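/- Consider the following system for a holomorphic function $f(b,c)$ on an open subset of $\mathbb C^2$ (the integrability conditions, by the method of hydrodynamic reductions, of the equation $u_{x_1x_2}+u_{x_1x_3}f(u_{x_2x_3},u_{x_3x_3})=0$ with $b=u_{x_2x_3}$, $c=u_{x_3x_3}$): \begin{align*} (ff_b-f_c)f_{bbb}&=f_{bb}(ff_{bb}+f_b^2-f_{bc}),\\ (ff_b-f_c)f_{bbc}&=f_{bb}(ff_{bc}+f_bf_c-f_{cc}),\\ (ff_b-f_c)f_{bcc}&=2ff_{bc}^2-ff_{bb}f_{cc}-f_{bc}f_{cc}+f_b^2f_{cc}-2f_bf_cf_{bc}+2f_c^2f_{bb},\\ (ff_b-f_c)f_{ccc}&=2f^2f_{bc}^2-2f^2f_{bb}f_{cc}+ff_{bc}f_{cc}+4ff_b^2f_{cc}-8ff_bf_cf_{bc}+4ff_c^2f_{bb}-f_{cc}^2-f_bf_cf_{cc}+2f_c^2f_{bc}. \end{align*} For $(\alpha,\beta)\in\mathbb R^2$, $\operatorname{Im}\tau>0$, $z\in\mathbb C$ let $$\vartheta_{\alpha\beta}(\tau,z)=\sum_{n\in\mathbb Z}e^{\pi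 i\left((n+\alpha/2)^2\tau+2(n+\alpha/2)(z+\beta/2)\right)},$$ and for $b\in\mathbb C$, $\operatorname{Re}c>0$ let $\psi(b,c)=\vartheta_{\alpha\beta}\left(\tfrac{ic}{\pi},\tfrac{b}{2\pi}\right)$ and $f_{\alpha\beta}=2\psi_b/\psi$, the latter where $\psi\ne0$. (1) For all $(\alpha,\beta)\in\mathbb R^2$ the series converges absolutely, $\psi$ is holomorphic on $\{\operatorname{Re}c>0\}$, and there it satisfies the heat equation $\psi_c=\psi_{bb}$ and the sixth-order ODE (where $\psi',\psi'',\dots,\psi^{(6)}$ are derivatives with respect to $b$) \begin{align*} &(\psi'''\psi^{(6)}-\psi^{(4)}\psi^{(5)})\psi^4+\bigl(2\psi'''((\psi''')^2-\psi'\psi^{(5)})+3\psi''(\psi''\psi^{(5)}-\psi'\psi^{(6)})+5\psi^{(4)}(\psi'\psi^{(4)}-\psi''\psi''')\bigr)\psi^3\\ &+\bigl(2(\psi')^3\psi^{(6)}+6(\psi')^2\psi''\psi^{(5)}-10(\psi')^2\psi'''\psi^{(4)}+2\psi'\psi''(\psi''')^2\bigr)\psi^2\\ &+6\bigl(2(\psi')^3(\psi''')^2-(\psi')^4\psi^{(5)}-(\psi'\psi'')^2\psi'''\bigr)\psi+6(\psi')^3\bigl((\psi')^2\psi^{(4)}-2\psi'\psi''\psi'''+(\psi'')^3\bigr)=0.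 \end{align*} Moreover, $f_{\alpha\beta}$ is a holomorphic solution of the system on the non-empty open set $\{\operatorname{Re}c>0,\ \psi\neq0\}$. (2) For all complex numbers $k,l,m,A,B,C,D$ with $k\ne0$ and $AD-BC\neq0$, the transformation $$f\mapsto\tilde f,\qquad \tilde f(b,c)=\frac{(AD-BC)\,f\!\left(\frac{kb+lc+m}{Cc+D},\frac{Ac+B}{Cc+D}\right)+lD-Cm-Ckb}{k(Cc+D)},$$ is a symmetry of the system: if $f$ is a holomorphic solution on an open set $U$, then $\tilde f$ is one on the open set of points $(b,c)$ with $Cc+D\neq0$ that are mapped into $U$. (3) Up to these symmetries, the generic solution of the system is $f_{\alpha\beta}$, for any characteristics. That is, there is a nonzero polynomial $P$ in six variables with complex coefficients such that for all $(\alpha,\beta)\in\mathbb R^2$: (a) $P(f,f_b,f_c,f_{bb},f_{bc},f_{cc})\ne0$ for $f=f_{\alpha\beta}$ at some point of its domain; (b) for every point $p\in\mathbb C^2$, every value $J\in\mathbb C^6$ of the 2-jet with $P(J)\ne0$ is the 2-jet $(f,f_b,f_c,f_{bb},f_{bc},f_{cc})$ at $p$ of some transform $\tilde f_{\alpha\beta}$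 defined near $p$; (c) if $f$ is a holomorphic solution on an open set $U$ and $P(f,f_b,f_c,f_{bb},f_{bc},f_{cc})\neq0$ at a point $p\in U$, then $f$ coincides near $p$ with some transform $\tilde f_{\alpha\beta}$. -/

import Mathlib

open Complex Topology Filter

noncomputable section

namespace HirotaTheta

/-- The partial derivative with respect to the first variable `b` of a function of
`p = (b, c)`. -/
def pdb (f : ℂ × ℂ → ℂ) : ℂ × ℂ → ℂ :=
  fun p => deriv (fun b => f (b, p.2)) p.1

/-- The partial derivative with respect to the second variable `c` of a function of
`p = (b, c)`. -/
def pdc (f : ℂ × ℂ → ℂ) : ℂ × ℂ → ℂ :=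
  fun p => deriv (fun c => f (p.1, c)) p.2

/-- The four third-order equations for `f (b, c)` (the integrability conditions of
`u_{x₁x₂} + u_{x₁x₃} f(u_{x₂x₃}, u_{x₃x₃}) = 0`), at the point `p = (b, c)`. -/
def IntegrabilityAt (f : ℂ × ℂ → ℂ) (p : ℂ × ℂ) : Prop :=
  let f₀ := f p
  let fb := pdb f p
  let fc := pdc f p
  let fbb := pdb (pdb f) p
  let fbc := pdc (pdb f) p
  let fcc := pdc (pdc f) p
  let fbbb := pdb (pdb (pdb f)) p
  let fbbc := pdc (pdb (pdb f)) p
  let fbcc := pdc (pdc (pdb f)) p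
  let fccc := pdc (pdc (pdc f)) p
  (f₀ * fb - fc) * fbbb = fbb * (f₀ * fbb + fb ^ 2 - fbc) ∧
  (f₀ * fb - fc) * fbbc = fbb * (f₀ * fbc + fb * fc - fcc) ∧
  (f₀ * fb - fc) * fbcc =
    2 * f₀ * fbc ^ 2 - f₀ * fbb * fcc - fbc * fcc + fb ^ 2 * fcc
      - 2 * fb * fc * fbc + 2 * fc ^ 2 * fbb ∧
  (f₀ * fb - fc) * fccc =
    2 * f₀ ^ 2 * fbc ^ 2 - 2 * f₀ ^ 2 * fbb * fcc + f₀ * fbc * fcc + 4 * f₀ * fb ^ 2 * fcc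
      - 8 * f₀ * fb * fc * fbc + 4 * f₀ * fc ^ 2 * fbb
      - fcc ^ 2 - fb * fc * fcc + 2 * fc ^ 2 * fbc

/-- `f` is a holomorphic solution of the integrability system on the open set `U ⊆ ℂ²`. -/
structure IsSolutionOn (f : ℂ × ℂ → ℂ) (U : Set (ℂ × ℂ)) : Prop where
  isOpen : IsOpen U
  analytic : AnalyticOnNhd ℂ f U
  eqns : ∀ p ∈ U, IntegrabilityAt f p

/-- The 2-jet `(f, f_b, f_c, f_bb, f_bc, f_cc)` of `f` at `p`. -/
def jet2 (f : ℂ × ℂ → ℂ) (p : ℂ × ℂ) : Fin 6 → ℂ :=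
  ![f p, pdb f p, pdc f p, pdb (pdb f) p, pdc (pdb f) p, pdc (pdc f) p]

/-- The left-hand side of the sixth-order ordinary differential equation (in `b`), at `p`. -/
def sixthOrderODE (ψ : ℂ × ℂ → ℂ) (p : ℂ × ℂ) : ℂ :=
  let y := ψ p
  let y1 := (pdb^[1] ψ) p
  let y2 := (pdb^[2] ψ) p
  let y3 := (pdb^[3] ψ) p
  let y4 := (pdb^[4] ψ) p
  let y5 := (pdb^[5] ψ) p
  let y6 := (pdb^[6] ψ) p
  (y3 * y6 - y4 * y5) * y ^ 4
    + (2 * y3 * (y3 ^ 2 - y1 * y5) + 3 * y2 * (y2 * y5 - y1 * y6)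
        + 5 * y4 * (y1 * y4 - y2 * y3)) * y ^ 3
    + (2 * y1 ^ 3 * y6 + 6 * y1 ^ 2 * y2 * y5 - 10 * y1 ^ 2 * y3 * y4
        + 2 * y1 * y2 * y3 ^ 2) * y ^ 2
    + 6 * (2 * y1 ^ 3 * y3 ^ 2 - y1 ^ 4 * y5 - (y1 * y2) ^ 2 * y3) * y
    + 6 * y1 ^ 3 * (y1 ^ 2 * y4 - 2 * y1 * y2 * y3 + y2 ^ 3)

/-- The `n`-th term of the Jacobi theta series with characteristics `(α, β)`. -/
def thetaTerm (α β : ℝ) (τ z : ℂ) (n : ℤ) : ℂ :=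
  cexp (Real.pi * I * ((n + α / 2) ^ 2 * τ + 2 * (n + α / 2) * (z + β / 2)))

/-- The Jacobi theta series `ϑ_{αβ}(τ, z)` with characteristics `(α, β)`. -/
def theta (α β : ℝ) (τ z : ℂ) : ℂ :=
  ∑' n : ℤ, thetaTerm α β τ z n

/-- `ψ(b, c) = ϑ_{αβ}(i c / π, b / 2π)`. -/
def psi (α β : ℝ) : ℂ × ℂ → ℂ :=
  fun p => theta α β (I * p.2 / Real.pi) (p.1 / (2 * Real.pi))

/-- `f = 2 ψ_b / ψ`. -/
def fTheta (α β : ℝ) : ℂ × ℂ → ℂ :=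
  fun p => 2 * pdb (psi α β) p / psi α β p

/-- The region `Re c > 0`, i.e. `Im (i c / π) > 0`, on which `ψ` is defined. -/
def halfSpace : Set (ℂ × ℂ) := {p | 0 < p.2.re}

/-- The region on which `f = 2 ψ_b / ψ` is defined. -/
def thetaDomain (α β : ℝ) : Set (ℂ × ℂ) := {p | 0 < p.2.re ∧ psi α β p ≠ 0}

/-- The parameters of a transformation of the `(b, c)`-plane
`(b, c) ↦ ((k b + l c + m) / (γ c + δ), (α c + β) / (γ c + δ))`,
with `k ≠ 0` and `α δ - β γ ≠ 0`. -/
structure Transf where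
  k : ℂ
  l : ℂ
  m : ℂ
  α : ℂ
  β : ℂ
  γ : ℂ
  δ : ℂ
  k_ne : k ≠ 0
  det_ne : α * δ - β * γ ≠ 0

namespace Transf

/-- The image of the point `(b, c)`; meaningful where `γ c + δ ≠ 0`. -/
def pt (g : Transf) (p : ℂ × ℂ) : ℂ × ℂ :=
  ((g.k * p.1 + g.l * p.2 + g.m) / (g.γ * p.2 + g.δ),
    (g.α * p.2 + g.β) / (g.γ * p.2 + g.δ))

/-- The points that `g` maps into `U`. -/
def dom (g : Transf) (U : Set (ℂ × ℂ)) : Set (ℂ × ℂ) :=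
  {p | g.γ * p.2 + g.δ ≠ 0 ∧ g.pt p ∈ U}

/-- The action on functions, for which `-f` transforms as the slope `db/dc` of a direction field:
`f̃(b, c) = ((α δ - β γ) f(B, C) + l δ - γ m - γ k b) / (k (γ c + δ))`, where `(B, C)` is the image
of `(b, c)`. -/
def act (g : Transf) (f : ℂ × ℂ → ℂ) : ℂ × ℂ → ℂ :=
  fun p => ((g.α * g.δ - g.β * g.γ) * f (g.pt p) + g.l * g.δ - g.γ * g.m - g.γ * g.k * p.1)
    / (g.k * (g.γ * p.2 + g.δ))

end Transf

end HirotaTheta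

end

namespace HirotaTheta

/-! ### Partial derivatives of analytic functions of two variables -/

/-! By the Cole–Hopf substitution, the heat equation for ψ makes f = 2ψ_b/ψ a solution of the
Burgers equation f_c = f_bb + f f_b. The addition formula `Th_addition` writes ψ(b+h)ψ(b−h) as a sum
of two products of a function of b and a function of h, the latter independent of the
characteristics. Its derivatives of order 0, 2, 4 at h = 0 are three linear forms in two unknowns,
hence linearly dependent with coefficients depending on c alone. This is the Hirota equation
`Th_bilinear`; it says that u = f_b satisfies u_bb = 6e(c)u − 3u² + r(c). Eliminating e and r from
it and its first two b-derivatives yields the sixth-order ODE, while Burgers and the constraint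
together imply the system by pure algebra (`IsEllipticBurgers.integrabilityAt`). The symmetries are
the chain rule: each transformed equation is a combination of the original ones.

For genericity, wherever f f_b − f_c ≠ 0 the system expresses all third derivatives through the
2-jet, so a solution is determined near a point by its 2-jet there
(`IsSolutionOn.eventuallyEq_of_jet2_eq`). It remains to move theta 2-jets onto every generic 2-jet
(`exists_jet2_act_fTheta_eq`). For a theta solution u_b² is a cubic in u, with depressed form 2x³ −
2Rx − S in x = e − u. A general 2-jet carries analogues of R, S and x up to scaling. The scale-free
ratio of R³ and S² is matched by the choice of c, then x by the choice of b, and the rest by the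
parameters of the transformation.

Two surjectivity statements make these choices possible. For fixed c, f_b takes every value
(`exists_pdb_fTheta_eq`), being an elliptic function with poles. The absolute invariant R³/disc
takes every value (`exists_absInv_eq`), being a modular function, holomorphic on the half-plane
because the cubic never degenerates (`disc_ne_zero`) and with a pole at the cusp. -/

lemma pdb_eq_fderiv {f : ℂ × ℂ → ℂ} {p : ℂ × ℂ} (hf : DifferentiableAt ℂ f p) :
    pdb f p = fderiv ℂ f p (1, 0) := by
  have h : HasDerivAt (fun b : ℂ => ((b, p.2) : ℂ × ℂ)) (1, 0) p.1 :=
    (hasDerivAt_id p.1).prodMk (hasDerivAt_const p.1 p.2)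
  exact (HasFDerivAt.comp_hasDerivAt (f := fun b : ℂ => ((b, p.2) : ℂ × ℂ)) p.1
    (hf.hasFDerivAt) h).deriv

lemma pdc_eq_fderiv {f : ℂ × ℂ → ℂ} {p : ℂ × ℂ} (hf : DifferentiableAt ℂ f p) :
    pdc f p = fderiv ℂ f p (0, 1) := by
  have h : HasDerivAt (fun c : ℂ => ((p.1, c) : ℂ × ℂ)) (0, 1) p.2 :=
    (hasDerivAt_const p.2 p.1).prodMk (hasDerivAt_id p.2)
  exact (HasFDerivAt.comp_hasDerivAt (f := fun c : ℂ => ((p.1, c) : ℂ × ℂ)) p.2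
    (hf.hasFDerivAt) h).deriv

lemma fderiv_apply_eq {f : ℂ × ℂ → ℂ} {p : ℂ × ℂ} (hf : DifferentiableAt ℂ f p) (v : ℂ × ℂ) :
    fderiv ℂ f p v = v.1 * pdb f p + v.2 * pdc f p := by
  rw [pdb_eq_fderiv hf, pdc_eq_fderiv hf, ← smul_eq_mul, ← smul_eq_mul, ← map_smul, ← map_smul,
    ← map_add]
  simp

/-- The chain rule along a curve in `ℂ²`. -/
lemma hasDerivAt_comp_curve {𝕜 : Type*} [NontriviallyNormedField 𝕜] [NormedAlgebra 𝕜 ℂ]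
    {f : ℂ × ℂ → ℂ} {x y : 𝕜 → ℂ} {x' y' : ℂ} {t : 𝕜}
    (hf : DifferentiableAt ℂ f (x t, y t)) (hx : HasDerivAt x x' t) (hy : HasDerivAt y y' t) :
    HasDerivAt (fun s => f (x s, y s)) (x' * pdb f (x t, y t) + y' * pdc f (x t, y t)) t := by
  have := HasFDerivAt.comp_hasDerivAt (f := fun s => ((x s, y s) : ℂ × ℂ)) t
    (hf.hasFDerivAt.restrictScalars 𝕜) (hx.prodMk hy)
  simpa [fderiv_apply_eq hf, Function.comp_def] using this

lemma hasDerivAt_pdb {f : ℂ × ℂ → ℂ} {p : ℂ × ℂ} (hf : DifferentiableAt ℂ f p) :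
    HasDerivAt (fun b => f (b, p.2)) (pdb f p) p.1 := by
  simpa using hasDerivAt_comp_curve (f := f) (x := fun b => b) (y := fun _ => p.2) (t := p.1) hf
    (hasDerivAt_id p.1) (hasDerivAt_const p.1 p.2)

lemma hasDerivAt_pdc {f : ℂ × ℂ → ℂ} {p : ℂ × ℂ} (hf : DifferentiableAt ℂ f p) :
    HasDerivAt (fun c => f (p.1, c)) (pdc f p) p.2 := by
  simpa using hasDerivAt_comp_curve (f := f) (x := fun _ => p.1) (y := fun c => c) (t := p.2) hf
    (hasDerivAt_const p.2 p.1) (hasDerivAt_id p.2)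

lemma eventually_slice_fst {p : ℂ × ℂ} {P : ℂ × ℂ → Prop} (h : ∀ᶠ q in 𝓝 p, P q) :
    ∀ᶠ b in 𝓝 p.1, P (b, p.2) :=
  (Continuous.tendsto (f := fun b : ℂ => ((b, p.2) : ℂ × ℂ)) (by fun_prop) p.1).eventually h

lemma eventually_slice_snd {p : ℂ × ℂ} {P : ℂ × ℂ → Prop} (h : ∀ᶠ q in 𝓝 p, P q) :
    ∀ᶠ c in 𝓝 p.2, P (p.1, c) :=
  (Continuous.tendsto (f := fun c : ℂ => ((p.1, c) : ℂ × ℂ)) (by fun_prop) p.2).eventually h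

lemma pdb_congr {f g : ℂ × ℂ → ℂ} {p : ℂ × ℂ} (h : f =ᶠ[𝓝 p] g) : pdb f p = pdb g p :=
  Filter.EventuallyEq.deriv_eq (eventually_slice_fst h)

lemma pdc_congr {f g : ℂ × ℂ → ℂ} {p : ℂ × ℂ} (h : f =ᶠ[𝓝 p] g) : pdc f p = pdc g p :=
  Filter.EventuallyEq.deriv_eq (eventually_slice_snd h)

lemma pdb_congr_on {f g : ℂ × ℂ → ℂ} {U : Set (ℂ × ℂ)} (hU : IsOpen U) (h : Set.EqOn f g U) :
    Set.EqOn (pdb f) (pdb g) U :=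
  fun _ hp => pdb_congr (h.eventuallyEq_of_mem (hU.mem_nhds hp))

lemma pdc_congr_on {f g : ℂ × ℂ → ℂ} {U : Set (ℂ × ℂ)} (hU : IsOpen U) (h : Set.EqOn f g U) :
    Set.EqOn (pdc f) (pdc g) U :=
  fun _ hp => pdc_congr (h.eventuallyEq_of_mem (hU.mem_nhds hp))

lemma analyticAt_pdb {f : ℂ × ℂ → ℂ} {p : ℂ × ℂ} (hf : AnalyticAt ℂ f p) :
    AnalyticAt ℂ (pdb f) p := by
  have h : AnalyticAt ℂ (fun q => fderiv ℂ f q (1, 0)) p :=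
    ((ContinuousLinearMap.apply ℂ ℂ ((1, 0) : ℂ × ℂ)).analyticAt _).comp hf.fderiv
  exact h.congr (hf.eventually_analyticAt.mono fun q hq => (pdb_eq_fderiv hq.differentiableAt).symm)

lemma analyticAt_pdc {f : ℂ × ℂ → ℂ} {p : ℂ × ℂ} (hf : AnalyticAt ℂ f p) :
    AnalyticAt ℂ (pdc f) p := by
  have h : AnalyticAt ℂ (fun q => fderiv ℂ f q (0, 1)) p :=
    ((ContinuousLinearMap.apply ℂ ℂ ((0, 1) : ℂ × ℂ)).analyticAt _).comp hf.fderiv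
  exact h.congr (hf.eventually_analyticAt.mono fun q hq => (pdc_eq_fderiv hq.differentiableAt).symm)

lemma analyticOnNhd_pdb {f : ℂ × ℂ → ℂ} {U : Set (ℂ × ℂ)} (hf : AnalyticOnNhd ℂ f U) :
    AnalyticOnNhd ℂ (pdb f) U := fun p hp => analyticAt_pdb (hf p hp)

lemma analyticOnNhd_pdc {f : ℂ × ℂ → ℂ} {U : Set (ℂ × ℂ)} (hf : AnalyticOnNhd ℂ f U) :
    AnalyticOnNhd ℂ (pdc f) U := fun p hp => analyticAt_pdc (hf p hp)

lemma pdb_pdc_comm {f : ℂ × ℂ → ℂ} {p : ℂ × ℂ} (hf : AnalyticAt ℂ f p) :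
    pdb (pdc f) p = pdc (pdb f) p := by
  have hs : IsSymmSndFDerivAt ℂ f p := hf.contDiffAt.isSymmSndFDerivAt (n := ⊤) (by simp)
  have hd := hf.fderiv.differentiableAt
  have h1 : pdc f =ᶠ[𝓝 p] fun q => fderiv ℂ f q (0, 1) :=
    hf.eventually_analyticAt.mono fun q hq => pdc_eq_fderiv hq.differentiableAt
  have h2 : pdb f =ᶠ[𝓝 p] fun q => fderiv ℂ f q (1, 0) :=
    hf.eventually_analyticAt.mono fun q hq => pdb_eq_fderiv hq.differentiableAt
  have key : ∀ v w : ℂ × ℂ, fderiv ℂ (fun q => fderiv ℂ f q v) p w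
      = fderiv ℂ (fderiv ℂ f) p w v := by
    intro v w
    rw [fderiv_clm_apply hd (differentiableAt_const v)]
    simp
  rw [pdb_congr h1, pdc_congr h2,
    pdb_eq_fderiv (hd.clm_apply (differentiableAt_const _)),
    pdc_eq_fderiv (hd.clm_apply (differentiableAt_const _)), key, key]
  exact hs _ _

end HirotaTheta


namespace HirotaTheta

/-! ### The transformations are symmetries of the system -/

namespace Transf

variable (g : Transf)

/-- The determinant `α δ - β γ`. -/
def det : ℂ := g.α * g.δ - g.β * g.γ

/-- The denominator `γ c + δ`. -/
def den (p : ℂ × ℂ) : ℂ := g.γ * p.2 + g.δ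

/-- The numerator `l δ - γ m - γ k b`. -/
def num (p : ℂ × ℂ) : ℂ := g.l * g.δ - g.γ * g.m - g.γ * g.k * p.1

lemma act_eq (f : ℂ × ℂ → ℂ) (p : ℂ × ℂ) :
    g.act f p = (g.det * f (g.pt p) + g.num p) / (g.k * g.den p) := by
  simp only [act, det, num, den]
  ring

lemma analyticAt_pt {p : ℂ × ℂ} (hp : g.den p ≠ 0) : AnalyticAt ℂ g.pt p := by
  have hb : AnalyticAt ℂ (fun q : ℂ × ℂ => q.1) p := analyticAt_fst
  have hc : AnalyticAt ℂ (fun q : ℂ × ℂ => q.2) p := analyticAt_snd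
  have hD : AnalyticAt ℂ (fun p : ℂ × ℂ => g.γ * p.2 + g.δ) p := by fun_prop
  exact AnalyticAt.prod ((by fun_prop : AnalyticAt ℂ (fun p : ℂ × ℂ =>
    g.k * p.1 + g.l * p.2 + g.m) p).div hD hp) ((by fun_prop : AnalyticAt ℂ (fun p : ℂ × ℂ =>
    g.α * p.2 + g.β) p).div hD hp)

lemma isOpen_dom {U : Set (ℂ × ℂ)} (hU : IsOpen U) : IsOpen (g.dom U) := by
  rw [isOpen_iff_mem_nhds]
  rintro p ⟨h1, h2⟩
  have hc : ContinuousAt g.den p := by unfold den; fun_prop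
  exact inter_mem (hc.preimage_mem_nhds (isOpen_ne.mem_nhds h1))
    ((g.analyticAt_pt h1).continuousAt.preimage_mem_nhds (hU.mem_nhds h2))

lemma analyticAt_act {f : ℂ × ℂ → ℂ} {p : ℂ × ℂ} (hp : g.den p ≠ 0)
    (hf : AnalyticAt ℂ f (g.pt p)) : AnalyticAt ℂ (g.act f) p := by
  have h1 : AnalyticAt ℂ (f ∘ g.pt) p := AnalyticAt.comp hf (g.analyticAt_pt hp)
  have hb : AnalyticAt ℂ (fun q : ℂ × ℂ => q.1) p := analyticAt_fst
  have hc : AnalyticAt ℂ (fun q : ℂ × ℂ => q.2) p := analyticAt_snd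
  have h2 : AnalyticAt ℂ (fun p : ℂ × ℂ => g.k * (g.γ * p.2 + g.δ)) p := by fun_prop
  have h3 : AnalyticAt ℂ (fun p : ℂ × ℂ => (g.α * g.δ - g.β * g.γ) * (f ∘ g.pt) p
      + g.l * g.δ - g.γ * g.m - g.γ * g.k * p.1) p :=
    (((analyticAt_const.mul h1).add analyticAt_const).sub analyticAt_const).sub
      (analyticAt_const.mul hb)
  exact h3.div h2 (mul_ne_zero g.k_ne hp)

variable {g} {f : ℂ × ℂ → ℂ} {p : ℂ × ℂ}

lemma hasDerivAt_den : HasDerivAt (fun c => g.den (p.1, c)) g.γ p.2 := by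
  simpa [den] using ((hasDerivAt_id p.2).const_mul g.γ).add_const g.δ

lemma hasDerivAt_num : HasDerivAt (fun b => g.num (b, p.2)) (-(g.γ * g.k)) p.1 := by
  simpa [num] using ((hasDerivAt_id p.1).const_mul (g.γ * g.k)).const_sub (g.l * g.δ - g.γ * g.m)

lemma hasDerivAt_comp_pt_fst (hf : AnalyticAt ℂ f (g.pt p)) :
    HasDerivAt (fun b => f (g.pt (b, p.2))) (g.k / g.den p * pdb f (g.pt p)) p.1 := by
  have hx : HasDerivAt (fun b : ℂ => (g.k * b + g.l * p.2 + g.m) / (g.γ * p.2 + g.δ))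
      (g.k / g.den p) p.1 := by
    simpa [den] using ((((hasDerivAt_id p.1).const_mul g.k).add_const (g.l * p.2)).add_const
      g.m).div_const (g.γ * p.2 + g.δ)
  simpa [pt] using hasDerivAt_comp_curve (f := f) (t := p.1) hf.differentiableAt hx
    (hasDerivAt_const p.1 ((g.α * p.2 + g.β) / (g.γ * p.2 + g.δ)))

/-- The inhomogeneous term `num` of the action reappears as the numerator of ∂B/∂c, where B is the
first coordinate of the image. It does not depend on c, so repeated c-derivatives act through the
single operator Δ∂_c + N∂_b together with derivatives of the denominator. -/
lemma hasDerivAt_comp_pt_snd (hp : g.den p ≠ 0) (hf : AnalyticAt ℂ f (g.pt p)) :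
    HasDerivAt (fun c => f (g.pt (p.1, c)))
      ((g.det * pdc f (g.pt p) + g.num p * pdb f (g.pt p)) / g.den p ^ 2) p.2 := by
  have hD : HasDerivAt (fun c => g.γ * c + g.δ) g.γ p.2 := hasDerivAt_den (p := p)
  have hp' : g.γ * p.2 + g.δ ≠ 0 := hp
  have hx : HasDerivAt (fun c => (g.k * p.1 + g.l * c + g.m) / (g.γ * c + g.δ))
      (g.num p / g.den p ^ 2) p.2 := by
    refine (((((hasDerivAt_id' p.2).const_mul g.l).const_add (g.k * p.1)).add_const g.m).div
      hD hp').congr_deriv ?_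
    simp only [den, num]
    ring
  have hy : HasDerivAt (fun c => (g.α * c + g.β) / (g.γ * c + g.δ))
      (g.det / g.den p ^ 2) p.2 := by
    refine ((((hasDerivAt_id' p.2).const_mul g.α).add_const g.β).div hD hp').congr_deriv ?_
    simp only [den, det]
    ring
  refine (hasDerivAt_comp_curve (f := f) (t := p.2) hf.differentiableAt hx hy).congr_deriv ?_
  simp only [pt]
  ring

section derivatives

variable {U : Set (ℂ × ℂ)}

lemma pdb_act (hf : AnalyticOnNhd ℂ f U) :
    Set.EqOn (pdb (g.act f))
    (fun p => g.det * pdb f (g.pt p) / g.den p ^ 2 - g.γ / g.den p) (g.dom U) := by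
  rintro p ⟨hp : g.den p ≠ 0, hq⟩
  have hk := g.k_ne
  have h := (((hasDerivAt_comp_pt_fst (hf _ hq)).const_mul g.det).add
    (hasDerivAt_num (g := g) (p := p))).div_const (g.k * g.den p)
  have e : (fun b => g.act f (b, p.2)) = fun b =>
      (g.det * f (g.pt (b, p.2)) + g.num (b, p.2)) / (g.k * g.den p) := by
    ext b; rw [act_eq]; rfl
  rw [pdb, e]
  refine h.deriv.trans ?_
  field_simp
  ring

lemma pdc_act (hf : AnalyticOnNhd ℂ f U) :
    Set.EqOn (pdc (g.act f))
    (fun p => g.det * (g.det * pdc f (g.pt p) + g.num p * pdb f (g.pt p)) / (g.k * g.den p ^ 3)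
      - g.γ * (g.det * f (g.pt p) + g.num p) / (g.k * g.den p ^ 2)) (g.dom U) := by
  rintro p ⟨hp : g.den p ≠ 0, hq⟩
  have hk := g.k_ne
  have h := (((hasDerivAt_comp_pt_snd hp (hf _ hq)).const_mul g.det).add_const (g.num p)).div
    ((hasDerivAt_den (g := g) (p := p)).const_mul g.k) (mul_ne_zero hk hp)
  have e : (fun c => g.act f (p.1, c)) = fun c =>
      (g.det * f (g.pt (p.1, c)) + g.num p) / (g.k * g.den (p.1, c)) := by
    ext c; rw [act_eq]; rfl
  rw [pdc, e]
  refine h.deriv.trans ?_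
  field_simp

lemma pdb_pdb_act (hU : IsOpen U) (hf : AnalyticOnNhd ℂ f U) :
    Set.EqOn (pdb (pdb (g.act f)))
    (fun p => g.det * g.k * pdb (pdb f) (g.pt p) / g.den p ^ 3) (g.dom U) := by
  intro p hp
  rw [pdb_congr_on (g.isOpen_dom hU) (pdb_act hf) hp]
  obtain ⟨hp : g.den p ≠ 0, hq⟩ := hp
  have h := (((hasDerivAt_comp_pt_fst (analyticOnNhd_pdb hf _ hq)).const_mul g.det).div_const
    (g.den p ^ 2)).sub_const (g.γ / g.den p)
  refine h.deriv.trans ?_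
  field_simp

lemma pdb_pdb_pdb_act (hU : IsOpen U) (hf : AnalyticOnNhd ℂ f U) :
    Set.EqOn (pdb (pdb (pdb (g.act f))))
    (fun p => g.det * g.k ^ 2 * pdb (pdb (pdb f)) (g.pt p) / g.den p ^ 4) (g.dom U) := by
  intro p hp
  rw [pdb_congr_on (g.isOpen_dom hU) (pdb_pdb_act hU hf) hp]
  obtain ⟨hp : g.den p ≠ 0, hq⟩ := hp
  have h := (((hasDerivAt_comp_pt_fst (analyticOnNhd_pdb (analyticOnNhd_pdb hf) _ hq)).const_mul
    (g.det * g.k)).div_const (g.den p ^ 3))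
  refine h.deriv.trans ?_
  field_simp

lemma pdc_pdb_act (hU : IsOpen U) (hf : AnalyticOnNhd ℂ f U) :
    Set.EqOn (pdc (pdb (g.act f)))
    (fun p => g.det * (g.det * pdc (pdb f) (g.pt p) + g.num p * pdb (pdb f) (g.pt p)) / g.den p ^ 4
      - 2 * g.γ * g.det * pdb f (g.pt p) / g.den p ^ 3 + g.γ ^ 2 / g.den p ^ 2) (g.dom U) := by
  intro p hp
  rw [pdc_congr_on (g.isOpen_dom hU) (pdb_act hf) hp]
  obtain ⟨hp : g.den p ≠ 0, hq⟩ := hp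
  have hd := hasDerivAt_den (g := g) (p := p)
  have h := (((hasDerivAt_comp_pt_snd hp (analyticOnNhd_pdb hf _ hq)).const_mul g.det).div
    (hd.pow 2) (pow_ne_zero 2 hp)).sub ((hasDerivAt_const p.2 g.γ).div hd hp)
  refine h.deriv.trans ?_
  simp only [Pi.pow_apply]
  field_simp
  ring

lemma pdc_pdb_pdb_act (hU : IsOpen U) (hf : AnalyticOnNhd ℂ f U) :
    Set.EqOn (pdc (pdb (pdb (g.act f))))
    (fun p => g.det * g.k * (g.det * pdc (pdb (pdb f)) (g.pt p)
        + g.num p * pdb (pdb (pdb f)) (g.pt p)) / g.den p ^ 5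
      - 3 * g.γ * g.det * g.k * pdb (pdb f) (g.pt p) / g.den p ^ 4) (g.dom U) := by
  intro p hp
  rw [pdc_congr_on (g.isOpen_dom hU) (pdb_pdb_act hU hf) hp]
  obtain ⟨hp : g.den p ≠ 0, hq⟩ := hp
  have hd := hasDerivAt_den (g := g) (p := p)
  have h := (((hasDerivAt_comp_pt_snd hp (analyticOnNhd_pdb (analyticOnNhd_pdb hf) _ hq)).const_mul
    (g.det * g.k)).div (hd.pow 3) (pow_ne_zero 3 hp))
  refine h.deriv.trans ?_
  simp only [Pi.pow_apply]
  field_simp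
  ring

lemma pdc_pdc_act (hU : IsOpen U) (hf : AnalyticOnNhd ℂ f U) :
    Set.EqOn (pdc (pdc (g.act f)))
    (fun p => g.det * (g.det ^ 2 * pdc (pdc f) (g.pt p) + 2 * g.det * g.num p * pdc (pdb f) (g.pt p)
        + g.num p ^ 2 * pdb (pdb f) (g.pt p)) / (g.k * g.den p ^ 5)
      - 4 * g.γ * g.det * (g.det * pdc f (g.pt p) + g.num p * pdb f (g.pt p)) / (g.k * g.den p ^ 4)
      + 2 * g.γ ^ 2 * (g.det * f (g.pt p) + g.num p) / (g.k * g.den p ^ 3)) (g.dom U) := by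
  intro p hp
  rw [pdc_congr_on (g.isOpen_dom hU) (pdc_act hf) hp]
  obtain ⟨hp : g.den p ≠ 0, hq⟩ := hp
  have hk := g.k_ne
  have hd := hasDerivAt_den (g := g) (p := p)
  have h0 := hasDerivAt_comp_pt_snd hp (hf _ hq)
  have hb := hasDerivAt_comp_pt_snd hp (analyticOnNhd_pdb hf _ hq)
  have hc := hasDerivAt_comp_pt_snd hp (analyticOnNhd_pdc hf _ hq)
  rw [pdb_pdc_comm (hf _ hq)] at hc
  have h := ((((hc.const_mul g.det).add (hb.const_mul (g.num p))).const_mul g.det).div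
    ((hd.pow 3).const_mul g.k) (mul_ne_zero hk (pow_ne_zero 3 hp))).sub
    ((((h0.const_mul g.det).add_const (g.num p)).const_mul g.γ).div
    ((hd.pow 2).const_mul g.k) (mul_ne_zero hk (pow_ne_zero 2 hp)))
  refine h.deriv.trans ?_
  simp only [Pi.pow_apply, Pi.add_apply]
  field_simp
  ring

lemma pdc_pdc_pdb_act (hU : IsOpen U) (hf : AnalyticOnNhd ℂ f U) :
    Set.EqOn (pdc (pdc (pdb (g.act f))))
    (fun p => g.det * (g.det ^ 2 * pdc (pdc (pdb f)) (g.pt p)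
        + 2 * g.det * g.num p * pdc (pdb (pdb f)) (g.pt p)
        + g.num p ^ 2 * pdb (pdb (pdb f)) (g.pt p)) / g.den p ^ 6
      - 6 * g.γ * g.det * (g.det * pdc (pdb f) (g.pt p) + g.num p * pdb (pdb f) (g.pt p))
        / g.den p ^ 5
      + 6 * g.γ ^ 2 * g.det * pdb f (g.pt p) / g.den p ^ 4
      - 2 * g.γ ^ 3 / g.den p ^ 3) (g.dom U) := by
  intro p hp
  rw [pdc_congr_on (g.isOpen_dom hU) (pdc_pdb_act hU hf) hp]
  obtain ⟨hp : g.den p ≠ 0, hq⟩ := hp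
  have hd := hasDerivAt_den (g := g) (p := p)
  have hfb := analyticOnNhd_pdb hf
  have h0 := hasDerivAt_comp_pt_snd hp (hfb _ hq)
  have hb := hasDerivAt_comp_pt_snd hp (analyticOnNhd_pdb hfb _ hq)
  have hc := hasDerivAt_comp_pt_snd hp (analyticOnNhd_pdc hfb _ hq)
  rw [pdb_pdc_comm (hfb _ hq)] at hc
  have h := (((((hc.const_mul g.det).add (hb.const_mul (g.num p))).const_mul g.det).div
    (hd.pow 4) (pow_ne_zero 4 hp)).sub
    ((h0.const_mul (2 * g.γ * g.det)).div (hd.pow 3) (pow_ne_zero 3 hp))).add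
    ((hasDerivAt_const p.2 (g.γ ^ 2)).div (hd.pow 2) (pow_ne_zero 2 hp))
  refine h.deriv.trans ?_
  simp only [Pi.pow_apply, Pi.add_apply]
  field_simp
  ring

lemma pdc_pdc_pdc_act (hU : IsOpen U) (hf : AnalyticOnNhd ℂ f U) :
    Set.EqOn (pdc (pdc (pdc (g.act f))))
    (fun p => g.det * (g.det ^ 3 * pdc (pdc (pdc f)) (g.pt p)
        + 3 * g.det ^ 2 * g.num p * pdc (pdc (pdb f)) (g.pt p)
        + 3 * g.det * g.num p ^ 2 * pdc (pdb (pdb f)) (g.pt p)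
        + g.num p ^ 3 * pdb (pdb (pdb f)) (g.pt p)) / (g.k * g.den p ^ 7)
      - 9 * g.γ * g.det * (g.det ^ 2 * pdc (pdc f) (g.pt p)
        + 2 * g.det * g.num p * pdc (pdb f) (g.pt p)
        + g.num p ^ 2 * pdb (pdb f) (g.pt p)) / (g.k * g.den p ^ 6)
      + 18 * g.γ ^ 2 * g.det * (g.det * pdc f (g.pt p) + g.num p * pdb f (g.pt p))
        / (g.k * g.den p ^ 5)
      - 6 * g.γ ^ 3 * (g.det * f (g.pt p) + g.num p) / (g.k * g.den p ^ 4)) (g.dom U) := by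
  intro p hp
  rw [pdc_congr_on (g.isOpen_dom hU) (pdc_pdc_act hU hf) hp]
  obtain ⟨hp : g.den p ≠ 0, hq⟩ := hp
  have hk := g.k_ne
  have hd := hasDerivAt_den (g := g) (p := p)
  have hfb := analyticOnNhd_pdb hf
  have hfc := analyticOnNhd_pdc hf
  have h0 := hasDerivAt_comp_pt_snd hp (hf _ hq)
  have hb := hasDerivAt_comp_pt_snd hp (hfb _ hq)
  have hc := hasDerivAt_comp_pt_snd hp (hfc _ hq)
  have hbb := hasDerivAt_comp_pt_snd hp (analyticOnNhd_pdb hfb _ hq)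
  have hbc := hasDerivAt_comp_pt_snd hp (analyticOnNhd_pdc hfb _ hq)
  have hcc := hasDerivAt_comp_pt_snd hp (analyticOnNhd_pdc hfc _ hq)
  have hcomm : pdb (pdc (pdc f)) (g.pt p) = pdc (pdc (pdb f)) (g.pt p) := by
    rw [pdb_pdc_comm (hfc _ hq),
      pdc_congr_on hU (fun q hq => pdb_pdc_comm (hf q hq)) hq]
  rw [pdb_pdc_comm (hf _ hq)] at hc
  rw [pdb_pdc_comm (hfb _ hq)] at hbc
  rw [hcomm] at hcc
  have h := (((((hcc.const_mul (g.det ^ 2)).add (hbc.const_mul (2 * g.det * g.num p))).add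
      (hbb.const_mul (g.num p ^ 2))).const_mul g.det).div
      ((hd.pow 5).const_mul g.k) (mul_ne_zero hk (pow_ne_zero 5 hp))).sub
    ((((hc.const_mul g.det).add (hb.const_mul (g.num p))).const_mul (4 * g.γ * g.det)).div
      ((hd.pow 4).const_mul g.k) (mul_ne_zero hk (pow_ne_zero 4 hp)))
  have h' := h.add
    ((((h0.const_mul g.det).add_const (g.num p)).const_mul (2 * g.γ ^ 2)).div
      ((hd.pow 3).const_mul g.k) (mul_ne_zero hk (pow_ne_zero 3 hp)))
  refine h'.deriv.trans ?_
  simp only [Pi.pow_apply, Pi.add_apply]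
  field_simp
  ring

end derivatives

end Transf

theorem IsSolutionOn.act {f : ℂ × ℂ → ℂ} {U : Set (ℂ × ℂ)} (h : IsSolutionOn f U) (g : Transf) :
    IsSolutionOn (g.act f) (g.dom U) where
  isOpen := g.isOpen_dom h.isOpen
  analytic := fun _ hp => g.analyticAt_act hp.1 (h.analytic _ hp.2)
  eqns := by
    intro p hp
    obtain ⟨e1, e2, e3, e4⟩ := h.eqns _ hp.2
    have hD : g.den p ≠ 0 := hp.1
    have hk := g.k_ne
    simp only [IntegrabilityAt, Transf.pdb_act h.analytic hp,
      Transf.pdc_act h.analytic hp, Transf.pdb_pdb_act h.isOpen h.analytic hp,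
      Transf.pdc_pdb_act h.isOpen h.analytic hp, Transf.pdc_pdc_act h.isOpen h.analytic hp,
      Transf.pdb_pdb_pdb_act h.isOpen h.analytic hp, Transf.pdc_pdb_pdb_act h.isOpen h.analytic hp,
      Transf.pdc_pdc_pdb_act h.isOpen h.analytic hp, Transf.pdc_pdc_pdc_act h.isOpen h.analytic hp,
      Transf.act_eq]
    generalize pdb (pdb (pdb f)) (g.pt p) = fbbb at *
    generalize pdc (pdb (pdb f)) (g.pt p) = fbbc at *
    generalize pdc (pdc (pdb f)) (g.pt p) = fbcc at *
    generalize pdc (pdc (pdc f)) (g.pt p) = fccc at *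
    generalize pdb (pdb f) (g.pt p) = fbb at *
    generalize pdc (pdb f) (g.pt p) = fbc at *
    generalize pdc (pdc f) (g.pt p) = fcc at *
    generalize pdb f (g.pt p) = fb at *
    generalize pdc f (g.pt p) = fc at *
    generalize f (g.pt p) = f₀ at *
    generalize g.det = Δ at *
    generalize g.num p = N at *
    generalize g.den p = D at *
    generalize g.γ = γ at *
    generalize g.k = k at *
    -- The factor f f_b − f_c is a relative invariant: it is only multiplied by Δ²/(kD³), so no new
    -- denominators enter.
    have hdel : (Δ * f₀ + N) / (k * D) * (Δ * fb / D ^ 2 - γ / D)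
        - (Δ * (Δ * fc + N * fb) / (k * D ^ 3) - γ * (Δ * f₀ + N) / (k * D ^ 2))
        = Δ ^ 2 * (f₀ * fb - fc) / (k * D ^ 3) := by
      field_simp
      ring
    rw [hdel]
    refine ⟨?_, ?_, ?_, ?_⟩
    -- Third derivatives in the direction Δ∂_c + N∂_b expand binomially, which explains the
    -- multipliers 1; 1, 1; 1, 2, 1; 1, 3, 3, 1 in powers of N.
    · linear_combination (norm := skip) (Δ ^ 3 * k / D ^ 7) * e1
      field_simp
      ring
    · linear_combination (norm := skip) (Δ ^ 4 / D ^ 8) * e2 + (Δ ^ 3 * N / D ^ 8) * e1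
      field_simp
      ring
    · linear_combination (norm := skip) (Δ ^ 5 / (k * D ^ 9)) * e3
        + (2 * Δ ^ 4 * N / (k * D ^ 9)) * e2 + (Δ ^ 3 * N ^ 2 / (k * D ^ 9)) * e1
      field_simp
      ring
    · linear_combination (norm := skip) (Δ ^ 6 / (k ^ 2 * D ^ 10)) * e4
        + (3 * Δ ^ 5 * N / (k ^ 2 * D ^ 10)) * e3 + (3 * Δ ^ 4 * N ^ 2 / (k ^ 2 * D ^ 10)) * e2
        + (Δ ^ 3 * N ^ 3 / (k ^ 2 * D ^ 10)) * e1
      field_simp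
      ring

end HirotaTheta


namespace HirotaTheta

/-! ### A solution is determined by its 2-jet at a point -/

/-- The `b`-derivative of the 2-jet of a solution, as a function of the 2-jet. -/
noncomputable def jetFieldB (x : Fin 6 → ℂ) : Fin 6 → ℂ :=
  ![x 1, x 3, x 4,
    (x 3 * (x 0 * x 3 + x 1 ^ 2 - x 4)) / (x 0 * x 1 - x 2),
    (x 3 * (x 0 * x 4 + x 1 * x 2 - x 5)) / (x 0 * x 1 - x 2),
    (2 * x 0 * x 4 ^ 2 - x 0 * x 3 * x 5 - x 4 * x 5 + x 1 ^ 2 * x 5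
      - 2 * x 1 * x 2 * x 4 + 2 * x 2 ^ 2 * x 3) / (x 0 * x 1 - x 2)]

/-- The `c`-derivative of the 2-jet of a solution, as a function of the 2-jet. -/
noncomputable def jetFieldC (x : Fin 6 → ℂ) : Fin 6 → ℂ :=
  ![x 2, x 4, x 5,
    (x 3 * (x 0 * x 4 + x 1 * x 2 - x 5)) / (x 0 * x 1 - x 2),
    (2 * x 0 * x 4 ^ 2 - x 0 * x 3 * x 5 - x 4 * x 5 + x 1 ^ 2 * x 5
      - 2 * x 1 * x 2 * x 4 + 2 * x 2 ^ 2 * x 3) / (x 0 * x 1 - x 2),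
    (2 * x 0 ^ 2 * x 4 ^ 2 - 2 * x 0 ^ 2 * x 3 * x 5 + x 0 * x 4 * x 5 + 4 * x 0 * x 1 ^ 2 * x 5
      - 8 * x 0 * x 1 * x 2 * x 4 + 4 * x 0 * x 2 ^ 2 * x 3
      - x 5 ^ 2 - x 1 * x 2 * x 5 + 2 * x 2 ^ 2 * x 4) / (x 0 * x 1 - x 2)]

lemma contDiffAt_jetFieldB {x : Fin 6 → ℂ} (hx : x 0 * x 1 - x 2 ≠ 0) :
    ContDiffAt ℂ 1 jetFieldB x := by
  rw [contDiffAt_pi]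
  intro i
  fin_cases i <;> simp [jetFieldB] <;> fun_prop

lemma contDiffAt_jetFieldC {x : Fin 6 → ℂ} (hx : x 0 * x 1 - x 2 ≠ 0) :
    ContDiffAt ℂ 1 jetFieldC x := by
  rw [contDiffAt_pi]
  intro i
  fin_cases i <;> simp [jetFieldC] <;> fun_prop

lemma continuousAt_jet2 {f : ℂ × ℂ → ℂ} {p : ℂ × ℂ} (hf : AnalyticAt ℂ f p) :
    ContinuousAt (jet2 f) p := by
  have hb := analyticAt_pdb hf
  have hc := analyticAt_pdc hf
  rw [continuousAt_pi]
  intro i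
  fin_cases i
  · exact hf.continuousAt
  · exact hb.continuousAt
  · exact hc.continuousAt
  · exact (analyticAt_pdb hb).continuousAt
  · exact (analyticAt_pdc hb).continuousAt
  · exact (analyticAt_pdc hc).continuousAt

/-- Once f f_b − f_c ≠ 0, the four equations can be solved for all third derivatives, so the 2-jet
along any curve obeys a closed first-order ODE. -/
lemma IsSolutionOn.hasDerivAt_jet2 {f : ℂ × ℂ → ℂ} {U : Set (ℂ × ℂ)} (h : IsSolutionOn f U)
    {x y : ℝ → ℂ} {x' y' : ℂ} {t : ℝ} (hx : HasDerivAt x x' t) (hy : HasDerivAt y y' t)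
    (hU : (x t, y t) ∈ U)
    (hd : jet2 f (x t, y t) 0 * jet2 f (x t, y t) 1 - jet2 f (x t, y t) 2 ≠ 0) :
    HasDerivAt (fun s => jet2 f (x s, y s))
      (x' • jetFieldB (jet2 f (x t, y t)) + y' • jetFieldC (jet2 f (x t, y t))) t := by
  have hf := h.analytic
  have hfb := analyticOnNhd_pdb hf
  have hfc := analyticOnNhd_pdc hf
  obtain ⟨e1, e2, e3, e4⟩ := h.eqns _ hU
  have hd' : f (x t, y t) * pdb f (x t, y t) - pdc f (x t, y t) ≠ 0 := hd
  have key : ∀ {F : ℂ × ℂ → ℂ}, AnalyticAt ℂ F (x t, y t) →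
      HasDerivAt (fun s => F (x s, y s)) (x' * pdb F (x t, y t) + y' * pdc F (x t, y t)) t :=
    fun hF => hasDerivAt_comp_curve hF.differentiableAt hx hy
  have hbcc : pdb (pdc (pdc f)) (x t, y t) = pdc (pdc (pdb f)) (x t, y t) := by
    rw [pdb_pdc_comm (hfc _ hU), pdc_congr_on h.isOpen (fun q hq => pdb_pdc_comm (hf q hq)) hU]
  rw [hasDerivAt_pi]
  intro i
  fin_cases i
  · exact key (hf _ hU)
  · exact key (hfb _ hU)
  · refine (key (hfc _ hU)).congr_deriv ?_
    rw [pdb_pdc_comm (hf _ hU)]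
    rfl
  · refine (key (analyticOnNhd_pdb hfb _ hU)).congr_deriv ?_
    change _ = x' * (_ / _) + y' * (_ / _)
    congr 2
    · exact eq_div_of_mul_eq hd' (by rw [mul_comm]; exact e1)
    · exact eq_div_of_mul_eq hd' (by rw [mul_comm]; exact e2)
  · refine (key (analyticOnNhd_pdc hfb _ hU)).congr_deriv ?_
    rw [pdb_pdc_comm (hfb _ hU)]
    change _ = x' * (_ / _) + y' * (_ / _)
    congr 2
    · exact eq_div_of_mul_eq hd' (by rw [mul_comm]; exact e2)
    · exact eq_div_of_mul_eq hd' (by rw [mul_comm]; exact e3)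
  · refine (key (analyticOnNhd_pdc hfc _ hU)).congr_deriv ?_
    rw [hbcc]
    change _ = x' * (_ / _) + y' * (_ / _)
    congr 2
    · exact eq_div_of_mul_eq hd' (by rw [mul_comm]; exact e3)
    · exact eq_div_of_mul_eq hd' (by rw [mul_comm]; exact e4)

/-- On the segment from p to a nearby point q both 2-jets solve the same autonomous ODE with
Lipschitz right-hand side and the same initial value, so they agree at q. -/
theorem IsSolutionOn.eventuallyEq_of_jet2_eq {f₁ f₂ : ℂ × ℂ → ℂ} {U₁ U₂ : Set (ℂ × ℂ)}
    (h₁ : IsSolutionOn f₁ U₁) (h₂ : IsSolutionOn f₂ U₂) {p : ℂ × ℂ} (hp₁ : p ∈ U₁) (hp₂ : p ∈ U₂)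
    (hj : jet2 f₁ p = jet2 f₂ p) (hd : jet2 f₁ p 0 * jet2 f₁ p 1 - jet2 f₁ p 2 ≠ 0) :
    f₁ =ᶠ[𝓝 p] f₂ := by
  obtain ⟨K₁, s₁, hs₁, hL₁⟩ := (contDiffAt_jetFieldB hd).exists_lipschitzOnWith
  obtain ⟨K₂, s₂, hs₂, hL₂⟩ := (contDiffAt_jetFieldC hd).exists_lipschitzOnWith
  have hs₃ : {x : Fin 6 → ℂ | x 0 * x 1 - x 2 ≠ 0} ∈ 𝓝 (jet2 f₁ p) :=
    ContinuousAt.preimage_mem_nhds (f := fun x : Fin 6 → ℂ => x 0 * x 1 - x 2) (by fun_prop)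
      (isOpen_ne.mem_nhds hd)
  have hs := inter_mem (inter_mem hs₁ hs₂) hs₃
  set s := s₁ ∩ s₂ ∩ {x : Fin 6 → ℂ | x 0 * x 1 - x 2 ≠ 0} with hs_def
  have ev₁ : ∀ᶠ q in 𝓝 p, jet2 f₁ q ∈ s := (continuousAt_jet2 (h₁.analytic p hp₁)) hs
  have ev₂ : ∀ᶠ q in 𝓝 p, jet2 f₂ q ∈ s := (continuousAt_jet2 (h₂.analytic p hp₂)) (hj ▸ hs)
  have hU₁ : ∀ᶠ q in 𝓝 p, q ∈ U₁ := h₁.isOpen.mem_nhds hp₁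
  have hU₂ : ∀ᶠ q in 𝓝 p, q ∈ U₂ := h₂.isOpen.mem_nhds hp₂
  obtain ⟨ε, hε, hball⟩ := Metric.eventually_nhds_iff_ball.1 ((hU₁.and hU₂).and (ev₁.and ev₂))
  filter_upwards [Metric.ball_mem_nhds p hε] with q hq
  have hmem : ∀ t ∈ Set.Icc (0 : ℝ) 1,
      (p.1 + t * (q.1 - p.1), p.2 + t * (q.2 - p.2)) ∈ Metric.ball p ε := by
    intro t ht
    have := (convex_ball p ε).add_smul_sub_mem (Metric.mem_ball_self hε) hq ht
    have e : p + t • (q - p) = (p.1 + t * (q.1 - p.1), p.2 + t * (q.2 - p.2)) := by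
      ext <;> simp
    rwa [e] at this
  have hline : ∀ (a v : ℂ) (t : ℝ), HasDerivAt (fun s : ℝ => a + s * v) v t := by
    intro a v t
    simpa using (((hasDerivAt_id t).ofReal_comp).mul_const v).const_add a
  have main : ∀ (f : ℂ × ℂ → ℂ) (U : Set (ℂ × ℂ)), IsSolutionOn f U →
      (∀ r ∈ Metric.ball p ε, r ∈ U ∧ jet2 f r ∈ s) → ∀ t ∈ Set.Icc (0 : ℝ) 1,
      HasDerivAt (fun t : ℝ => jet2 f (p.1 + t * (q.1 - p.1), p.2 + t * (q.2 - p.2)))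
        ((q.1 - p.1) • jetFieldB (jet2 f (p.1 + t * (q.1 - p.1), p.2 + t * (q.2 - p.2)))
        + (q.2 - p.2) • jetFieldC (jet2 f (p.1 + t * (q.1 - p.1), p.2 + t * (q.2 - p.2)))) t := by
    intro f U h hU t ht
    have := hU _ (hmem t ht)
    exact h.hasDerivAt_jet2 (hline _ _ t) (hline _ _ t) this.1 this.2.2
  have m₁ := main f₁ U₁ h₁ fun r hr => ⟨(hball r hr).1.1, (hball r hr).2.1⟩
  have m₂ := main f₂ U₂ h₂ fun r hr => ⟨(hball r hr).1.2, (hball r hr).2.2⟩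
  have hLip : ∀ t ∈ Set.Ico (0 : ℝ) 1, LipschitzOnWith (‖q.1 - p.1‖₊ * K₁ + ‖q.2 - p.2‖₊ * K₂)
      (fun x => (q.1 - p.1) • jetFieldB x + (q.2 - p.2) • jetFieldC x) s := by
    intro t _
    exact LipschitzOnWith.add
      ((lipschitzWith_smul (q.1 - p.1)).comp_lipschitzOnWith
        (hL₁.mono (Set.inter_subset_left.trans Set.inter_subset_left)))
      ((lipschitzWith_smul (q.2 - p.2)).comp_lipschitzOnWith
        (hL₂.mono (Set.inter_subset_left.trans Set.inter_subset_right)))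
  have := ODE_solution_unique_of_mem_Icc_right (s := fun _ => s)
    (v := fun _ x => (q.1 - p.1) • jetFieldB x + (q.2 - p.2) • jetFieldC x)
    hLip (fun t ht => (m₁ t ht).continuousAt.continuousWithinAt)
    (fun t ht => (m₁ t (Set.Ico_subset_Icc_self ht)).hasDerivWithinAt)
    (fun t ht => (hball _ (hmem t (Set.Ico_subset_Icc_self ht))).2.1)
    (fun t ht => (m₂ t ht).continuousAt.continuousWithinAt)
    (fun t ht => (m₂ t (Set.Ico_subset_Icc_self ht)).hasDerivWithinAt)
    (fun t ht => (hball _ (hmem t (Set.Ico_subset_Icc_self ht))).2.2)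
    (by simpa using hj) (Set.right_mem_Icc.2 zero_le_one)
  have := congrFun this 0
  simpa [jet2] using this

end HirotaTheta


namespace HirotaTheta

/-! ### Theta series and their derivatives -/

/-- A normally convergent series of products of holomorphic functions of `b` and of `c` is
analytic in `(b, c)`. -/
lemma analyticAt_tsum_mul {d a : ℤ → ℂ → ℂ} {U V : Set ℂ} {v u : ℤ → ℝ} (hU : IsOpen U)
    (hV : IsOpen V) (hv : Summable v) (hu : Summable u)
    (hd : ∀ n, DifferentiableOn ℂ (d n) U) (ha : ∀ n, DifferentiableOn ℂ (a n) V)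
    (hdv : ∀ n, ∀ b ∈ U, ‖d n b‖ ≤ v n) (hau : ∀ n, ∀ c ∈ V, ‖a n c‖ ≤ u n)
    {p : ℂ × ℂ} (hp₁ : p.1 ∈ U) (hp₂ : p.2 ∈ V) :
    AnalyticAt ℂ (fun q : ℂ × ℂ => ∑' n, d n q.1 * a n q.2) p := by
  -- Joint analyticity comes from one-variable analyticity with Banach values: c ↦ (a_n(c)) is
  -- analytic into ℓ¹, b ↦ (d_n(b)) is analytic into its dual, and the series is the pairing of the
  -- two.
  let E := lp (fun _ : ℤ => ℂ) 1
  let e : ℤ → E := fun n => lp.single 1 n (1 : ℂ)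
  let φ : ℤ → (E →L[ℂ] ℂ) := fun n => lp.evalCLM ℂ (fun _ : ℤ => ℂ) 1 n
  have he : ∀ n, ‖e n‖ = 1 := fun n =>
    (lp.norm_single (E := fun _ : ℤ => ℂ) zero_lt_one n (1 : ℂ)).trans norm_one
  have hφe : ∀ (n : ℤ) (x : E), φ n x = x n := fun _ _ => rfl
  have hφ : ∀ n, ‖φ n‖ ≤ 1 := fun n =>
    ContinuousLinearMap.opNorm_le_bound _ zero_le_one fun x => by
      rw [hφe, one_mul]
      exact lp.norm_apply_le_norm one_ne_zero x n
  have hA : AnalyticAt ℂ (fun c => ∑' n, a n c • e n) p.2 :=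
    (differentiableOn_tsum_of_summable_norm hu (fun n => (ha n).smul_const (e n)) hV
      (fun n c hc => by rw [norm_smul, he, mul_one]; exact hau n c hc)).analyticAt
      (hV.mem_nhds hp₂)
  have hT : AnalyticAt ℂ (fun b => ∑' n, d n b • φ n) p.1 :=
    (differentiableOn_tsum_of_summable_norm hv (fun n => (hd n).smul_const (φ n)) hU
      (fun n b hb => by
        rw [norm_smul]
        exact (mul_le_of_le_one_right (norm_nonneg _) (hφ n)).trans (hdv n b hb))).analyticAt
      (hU.mem_nhds hp₁)
  have hB : AnalyticAt ℂ (fun q : ℂ × ℂ => (∑' n, d n q.1 • φ n) (∑' n, a n q.2 • e n)) p := by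
    have h1 : AnalyticAt ℂ (fun q : ℂ × ℂ => ∑' n, d n q.1 • φ n) p :=
      AnalyticAt.comp (f := Prod.fst) hT analyticAt_fst
    have h2 : AnalyticAt ℂ (fun q : ℂ × ℂ => ∑' n, a n q.2 • e n) p :=
      AnalyticAt.comp (f := Prod.snd) hA analyticAt_snd
    exact (ContinuousLinearMap.analyticAt_bilinear (ContinuousLinearMap.id ℂ (E →L[ℂ] ℂ))
      (_, _)).comp_of_eq (h1.prod h2) rfl
  refine hB.congr ?_
  filter_upwards [(hU.prod hV).mem_nhds ⟨hp₁, hp₂⟩] with q hq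
  have sA : Summable fun n => a n q.2 • e n := Summable.of_norm_bounded hu fun n => by
    rw [norm_smul, he, mul_one]; exact hau n _ hq.2
  have sT : Summable fun n => d n q.1 • φ n := Summable.of_norm_bounded hv fun n => by
    rw [norm_smul]
    exact (mul_le_of_le_one_right (norm_nonneg _) (hφ n)).trans (hdv n _ hq.1)
  have hval : ∀ m, φ m (∑' n, a n q.2 • e n) = a m q.2 := by
    intro m
    rw [(φ m).map_tsum sA, tsum_eq_single m]
    · rw [map_smul, hφe]
      simp [e]
    · intro n hn
      rw [map_smul, hφe]
      simp [e, Pi.single_eq_of_ne hn.symm]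
  rw [← ContinuousLinearMap.apply_apply (∑' n, a n q.2 • e n) (∑' n, d n q.1 • φ n),
    ContinuousLinearMap.map_tsum _ sT]
  refine tsum_congr fun n => ?_
  simp [hval]

/-- The terms of the `k`-th `b`-derivative of the theta series with characteristic `s`. -/
noncomputable def thTerm (s : ℝ) (k : ℕ) (p : ℂ × ℂ) (n : ℤ) : ℂ :=
  (I * (n + s)) ^ k * cexp (-(n + s) ^ 2 * p.2 + I * (n + s) * p.1)

/-- The `k`-th `b`-derivative of the theta series `∑ exp (-(n + s)² c + i (n + s) b)`. -/
noncomputable def Th (s : ℝ) (k : ℕ) (p : ℂ × ℂ) : ℂ := ∑' n : ℤ, thTerm s k p n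

lemma norm_thTerm (s : ℝ) (k : ℕ) (p : ℂ × ℂ) (n : ℤ) :
    ‖thTerm s k p n‖ = |n + s| ^ k * Real.exp (-(n + s) ^ 2 * p.2.re - (n + s) * p.1.im) := by
  have h1 : (-(n + s) ^ 2 * p.2 + I * (n + s) * p.1 : ℂ)
      = ((-(n + s) ^ 2 : ℝ) : ℂ) * p.2 + ((n + s : ℝ) : ℂ) * (I * p.1) := by push_cast; ring
  have h2 : (I * (n + s) : ℂ) = I * ((n + s : ℝ) : ℂ) := by push_cast; ring
  rw [thTerm, norm_mul, norm_pow, h1, h2, Complex.norm_exp, norm_mul, norm_I, one_mul,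
    Complex.norm_real, Real.norm_eq_abs, add_re, re_ofReal_mul, re_ofReal_mul, I_mul_re]
  ring_nf

/-- Complete the square in |n + s|. Of the slope M + 2, one unit pays for |n + s|^k ≤ k! exp |n + s|
and the other produces the decay exp(−|n|). -/
lemma exists_exp_bound (s : ℝ) (k : ℕ) {ρ : ℝ} (hρ : 0 < ρ) (M : ℝ) :
    ∃ C : ℝ, ∀ n : ℤ, |n + s| ^ k * Real.exp (-(n + s) ^ 2 * ρ + |n + s| * M)
      ≤ C * Real.exp (-|n|) := by
  refine ⟨k.factorial * Real.exp ((M + 2) ^ 2 / (4 * ρ) + |s|), fun n => ?_⟩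
  have h1 : |n + s| ^ k ≤ k.factorial * Real.exp |n + s| := by
    have := Real.pow_div_factorial_le_exp |(n : ℝ) + s| (abs_nonneg _) k
    rwa [div_le_iff₀ (by positivity), mul_comm] at this
  have h2 : (|n| : ℝ) ≤ |n + s| + |s| := by
    simpa using abs_sub ((n : ℝ) + s) s
  have h3 : 0 ≤ ρ * (|n + s| - (M + 2) / (2 * ρ)) ^ 2 := by positivity
  have h4 : ρ * (|n + s| - (M + 2) / (2 * ρ)) ^ 2
      = (n + s) ^ 2 * ρ - (M + 2) * |n + s| + (M + 2) ^ 2 / (4 * ρ) := by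
    rw [← sq_abs ((n : ℝ) + s)]
    field_simp
    ring
  calc |n + s| ^ k * Real.exp (-(n + s) ^ 2 * ρ + |n + s| * M)
      ≤ (k.factorial * Real.exp |n + s|) * Real.exp (-(n + s) ^ 2 * ρ + |n + s| * M) := by gcongr
    _ = k.factorial * Real.exp (|n + s| + (-(n + s) ^ 2 * ρ + |n + s| * M)) := by
      rw [mul_assoc, ← Real.exp_add]
    _ ≤ k.factorial * Real.exp ((M + 2) ^ 2 / (4 * ρ) + |s| + -|n|) := by
      rw [h4] at h3
      refine mul_le_mul_of_nonneg_left (Real.exp_le_exp.2 ?_) (by positivity)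
      push_cast
      linarith
    _ = _ := by rw [Real.exp_add, mul_assoc]

lemma summable_exp_neg_abs : Summable fun n : ℤ => Real.exp (-|n|) := by
  have : Summable fun n : ℕ => Real.exp (-n) := by
    simpa using Real.summable_exp_neg_nat
  apply Summable.of_nat_of_neg <;> simpa using this

lemma exists_summable_bound (s : ℝ) (k : ℕ) {ρ : ℝ} (hρ : 0 < ρ) (M : ℝ) :
    ∃ u : ℤ → ℝ, Summable u ∧ ∀ (n : ℤ), ∀ p : ℂ × ℂ, ρ ≤ p.2.re → |p.1.im| ≤ M →
      ‖thTerm s k p n‖ ≤ u n := by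
  obtain ⟨C, hC⟩ := exists_exp_bound s k hρ M
  refine ⟨_, summable_exp_neg_abs.mul_left C, fun n p hc hb => le_trans ?_ (hC n)⟩
  rw [norm_thTerm]
  gcongr
  have h1 : (n + s) ^ 2 * ρ ≤ (n + s) ^ 2 * p.2.re := by gcongr
  have h2 : -((n + s) * p.1.im) ≤ |n + s| * M := by
    calc -((n + s) * p.1.im) ≤ |(n + s) * p.1.im| := neg_le_abs _
      _ = |n + s| * |p.1.im| := abs_mul _ _
      _ ≤ |n + s| * M := by gcongr
  linarith

lemma summable_thTerm (s : ℝ) (k : ℕ) {p : ℂ × ℂ} (hp : p ∈ halfSpace) :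
    Summable (thTerm s k p) := by
  obtain ⟨u, hu, h⟩ := exists_summable_bound s k (ρ := p.2.re) hp |p.1.im|
  exact Summable.of_norm_bounded hu fun n => h n p le_rfl le_rfl

lemma isOpen_halfSpace : IsOpen halfSpace :=
  isOpen_lt continuous_const (Complex.continuous_re.comp continuous_snd)

lemma isOpen_abs_im_lt (M : ℝ) : IsOpen {b : ℂ | |b.im| < M} :=
  isOpen_lt (continuous_abs.comp Complex.continuous_im) continuous_const

lemma isOpen_lt_re (ρ : ℝ) : IsOpen {c : ℂ | ρ < c.re} :=
  isOpen_lt continuous_const Complex.continuous_re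

lemma analyticAt_Th (s : ℝ) (k : ℕ) {p : ℂ × ℂ} (hp : p ∈ halfSpace) :
    AnalyticAt ℂ (Th s k) p := by
  have hp' : 0 < p.2.re := hp
  obtain ⟨C, hC⟩ := exists_exp_bound s 0 (half_pos hp') (|p.1.im| + 2)
  obtain ⟨M, hM⟩ : ∃ M, M = |p.1.im| + 1 := ⟨_, rfl⟩
  obtain ⟨C', hC'⟩ := exists_exp_bound s k (half_pos hp') (2 * M)
  have hq := half_lt_self hp'
  set r : ℝ := p.2.re / 2 with hr
  -- To separate the variables with both factors summable, the Gaussian is split by writing c = r/2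
  -- + (c − r/2): the part with r/2 goes to the b-factor, and c − r/2 still has real part greater
  -- than r/2.
  have key := analyticAt_tsum_mul (p := p)
    (d := fun n b => (I * (n + s)) ^ k * cexp (-(n + s) ^ 2 * (r / 2 : ℝ) + I * (n + s) * b))
    (a := fun n c => cexp (-(n + s) ^ 2 * (c - (r / 2 : ℝ))))
    (U := {b | |b.im| < M}) (V := {c | r < c.re}) (isOpen_abs_im_lt M) (isOpen_lt_re r)
    (exists_summable_bound s k (ρ := r / 2) (by positivity) M).choose_spec.1
    (exists_summable_bound s 0 (ρ := r / 2) (by positivity) 0).choose_spec.1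
    (fun n => by fun_prop) (fun n => by fun_prop)
    (fun n b hb => ?_) (fun n c hc => ?_) (by simp [hM]) hq
  · refine key.congr (Eventually.of_forall fun q => tsum_congr fun n => ?_)
    simp only [thTerm]
    rw [mul_assoc, ← Complex.exp_add]
    ring_nf
  · exact (exists_summable_bound s k (ρ := r / 2) (by positivity) M).choose_spec.2 n
      (b, ((r / 2 : ℝ) : ℂ)) (by simp) (le_of_lt hb)
  · have := (exists_summable_bound s 0 (ρ := r / 2) (by positivity) 0).choose_spec.2 n
      (0, c - ((r / 2 : ℝ) : ℂ)) (by
        have : r < c.re := hc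
        simp only [sub_re, ofReal_re]
        linarith) (by simp)
    simpa [thTerm] using this

lemma pdb_Th (s : ℝ) (k : ℕ) {p : ℂ × ℂ} (hp : p ∈ halfSpace) :
    pdb (Th s k) p = Th s (k + 1) p := by
  obtain ⟨u, hu, h⟩ := exists_summable_bound s k (ρ := p.2.re) hp (|p.1.im| + 1)
  have := hasSum_deriv_of_summable_norm (F := fun n b => thTerm s k (b, p.2) n) (z := p.1) hu
    (fun n => by unfold thTerm; fun_prop) (isOpen_abs_im_lt (|p.1.im| + 1))
    (fun n b hb => h n (b, p.2) le_rfl (le_of_lt hb)) (by simp)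
  refine this.tsum_eq.symm.trans (tsum_congr fun n => ?_)
  refine HasDerivAt.deriv ?_
  have h1 : HasDerivAt (fun b : ℂ => -(n + s : ℂ) ^ 2 * p.2 + I * (n + s) * b) (I * (n + s)) p.1 := by
    simpa using ((hasDerivAt_id p.1).const_mul (I * (n + s : ℂ))).const_add (-(n + s : ℂ) ^ 2 * p.2)
  refine (h1.cexp.const_mul ((I * (n + s : ℂ)) ^ k)).congr_deriv ?_
  simp only [thTerm]
  ring

/-- The heat equation holds term by term, since (i(n + s))² = −(n + s)². -/
lemma pdc_Th (s : ℝ) (k : ℕ) {p : ℂ × ℂ} (hp : p ∈ halfSpace) :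
    pdc (Th s k) p = Th s (k + 2) p := by
  have hp' : 0 < p.2.re := hp
  obtain ⟨u, hu, h⟩ := exists_summable_bound s k (half_pos hp') |p.1.im|
  have := hasSum_deriv_of_summable_norm (F := fun n c => thTerm s k (p.1, c) n) (z := p.2) hu
    (fun n => by unfold thTerm; fun_prop) (isOpen_lt_re (p.2.re / 2))
    (fun n c hc => h n (p.1, c) (le_of_lt hc) le_rfl) (half_lt_self hp')
  refine this.tsum_eq.symm.trans (tsum_congr fun n => ?_)
  refine HasDerivAt.deriv ?_
  have h1 : HasDerivAt (fun c : ℂ => -(n + s : ℂ) ^ 2 * c + I * (n + s) * p.1)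
      (-(n + s : ℂ) ^ 2) p.2 := by
    simpa using ((hasDerivAt_id p.2).const_mul (-(n + s : ℂ) ^ 2)).add_const (I * (n + s) * p.1)
  refine (h1.cexp.const_mul ((I * (n + s : ℂ)) ^ k)).congr_deriv ?_
  have : (I * (n + s : ℂ)) ^ (k + 2) = (I * (n + s : ℂ)) ^ k * (-(n + s : ℂ) ^ 2) := by
    rw [pow_add, mul_pow I _ 2, I_sq]
    ring
  simp only [thTerm, this]
  ring

end HirotaTheta


namespace HirotaTheta

/-! ### Reduction of ψ to the series `Th` -/

lemma thetaTerm_eq (α β : ℝ) (τ z : ℂ) (n : ℤ) :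
    thetaTerm α β τ z n =
      thTerm (α / 2) 0 (2 * Real.pi * z + Real.pi * β, -(I * Real.pi * τ)) n := by
  simp only [thetaTerm, thTerm, pow_zero, one_mul]
  congr 1
  push_cast
  ring

lemma summable_thetaTerm (α β : ℝ) {τ : ℂ} (z : ℂ) (hτ : 0 < τ.im) :
    Summable (thetaTerm α β τ z) := by
  have : (2 * Real.pi * z + Real.pi * β, -(I * Real.pi * τ)) ∈ halfSpace := by
    simpa [halfSpace] using mul_pos Real.pi_pos hτ
  exact (summable_thTerm (α / 2) 0 this).congr fun n => (thetaTerm_eq α β τ z n).symm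

/-- The characteristic β is merely a translation of b by πβ, and α enters only as the shift s = α/2
of the summation lattice. -/
lemma psi_eq (α β : ℝ) : psi α β = fun p => Th (α / 2) 0 (p.1 + Real.pi * β, p.2) := by
  have hpi : (Real.pi : ℂ) ≠ 0 := by exact_mod_cast Real.pi_ne_zero
  ext p
  refine tsum_congr fun n => ?_
  rw [thetaTerm_eq]
  congr 2
  · field_simp
  · field_simp
    rw [I_sq]
    ring

lemma pdb_shift (F : ℂ × ℂ → ℂ) (t : ℂ) :
    pdb (fun p => F (p.1 + t, p.2)) = fun p => pdb F (p.1 + t, p.2) := by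
  ext p
  exact deriv_comp_add_const (f := fun b => F (b, p.2)) t p.1

lemma iterate_pdb_psi (α β : ℝ) (k : ℕ) :
    Set.EqOn (pdb^[k] (psi α β)) (fun p => Th (α / 2) k (p.1 + Real.pi * β, p.2)) halfSpace := by
  induction k with
  | zero => intro p _; simp [psi_eq]
  | succ k ih =>
    intro p hp
    rw [Function.iterate_succ_apply', pdb_congr_on isOpen_halfSpace ih hp, pdb_shift]
    exact pdb_Th _ _ (p := (p.1 + Real.pi * β, p.2)) hp

lemma pdc_psi (α β : ℝ) {p : ℂ × ℂ} (hp : p ∈ halfSpace) :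
    pdc (psi α β) p = pdb (pdb (psi α β)) p := by
  have h2 := iterate_pdb_psi α β 2 hp
  simp only [Function.iterate_succ, Function.iterate_zero, Function.comp_apply, id] at h2
  rw [h2, psi_eq]
  exact pdc_Th _ _ (p := (p.1 + Real.pi * β, p.2)) hp

lemma analyticOnNhd_psi (α β : ℝ) : AnalyticOnNhd ℂ (psi α β) halfSpace := by
  intro p hp
  rw [psi_eq]
  have h1 : AnalyticAt ℂ (fun q : ℂ × ℂ => (q.1 + Real.pi * β, q.2)) p :=
    (analyticAt_fst.add analyticAt_const).prod analyticAt_snd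
  exact (analyticAt_Th _ 0 (p := (p.1 + Real.pi * β, p.2)) hp).comp_of_eq h1 rfl

/-! ### The addition formula and the bilinear equation -/

/-- Pairs of integers, split by the parity of their difference. -/
def parityEquiv : (ℤ × ℤ) ⊕ (ℤ × ℤ) ≃ ℤ × ℤ where
  toFun := Sum.elim (fun x => (x.1 + x.2, x.1 - x.2)) (fun x => (x.1 + x.2 + 1, x.1 - x.2))
  invFun x := if (x.1 - x.2) % 2 = 0 then Sum.inl ((x.1 + x.2) / 2, (x.1 - x.2) / 2)
    else Sum.inr ((x.1 + x.2 - 1) / 2, (x.1 - x.2 - 1) / 2)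
  left_inv := by
    rintro (⟨j, k⟩ | ⟨j, k⟩)
    · have : (j + k - (j - k)) % 2 = 0 := by omega
      simp only [Sum.elim_inl, this, if_true, Sum.inl.injEq, Prod.mk.injEq]
      omega
    · have : ¬ (j + k + 1 - (j - k)) % 2 = 0 := by omega
      simp only [Sum.elim_inr, this, if_false, Sum.inr.injEq, Prod.mk.injEq]
      omega
  right_inv := by
    rintro ⟨n, m⟩
    by_cases h : (n - m) % 2 = 0
    · simp only [h, if_true, Sum.elim_inl, Prod.mk.injEq]
      omega
    · simp only [h, if_false, Sum.elim_inr, Prod.mk.injEq]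
      omega

lemma hasSum_thTerm_mul (s t : ℝ) {p q : ℂ × ℂ} (hp : p ∈ halfSpace) (hq : q ∈ halfSpace) :
    HasSum (fun x : ℤ × ℤ => thTerm s 0 p x.1 * thTerm t 0 q x.2) (Th s 0 p * Th t 0 q) :=
  HasSum.mul (summable_thTerm s 0 hp).hasSum (summable_thTerm t 0 hq).hasSum
    (summable_mul_of_summable_norm (summable_thTerm s 0 hp).norm (summable_thTerm t 0 hq).norm)

/-- Split the pairs (n, m) by the parity of n − m and pass to half-sum and half-difference: squares
add up to twice the new squares, and b and h decouple. The characteristic s stays with b, so the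
h-factors are the same for every theta series. -/
theorem Th_addition (s : ℝ) {c : ℂ} (hc : 0 < c.re) (b h : ℂ) :
    Th s 0 (b + h, c) * Th s 0 (b - h, c) =
      Th s 0 (2 * b, 2 * c) * Th 0 0 (2 * h, 2 * c)
        + Th (s + 1 / 2) 0 (2 * b, 2 * c) * Th (1 / 2) 0 (2 * h, 2 * c) := by
  have hc2 : 0 < (2 * c).re := by simpa using hc
  have h0 := hasSum_thTerm_mul s s (p := (b + h, c)) (q := (b - h, c)) hc hc
  have h1 := hasSum_thTerm_mul s 0 (p := (2 * b, 2 * c)) (q := (2 * h, 2 * c)) hc2 hc2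
  have h2 := hasSum_thTerm_mul (s + 1 / 2) (1 / 2) (p := (2 * b, 2 * c)) (q := (2 * h, 2 * c)) hc2 hc2
  rw [← parityEquiv.hasSum_iff] at h0
  refine h0.unique (HasSum.sum ?_ ?_)
  · convert h1 using 1
    ext ⟨j, k⟩
    simp only [Function.comp_apply, parityEquiv, Equiv.coe_fn_mk, Sum.elim_inl, thTerm, pow_zero,
      one_mul, ← Complex.exp_add]
    congr 1
    push_cast
    ring
  · convert h2 using 1
    ext ⟨j, k⟩
    simp only [Function.comp_apply, parityEquiv, Equiv.coe_fn_mk, Sum.elim_inr, thTerm, pow_zero,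
      one_mul, ← Complex.exp_add]
    congr 1
    push_cast
    ring

lemma hasDerivAt_Th (s : ℝ) (k : ℕ) {c : ℂ} (hc : 0 < c.re) (b : ℂ) :
    HasDerivAt (fun b => Th s k (b, c)) (Th s (k + 1) (b, c)) b := by
  have h : ((b, c) : ℂ × ℂ) ∈ halfSpace := hc
  rw [← pdb_Th s k h]
  exact hasDerivAt_pdb (analyticAt_Th s k h).differentiableAt

/-- The values at `h = 0` of the addition formula and its second and fourth derivatives. -/
theorem Th_addition_derivatives (s : ℝ) {c : ℂ} (hc : 0 < c.re) (b : ℂ) :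
    Th s 0 (b, c) ^ 2 = Th s 0 (2 * b, 2 * c) * Th 0 0 (0, 2 * c)
        + Th (s + 1 / 2) 0 (2 * b, 2 * c) * Th (1 / 2) 0 (0, 2 * c) ∧
    Th s 0 (b, c) * Th s 2 (b, c) - Th s 1 (b, c) ^ 2 =
      2 * (Th s 0 (2 * b, 2 * c) * Th 0 2 (0, 2 * c)
        + Th (s + 1 / 2) 0 (2 * b, 2 * c) * Th (1 / 2) 2 (0, 2 * c)) ∧
    Th s 0 (b, c) * Th s 4 (b, c) - 4 * Th s 1 (b, c) * Th s 3 (b, c) + 3 * Th s 2 (b, c) ^ 2 =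
      8 * (Th s 0 (2 * b, 2 * c) * Th 0 4 (0, 2 * c)
        + Th (s + 1 / 2) 0 (2 * b, 2 * c) * Th (1 / 2) 4 (0, 2 * c)) := by
  have hc2 : 0 < (2 * c).re := by simpa using hc
  have hP : ∀ k h, HasDerivAt (fun h => Th s k (b + h, c)) (Th s (k + 1) (b + h, c)) h := fun k h => by
    simpa using (hasDerivAt_Th s k hc (b + h)).comp_const_add b h
  have hM : ∀ k h, HasDerivAt (fun h => Th s k (b - h, c)) (-Th s (k + 1) (b - h, c)) h :=
    fun k h => by simpa using (hasDerivAt_Th s k hc (b - h)).comp_const_sub b h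
  have hB : ∀ t k h, HasDerivAt (fun h => Th t k (2 * h, 2 * c)) (2 * Th t (k + 1) (2 * h, 2 * c)) h :=
    fun t k h => (HasDerivAt.comp (h₂ := fun b => Th t k (b, 2 * c)) h (hasDerivAt_Th t k hc2 (2 * h))
      ((hasDerivAt_id' h).const_mul (2 : ℂ))).congr_deriv (by ring)
  have hR : ∀ k, ∀ h, HasDerivAt
      (fun h => Th s 0 (2 * b, 2 * c) * Th 0 k (2 * h, 2 * c)
        + Th (s + 1 / 2) 0 (2 * b, 2 * c) * Th (1 / 2) k (2 * h, 2 * c))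
      (2 * (Th s 0 (2 * b, 2 * c) * Th 0 (k + 1) (2 * h, 2 * c)
        + Th (s + 1 / 2) 0 (2 * b, 2 * c) * Th (1 / 2) (k + 1) (2 * h, 2 * c))) h := fun k h =>
    (((hB 0 k h).const_mul _).add ((hB (1 / 2) k h).const_mul _)).congr_deriv (by ring)
  have hL : ∀ i j h, HasDerivAt (fun h => Th s i (b + h, c) * Th s j (b - h, c))
      (Th s (i + 1) (b + h, c) * Th s j (b - h, c) - Th s i (b + h, c) * Th s (j + 1) (b - h, c)) h :=
    fun i j h => ((hP i h).mul (hM j h)).congr_deriv (by ring)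
  have E0 := fun h => Th_addition s hc b h
  have E1 := fun h => (hL 0 0 h).unique ((hR 0 h).congr_of_eventuallyEq (.of_forall E0))
  have E2 := fun h => ((hL 1 0 h).sub (hL 0 1 h)).unique
    (((hR 1 h).const_mul 2).congr_of_eventuallyEq (.of_forall E1))
  have E3 := fun h => (((hL 2 0 h).sub (hL 1 1 h)).sub ((hL 1 1 h).sub (hL 0 2 h))).unique
    ((((hR 2 h).const_mul 2).const_mul 2).congr_of_eventuallyEq (.of_forall E2))
  have E4 := fun h => ((((hL 3 0 h).sub (hL 2 1 h)).sub ((hL 2 1 h).sub (hL 1 2 h))).sub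
    (((hL 2 1 h).sub (hL 1 2 h)).sub ((hL 1 2 h).sub (hL 0 3 h)))).unique
    (((((hR 3 h).const_mul 2).const_mul 2).const_mul 2).congr_of_eventuallyEq (.of_forall E3))
  have e0 := E0 0
  have e2 := E2 0
  have e4 := E4 0
  simp only [add_zero, sub_zero, mul_zero, zero_add, Nat.reduceAdd] at e0 e2 e4
  refine ⟨?_, ?_, ?_⟩
  · linear_combination e0
  · linear_combination e2 / 2
  · linear_combination e4 / 2

/-- The Wronskian of the two even theta constants in the addition formula. -/
noncomputable def wronskian (c : ℂ) : ℂ :=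
  Th 0 0 (0, 2 * c) * Th (1 / 2) 2 (0, 2 * c) - Th (1 / 2) 0 (0, 2 * c) * Th 0 2 (0, 2 * c)

/-- The coefficient `e` in `u_bb = 6 e u - 3 u² + r`, where `u / 2` is the second logarithmic
derivative of a theta series in `b`. -/
noncomputable def coefE (c : ℂ) : ℂ :=
  2 / 3 * (Th 0 0 (0, 2 * c) * Th (1 / 2) 4 (0, 2 * c)
    - Th (1 / 2) 0 (0, 2 * c) * Th 0 4 (0, 2 * c)) / wronskian c

/-- The coefficient `r` in `u_bb = 6 e u - 3 u² + r`, where `u / 2` is the second logarithmic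
derivative of a theta series in `b`. -/
noncomputable def coefR (c : ℂ) : ℂ :=
  16 * (Th 0 4 (0, 2 * c) * Th (1 / 2) 2 (0, 2 * c)
    - Th (1 / 2) 4 (0, 2 * c) * Th 0 2 (0, 2 * c)) / wronskian c

/-- The Hirota bilinear equation for the theta series. -/
theorem Th_bilinear (s : ℝ) {c : ℂ} (hc : 0 < c.re) (hw : wronskian c ≠ 0) (b : ℂ) :
    Th s 0 (b, c) * Th s 4 (b, c) - 4 * Th s 1 (b, c) * Th s 3 (b, c) + 3 * Th s 2 (b, c) ^ 2 =
      6 * coefE c * (Th s 0 (b, c) * Th s 2 (b, c) - Th s 1 (b, c) ^ 2)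
        + coefR c / 2 * Th s 0 (b, c) ^ 2 := by
  obtain ⟨h0, h2, h4⟩ := Th_addition_derivatives s hc b
  -- `coefE` and `coefR` are what Cramer's rule gives for expressing the fourth-order theta
  -- constants through those of orders 2 and 0; the determinant of that system is `wronskian`.
  rw [h0, h2, h4, coefE, coefR]
  field_simp
  rw [wronskian]
  ring

end HirotaTheta


namespace HirotaTheta

/-! ### The second logarithmic derivative of an entire function -/

/-- The second logarithmic derivative of `f`. -/
noncomputable def logDeriv₂ (f : ℂ → ℂ) (b : ℂ) : ℂ :=
  (f b * deriv (deriv f) b - deriv f b ^ 2) / f b ^ 2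

/-- The Euler operator (b − b₀) d/db preserves the shape (b − b₀)^n times an analytic function, so
it can be iterated without exponents n − 1. -/
lemma eventually_sub_mul_deriv {f g : ℂ → ℂ} {b₀ : ℂ} {n : ℕ} (hg : AnalyticAt ℂ g b₀)
    (h : ∀ᶠ b in 𝓝 b₀, f b = (b - b₀) ^ n * g b) :
    ∀ᶠ b in 𝓝 b₀, (b - b₀) * deriv f b = (b - b₀) ^ n * (n * g b + (b - b₀) * deriv g b) := by
  filter_upwards [h.eventually_nhds, hg.eventually_analyticAt] with b hb hgb
  have h1 : HasDerivAt (fun b => (b - b₀) ^ n * g b)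
      (n * (b - b₀) ^ (n - 1) * g b + (b - b₀) ^ n * deriv g b) b := by
    exact ((((hasDerivAt_id' b).sub_const b₀).pow n).mul
      hgb.differentiableAt.hasDerivAt).congr_deriv (by simp [Pi.pow_apply])
  rw [EventuallyEq.deriv_eq hb, h1.deriv]
  rcases n with _ | n
  · simp
  · simp only [Nat.add_sub_cancel]
    ring

lemma analyticAt_logDeriv₂ {f : ℂ → ℂ} {b : ℂ} (hf : AnalyticAt ℂ f b) (hb : f b ≠ 0) :
    AnalyticAt ℂ (logDeriv₂ f) b :=
  ((hf.mul hf.deriv.deriv).sub (hf.deriv.pow 2)).div (hf.pow 2) (pow_ne_zero 2 hb)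

/-- At a zero of `f` the second logarithmic derivative has a double pole. -/
lemma exists_tendsto_sq_mul_logDeriv₂ {f : ℂ → ℂ} {b₀ : ℂ} (hf : AnalyticAt ℂ f b₀)
    (h0 : f b₀ = 0) (hne : ¬ ∀ᶠ b in 𝓝 b₀, f b = 0) :
    ∃ κ : ℂ, κ ≠ 0 ∧ Tendsto (fun b => (b - b₀) ^ 2 * logDeriv₂ f b) (𝓝[≠] b₀) (𝓝 κ) := by
  obtain ⟨n, g, hg, hg0, hfg⟩ := hf.exists_eventuallyEq_pow_smul_nonzero_iff.2 hne
  simp only [smul_eq_mul] at hfg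
  have hn : n ≠ 0 := by
    rintro rfl
    have := hfg.self_of_nhds
    simp [h0, hg0.symm] at this
  set h : ℂ → ℂ := fun b => n * g b + (b - b₀) * deriv g b with hh
  have hha : AnalyticAt ℂ h b₀ := by
    have := hg.deriv
    fun_prop
  have e1 := eventually_sub_mul_deriv hg hfg
  have e2 := eventually_sub_mul_deriv (f := fun b => (b - b₀) * deriv f b) hha e1
  set K : ℂ → ℂ := fun b => (g b * (n * h b + (b - b₀) * deriv h b) - g b * h b - h b ^ 2) / g b ^ 2
    with hK
  have hKc : ContinuousAt K b₀ := by
    have h1 := hg.continuousAt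
    have h2 := hha.continuousAt
    have h3 := hha.deriv.continuousAt
    exact ContinuousAt.div (by fun_prop) (by fun_prop) (pow_ne_zero 2 hg0)
  -- At b₀ the expression is n² − n − n² = −n, where n is the order of the zero.
  have hK0 : K b₀ = -n := by
    simp only [hK, hh, sub_self, zero_mul, add_zero]
    field_simp
    ring
  refine ⟨-n, neg_ne_zero.2 (Nat.cast_ne_zero.2 hn), ?_⟩
  rw [← hK0]
  refine (hKc.tendsto.mono_left nhdsWithin_le_nhds).congr' ?_
  have hg1 : ∀ᶠ b in 𝓝 b₀, g b ≠ 0 := hg.continuousAt.eventually_ne hg0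
  filter_upwards [nhdsWithin_le_nhds hfg, nhdsWithin_le_nhds e1, nhdsWithin_le_nhds e2,
    nhdsWithin_le_nhds hg1, nhdsWithin_le_nhds hf.eventually_analyticAt,
    self_mem_nhdsWithin] with b hb1 hb2 hb3 hb4 hb5 hb6
  have ht : b - b₀ ≠ 0 := sub_ne_zero.2 hb6
  have hd : deriv (fun b => (b - b₀) * deriv f b) b = deriv f b + (b - b₀) * deriv (deriv f) b := by
    have := ((hasDerivAt_id' b).sub_const b₀).mul hb5.deriv.differentiableAt.hasDerivAt
    exact this.deriv.trans (by simp)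
  rw [hd] at hb3
  have hnum : (b - b₀) ^ 2 * (f b * deriv (deriv f) b - deriv f b ^ 2)
      = ((b - b₀) ^ n) ^ 2 *
        (g b * (n * h b + (b - b₀) * deriv h b) - g b * h b - h b ^ 2) := by
    have hb2' : (b - b₀) * deriv f b = (b - b₀) ^ n * h b := hb2
    rw [hb1]
    linear_combination ((b - b₀) ^ n * g b) * hb3 - ((b - b₀) ^ n * g b) * hb2'
      - ((b - b₀) * deriv f b + (b - b₀) ^ n * h b) * hb2'
  rw [logDeriv₂, ← mul_div_assoc, hnum, hb1, hK]
  field_simp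

/-- If `(dz/db)² = z² g` with `g` continuous, then a zero of `z` is not isolated. -/
lemma eventually_eq_zero_of_deriv_sq_eq {z g : ℂ → ℂ} {b₀ : ℂ} (hz : AnalyticAt ℂ z b₀)
    (h0 : z b₀ = 0) (hg : ContinuousAt g b₀)
    (h : ∀ᶠ b in 𝓝 b₀, deriv z b ^ 2 = z b ^ 2 * g b) : ∀ᶠ b in 𝓝 b₀, z b = 0 := by
  by_contra hne
  obtain ⟨n, k, hk, hk0, hzk⟩ := hz.exists_eventuallyEq_pow_smul_nonzero_iff.2 hne
  simp only [smul_eq_mul] at hzk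
  have hn : n ≠ 0 := by
    rintro rfl
    have := hzk.self_of_nhds
    simp [h0, hk0.symm] at this
  have e1 := eventually_sub_mul_deriv hk hzk
  have hd := hk.deriv.continuousAt
  have hkc := hk.continuousAt
  -- This is (b − b₀)² times the difference of the two sides of the equation, divided by (b −
  -- b₀)^(2n). It vanishes off b₀, yet its value at b₀ is n²k(b₀)² ≠ 0.
  have hc : ContinuousAt (fun b => (n * k b + (b - b₀) * deriv k b) ^ 2
      - (b - b₀) ^ 2 * k b ^ 2 * g b) b₀ := by fun_prop
  have hlim := hc.tendsto.mono_left (nhdsWithin_le_nhds (s := {b₀}ᶜ))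
  have hzero : Tendsto (fun b => (n * k b + (b - b₀) * deriv k b) ^ 2
      - (b - b₀) ^ 2 * k b ^ 2 * g b) (𝓝[≠] b₀) (𝓝 0) := by
    refine tendsto_const_nhds.congr' ?_
    filter_upwards [nhdsWithin_le_nhds hzk, nhdsWithin_le_nhds e1, nhdsWithin_le_nhds h,
      self_mem_nhdsWithin] with b h1 h2 h3 h4
    have ht : (b - b₀) ^ n ≠ 0 := pow_ne_zero n (sub_ne_zero.2 h4)
    have : ((b - b₀) ^ n) ^ 2 * ((n * k b + (b - b₀) * deriv k b) ^ 2
      - (b - b₀) ^ 2 * k b ^ 2 * g b) = 0 := by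
      rw [h1] at h3
      linear_combination (b - b₀) ^ 2 * h3 - ((b - b₀) * deriv z b +
        (b - b₀) ^ n * (n * k b + (b - b₀) * deriv k b)) * h2
    exact ((mul_eq_zero.1 this).resolve_left (pow_ne_zero 2 ht)).symm
  have := tendsto_nhds_unique hlim hzero
  simp [hn, hk0] at this

/-- The multiplier is the exponential of a linear function, whose second logarithmic derivative is
zero. -/
lemma logDeriv₂_quasiperiod {f : ℂ → ℂ} (hf : Differentiable ℂ f) {ω A κ : ℂ} (hA : A ≠ 0)
    (h : ∀ b, f (b + ω) = A * cexp (κ * b) * f b) (b : ℂ) :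
    logDeriv₂ f (b + ω) = logDeriv₂ f b := by
  have hd : Differentiable ℂ (deriv f) := fun x => (hf.analyticAt x).deriv.differentiableAt
  have hE : ∀ b, HasDerivAt (fun b => A * cexp (κ * b)) (κ * (A * cexp (κ * b))) b := fun b =>
    ((((hasDerivAt_id' b).const_mul κ).cexp).const_mul A).congr_deriv (by ring)
  have h1 : ∀ b, deriv f (b + ω) = A * cexp (κ * b) * (κ * f b + deriv f b) := fun b => by
    have e1 : HasDerivAt (fun b => f (b + ω)) (deriv f (b + ω)) b :=
      (hf (b + ω)).hasDerivAt.comp_add_const b ω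
    have e2 := ((hE b).mul (hf b).hasDerivAt).congr_of_eventuallyEq (.of_forall h)
    exact (e1.unique e2).trans (by ring)
  have h2 : ∀ b, deriv (deriv f) (b + ω) =
      A * cexp (κ * b) * (κ ^ 2 * f b + 2 * κ * deriv f b + deriv (deriv f) b) := fun b => by
    have e1 : HasDerivAt (fun b => deriv f (b + ω)) (deriv (deriv f) (b + ω)) b :=
      (hd (b + ω)).hasDerivAt.comp_add_const b ω
    have e2 := ((hE b).mul (((hf b).hasDerivAt.const_mul κ).add
      (hd b).hasDerivAt)).congr_of_eventuallyEq (.of_forall h1)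
    exact (e1.unique e2).trans (by simp only [Pi.add_apply]; ring)
  have hE0 : A * cexp (κ * b) ≠ 0 := mul_ne_zero hA (Complex.exp_ne_zero _)
  rw [logDeriv₂, logDeriv₂, h, h1, h2]
  generalize A * cexp (κ * b) = E at *
  rw [show E * f b * (E * (κ ^ 2 * f b + 2 * κ * deriv f b + deriv (deriv f) b))
    - (E * (κ * f b + deriv f b)) ^ 2 = E ^ 2 * (f b * deriv (deriv f) b - deriv f b ^ 2) by ring,
    mul_pow, mul_div_mul_left _ _ (pow_ne_zero 2 hE0)]

lemma not_eventually_eq_zero {f : ℂ → ℂ} (hf : Differentiable ℂ f) (hne : ∃ b, f b ≠ 0) (b₀ : ℂ) :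
    ¬ ∀ᶠ b in 𝓝 b₀, f b = 0 := by
  intro h
  obtain ⟨b, hb⟩ := hne
  exact hb (AnalyticOnNhd.eqOn_zero_of_preconnected_of_eventuallyEq_zero (U := Set.univ)
    (fun x _ => hf.analyticAt x) isPreconnected_univ (Set.mem_univ b₀) h (Set.mem_univ b))

/-- The second logarithmic derivative of an entire function with a zero is nowhere locally
constant. -/
lemma logDeriv₂_not_eventually_const {f : ℂ → ℂ} (hf : Differentiable ℂ f) (hne : ∃ b, f b ≠ 0)
    (hz : ∃ b, f b = 0) {b₁ : ℂ} (hb₁ : f b₁ ≠ 0) (t : ℂ) :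
    ¬ ∀ᶠ b in 𝓝 b₁, logDeriv₂ f b = t := by
  intro h
  obtain ⟨b₀, hb₀⟩ := hz
  have hd : Differentiable ℂ (deriv f) := fun x => (hf.analyticAt x).deriv.differentiableAt
  have hdd : Differentiable ℂ (deriv (deriv f)) := fun x => (hd.analyticAt x).deriv.differentiableAt
  -- Cleared of denominators the relation is between entire functions, so the identity theorem
  -- carries it across the zeros of f, where it contradicts the double pole.
  have hall : ∀ b, f b * deriv (deriv f) b - deriv f b ^ 2 - t * f b ^ 2 = 0 := by
    by_contra! hcon
    refine not_eventually_eq_zero (by fun_prop) hcon b₁ ?_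
    filter_upwards [h, hf.continuous.continuousAt.eventually_ne hb₁] with b hb hfb
    rw [logDeriv₂, div_eq_iff (pow_ne_zero 2 hfb)] at hb
    rw [hb, sub_self]
  have hnz := not_eventually_eq_zero hf hne b₀
  obtain ⟨κ, hκ, hlim⟩ := exists_tendsto_sq_mul_logDeriv₂ (hf.analyticAt b₀) hb₀ hnz
  have hlim0 : Tendsto (fun b => (b - b₀) ^ 2 * t) (𝓝[≠] b₀) (𝓝 0) := by
    have : Continuous fun b : ℂ => (b - b₀) ^ 2 * t := by fun_prop
    simpa using (this.tendsto b₀).mono_left (nhdsWithin_le_nhds (s := {b₀}ᶜ))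
  refine hκ (tendsto_nhds_unique hlim (hlim0.congr' ?_))
  filter_upwards [((hf.analyticAt b₀).eventually_eq_zero_or_eventually_ne_zero).resolve_left hnz]
    with b hb
  rw [logDeriv₂, sub_eq_zero.1 (hall b), mul_div_assoc, div_self (pow_ne_zero 2 hb), mul_one]

/-- For an entire function with a zero and two independent quasi-periods, the second logarithmic
derivative takes every value. -/
theorem exists_logDeriv₂_eq {f : ℂ → ℂ} (hf : Differentiable ℂ f) (hne : ∃ b, f b ≠ 0)
    (hz : ∃ b, f b = 0) {ω₁ : ℝ} (hω₁ : 0 < ω₁) {ω₂ : ℂ} (hω₂ : 0 < ω₂.im) {A₁ κ₁ A₂ κ₂ : ℂ}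
    (hA₁ : A₁ ≠ 0) (hA₂ : A₂ ≠ 0) (h₁ : ∀ b, f (b + ω₁) = A₁ * cexp (κ₁ * b) * f b)
    (h₂ : ∀ b, f (b + ω₂) = A₂ * cexp (κ₂ * b) * f b) (t : ℂ) :
    ∃ b, f b ≠ 0 ∧ logDeriv₂ f b = t := by
  have han : ∀ b, f b ≠ 0 → AnalyticAt ℂ (logDeriv₂ f) b := fun b hb =>
    analyticAt_logDeriv₂ (hf.analyticAt b) hb
  -- The zero set is carried along with the value, so that reduction modulo the periods keeps points
  -- off the zeros of f.
  have hper : ∀ {ω A κ : ℂ}, A ≠ 0 → (∀ b, f (b + ω) = A * cexp (κ * b) * f b) →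
      Function.Periodic (fun b => (logDeriv₂ f b, (f b = 0 : Prop))) ω := fun hA h b => by
    simp only [logDeriv₂_quasiperiod hf hA h b, h b, mul_eq_zero, hA, Complex.exp_ne_zero, false_or]
  let K : Set ℂ := Set.Icc 0 ω₁ ×ℂ Set.Icc 0 ω₂.im
  have hK : IsCompact K := isCompact_Icc.reProdIm isCompact_Icc
  have hred : ∀ b, ∃ b' ∈ K, logDeriv₂ f b' = logDeriv₂ f b ∧ (f b' = 0 ↔ f b = 0) := by
    intro b
    obtain ⟨n, hn⟩ : ∃ n : ℤ, n = ⌊b.im / ω₂.im⌋ := ⟨_, rfl⟩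
    obtain ⟨m, hm⟩ : ∃ m : ℤ, m = ⌊(b - n * ω₂).re / ω₁⌋ := ⟨_, rfl⟩
    have p1 := ((hper hA₁ h₁).int_mul m).sub_eq (b - n * ω₂)
    have p2 := ((hper hA₂ h₂).int_mul n).sub_eq b
    have p := p1.trans p2
    refine ⟨b - n * ω₂ - m * ω₁, ?_, (Prod.ext_iff.1 p).1, iff_of_eq (Prod.ext_iff.1 p).2⟩
    have b1 := Int.floor_le (b.im / ω₂.im)
    have b2 := (Int.lt_floor_add_one (b.im / ω₂.im)).le
    have b3 := Int.floor_le ((b - n * ω₂).re / ω₁)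
    have b4 := (Int.lt_floor_add_one ((b - n * ω₂).re / ω₁)).le
    rw [← hn, le_div_iff₀ hω₂] at b1
    rw [← hn, div_le_iff₀ hω₂] at b2
    rw [← hm, le_div_iff₀ hω₁] at b3
    rw [← hm, div_le_iff₀ hω₁] at b4
    simp only [sub_re, mul_re, intCast_re, intCast_im, zero_mul, sub_zero] at b3 b4
    simp only [K, Complex.mem_reProdIm, Set.mem_Icc, sub_re, sub_im, mul_re, mul_im, intCast_re,
      intCast_im, ofReal_re, ofReal_im, zero_mul, mul_zero, sub_zero, add_zero]
    refine ⟨⟨?_, ?_⟩, ?_, ?_⟩ <;> linarith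
  let S : Set ℂ := {t | ∃ b, f b ≠ 0 ∧ logDeriv₂ f b = t}
  have hopen : IsOpen S := by
    rw [isOpen_iff_mem_nhds]
    rintro _ ⟨b, hb, rfl⟩
    rcases (han b hb).eventually_constant_or_nhds_le_map_nhds with hc | hc
    · exact absurd hc (logDeriv₂_not_eventually_const hf hne hz hb _)
    · refine hc (Filter.mem_map.2 ?_)
      filter_upwards [hf.continuous.continuousAt.eventually_ne hb] with x hx using ⟨x, hx, rfl⟩
  -- Preimages of a convergent sequence of values are moved into the compact rectangle `K`. A limit
  -- of these preimages cannot be a zero of f, since the double pole there would make the values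
  -- unbounded.
  have hclosed : IsClosed S := by
    refine IsSeqClosed.isClosed fun x t hx hlim => ?_
    have hx' : ∀ n, ∃ b ∈ K, f b ≠ 0 ∧ logDeriv₂ f b = x n := fun n => by
      obtain ⟨b, hb, hbx⟩ := hx n
      obtain ⟨b', hb', e1, e2⟩ := hred b
      exact ⟨b', hb', fun h => hb (e2.1 h), e1.trans hbx⟩
    choose u huK hu0 hux using hx'
    obtain ⟨b₀, -, φ, hφ, hlimb⟩ := hK.tendsto_subseq huK
    have hlimx := hlim.comp hφ.tendsto_atTop
    by_cases hb₀ : f b₀ = 0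
    · exfalso
      obtain ⟨κ, hκ, hk⟩ := exists_tendsto_sq_mul_logDeriv₂ (hf.analyticAt b₀) hb₀
        (not_eventually_eq_zero hf hne b₀)
      have hne' : Tendsto (u ∘ φ) atTop (𝓝[≠] b₀) :=
        tendsto_nhdsWithin_iff.2 ⟨hlimb, .of_forall fun n h => hu0 (φ n) (by
          rw [show u (φ n) = b₀ from h, hb₀])⟩
      have e1 := hk.comp hne'
      have e2 : Tendsto (fun n => ((u ∘ φ) n - b₀) ^ 2 * x (φ n)) atTop (𝓝 ((b₀ - b₀) ^ 2 * t)) :=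
        ((hlimb.sub_const b₀).pow 2).mul hlimx
      refine hκ ((tendsto_nhds_unique e1 (e2.congr fun n => ?_)).trans (by simp))
      simp only [Function.comp_apply, hux]
    · refine ⟨b₀, hb₀, tendsto_nhds_unique ((han b₀ hb₀).continuousAt.tendsto.comp hlimb) ?_⟩
      exact hlimx.congr fun n => (hux (φ n)).symm
  obtain ⟨b, hb⟩ := hne
  have : S = Set.univ := IsClopen.eq_univ ⟨hclosed, hopen⟩ ⟨_, b, hb, rfl⟩
  exact Set.eq_univ_iff_forall.1 this t

end HirotaTheta


namespace HirotaTheta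

/-! ### Zeros and quasi-periods of the theta series -/

lemma deriv_Th (s : ℝ) (k : ℕ) {c : ℂ} (hc : 0 < c.re) :
    deriv (fun b => Th s k (b, c)) = fun b => Th s (k + 1) (b, c) :=
  funext fun b => (hasDerivAt_Th s k hc b).deriv

lemma differentiable_Th (s : ℝ) (k : ℕ) {c : ℂ} (hc : 0 < c.re) :
    Differentiable ℂ fun b => Th s k (b, c) :=
  fun b => (hasDerivAt_Th s k hc b).differentiableAt

lemma logDeriv₂_Th (s : ℝ) {c : ℂ} (hc : 0 < c.re) (b : ℂ) :
    logDeriv₂ (fun b => Th s 0 (b, c)) b =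
      (Th s 0 (b, c) * Th s 2 (b, c) - Th s 1 (b, c) ^ 2) / Th s 0 (b, c) ^ 2 := by
  rw [logDeriv₂, deriv_Th s 0 hc, deriv_Th s 1 hc]

lemma Th_add_two_pi (s : ℝ) (c b : ℂ) :
    Th s 0 (b + (2 * Real.pi : ℝ), c) = cexp (2 * Real.pi * I * s) * cexp (0 * b) * Th s 0 (b, c) := by
  rw [Th, Th, ← tsum_mul_left]
  refine tsum_congr fun n => ?_
  simp only [thTerm, pow_zero, one_mul, zero_mul, Complex.exp_zero, mul_one]
  rw [← Complex.exp_add, Complex.exp_eq_exp_iff_exists_int]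
  exact ⟨n, by push_cast; ring⟩

/-- The translation by 2ic completes the square in the exponent and thereby shifts n to n + 1. -/
lemma Th_add_two_I_mul (s : ℝ) (c b : ℂ) :
    Th s 0 (b + 2 * I * c, c) = cexp c * cexp (-I * b) * Th s 0 (b, c) := by
  rw [Th, Th, ← tsum_mul_left, ← (Equiv.addRight (1 : ℤ)).tsum_eq (fun n => _ * thTerm s 0 (b, c) n)]
  refine tsum_congr fun n => ?_
  simp only [thTerm, pow_zero, one_mul, ← Complex.exp_add, Equiv.coe_addRight]
  congr 1
  push_cast
  linear_combination (2 * (n + s) * c) * I_sq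

/-- At this point the reflection n ↦ −1 − n preserves the Gaussian part of each term and reverses
its sign, so the sum equals its negative. -/
lemma Th_zero (s : ℝ) (c : ℂ) : Th s 0 (Real.pi + I * c - 2 * I * s * c, c) = 0 := by
  have h : ∀ n : ℤ, thTerm s 0 (Real.pi + I * c - 2 * I * s * c, c) (Equiv.subLeft (-1) n)
      = - thTerm s 0 (Real.pi + I * c - 2 * I * s * c, c) n := by
    intro n
    have hneg : ∀ y : ℂ, -cexp y = cexp (y + Real.pi * I) := fun y => by
      rw [Complex.exp_add, Complex.exp_pi_mul_I, mul_neg_one]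
    simp only [thTerm, pow_zero, one_mul, Equiv.subLeft_apply]
    rw [hneg, Complex.exp_eq_exp_iff_exists_int]
    refine ⟨-(n + 1), ?_⟩
    push_cast
    linear_combination (c * (-1 - n + s) * (1 - 2 * s) - c * (n + s) * (1 - 2 * s)) * I_sq

  have e : Th s 0 (Real.pi + I * c - 2 * I * s * c, c) = -Th s 0 (Real.pi + I * c - 2 * I * s * c, c) := by
    conv_lhs => rw [Th, ← (Equiv.subLeft (-1 : ℤ)).tsum_eq]
    rw [Th, ← tsum_neg]
    exact tsum_congr h
  exact self_eq_neg.1 e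

/-- After removing the factor exp(isx), the zeroth Fourier coefficient on the real axis is 2π
exp(−s²c), up to normalisation, and this is not zero. -/
lemma exists_Th_ne_zero (s : ℝ) {c : ℂ} (hc : 0 < c.re) : ∃ b, Th s 0 (b, c) ≠ 0 := by
  by_contra! h
  obtain ⟨u, hu, hb⟩ := exists_summable_bound s 0 (ρ := c.re) hc 0
  have hint := intervalIntegral.hasSum_integral_of_dominated_convergence (a := 0) (b := 2 * Real.pi)
    (μ := MeasureTheory.volume) (F := fun (n : ℤ) (x : ℝ) => thTerm s 0 (x, c) n * cexp (-(I * s * x)))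
    (f := fun _ => 0) (fun n _ => u n)
    (fun n => by
      refine Continuous.aestronglyMeasurable ?_
      unfold thTerm
      fun_prop)
    (fun n => .of_forall fun x _ => by
      have : ‖cexp (-(I * s * x))‖ = 1 := by simp [Complex.norm_exp]
      rw [norm_mul, this, mul_one]
      exact hb n (x, c) le_rfl (by simp))
    (.of_forall fun x _ => hu) (by simp)
    (.of_forall fun x _ => by
      have hs := (summable_thTerm s 0 (p := ((x : ℂ), c)) hc).hasSum
      have h0 : ∑' n, thTerm s 0 ((x : ℂ), c) n = 0 := h x
      rw [h0] at hs
      simpa using hs.mul_right (cexp (-(I * s * x))))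
  have hterm : ∀ n : ℤ, ∫ x in (0 : ℝ)..2 * Real.pi, thTerm s 0 (x, c) n * cexp (-(I * s * x))
      = if n = 0 then 2 * Real.pi * cexp (-s ^ 2 * c) else 0 := by
    intro n
    have e : ∀ x : ℝ, thTerm s 0 (x, c) n * cexp (-(I * s * x))
        = cexp (-(n + s) ^ 2 * c) * cexp (I * n * x) := fun x => by
      simp only [thTerm, pow_zero, one_mul, ← Complex.exp_add]
      congr 1
      ring
    simp_rw [e]
    rw [intervalIntegral.integral_const_mul]
    split_ifs with hn
    · subst hn
      simp
      ring
    · have hn' : (I * n : ℂ) ≠ 0 := mul_ne_zero I_ne_zero (Int.cast_ne_zero.2 hn)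
      have : cexp (I * n * (2 * Real.pi : ℝ)) = 1 :=
        Complex.exp_eq_one_iff.2 ⟨n, by push_cast; ring⟩
      rw [integral_exp_mul_complex hn', this]
      simp
  simp_rw [hterm] at hint
  have := hint.unique (hasSum_ite_eq 0 _)
  simp [Real.pi_ne_zero] at this

/-- If the theta constants of orders 0 and 2 were proportional, the addition formula would make the
second logarithmic derivative of θ constant in b, although θ has a zero. If both constants of order
0 vanished, θ² would vanish identically. -/
theorem wronskian_ne_zero {c : ℂ} (hc : 0 < c.re) : wronskian c ≠ 0 := by
  intro hw
  obtain ⟨b₁, hb₁⟩ := exists_Th_ne_zero 0 hc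
  have key : ∀ t : ℂ, ¬ ∀ b, Th 0 0 (b, c) * Th 0 2 (b, c) - Th 0 1 (b, c) ^ 2
      = t * Th 0 0 (b, c) ^ 2 := fun t ht => by
    refine logDeriv₂_not_eventually_const (differentiable_Th 0 0 hc) (exists_Th_ne_zero 0 hc)
      ⟨_, Th_zero 0 c⟩ hb₁ t ?_
    filter_upwards [(differentiable_Th 0 0 hc).continuous.continuousAt.eventually_ne hb₁] with b hb
    rw [logDeriv₂_Th 0 hc, ht, mul_div_assoc, div_self (pow_ne_zero 2 hb), mul_one]
  have h := fun b => Th_addition_derivatives 0 hc b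
  rw [wronskian] at hw
  by_cases h0 : Th 0 0 (0, 2 * c) = 0
  · by_cases h1 : Th (1 / 2) 0 (0, 2 * c) = 0
    · have := (h b₁).1
      rw [h0, h1, mul_zero, mul_zero, add_zero] at this
      exact hb₁ (pow_eq_zero_iff two_ne_zero |>.1 this)
    · refine key (2 * Th (1 / 2) 2 (0, 2 * c) / Th (1 / 2) 0 (0, 2 * c)) fun b => ?_
      obtain ⟨e1, e2, -⟩ := h b
      rw [e1, e2]
      generalize Th (0 + 1 / 2) 0 (2 * b, 2 * c) = A
      field_simp
      linear_combination (-Th 0 0 (2 * b, 2 * c)) * hw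
  · refine key (2 * Th 0 2 (0, 2 * c) / Th 0 0 (0, 2 * c)) fun b => ?_
    obtain ⟨e1, e2, -⟩ := h b
    rw [e1, e2]
    generalize Th (0 + 1 / 2) 0 (2 * b, 2 * c) = A
    field_simp
    linear_combination A * hw

/-- For fixed `c` the second logarithmic derivative of a theta series takes every value. -/
theorem exists_logDeriv₂_Th_eq (s : ℝ) {c : ℂ} (hc : 0 < c.re) (t : ℂ) :
    ∃ b, Th s 0 (b, c) ≠ 0 ∧ logDeriv₂ (fun b => Th s 0 (b, c)) b = t :=
  exists_logDeriv₂_eq (differentiable_Th s 0 hc) (exists_Th_ne_zero s hc) ⟨_, Th_zero s c⟩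
    Real.two_pi_pos (ω₂ := 2 * I * c) (by simpa using hc) (Complex.exp_ne_zero _)
    (Complex.exp_ne_zero _) (Th_add_two_pi s c) (Th_add_two_I_mul s c) t

end HirotaTheta


namespace HirotaTheta

/-! ### The Burgers equation with an elliptic constraint -/

/-- `f` satisfies the Burgers equation, and `u = f_b` satisfies `u_bb = 6 e(c) u - 3 u² + r(c)`. -/
structure IsEllipticBurgers (f : ℂ × ℂ → ℂ) (U : Set (ℂ × ℂ)) (e r : ℂ → ℂ) : Prop where
  isOpen : IsOpen U
  analytic : AnalyticOnNhd ℂ f U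
  burgers : ∀ p ∈ U, pdc f p = pdb (pdb f) p + f p * pdb f p
  elliptic : ∀ p ∈ U, pdb (pdb (pdb f)) p = 6 * e p.2 * pdb f p - 3 * pdb f p ^ 2 + r p.2

namespace IsEllipticBurgers

variable {f : ℂ × ℂ → ℂ} {U : Set (ℂ × ℂ)} {e r : ℂ → ℂ}

lemma analyticOnNhd_iterate (h : IsEllipticBurgers f U e r) (k : ℕ) :
    AnalyticOnNhd ℂ (pdb^[k] f) U := by
  induction k with
  | zero => exact h.analytic
  | succ k ih => rw [Function.iterate_succ']; exact analyticOnNhd_pdb ih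

lemma hasDerivAt_fst (h : IsEllipticBurgers f U e r) (k : ℕ) {p : ℂ × ℂ} (hp : p ∈ U) :
    HasDerivAt (fun b => (pdb^[k] f) (b, p.2)) ((pdb^[k + 1] f) p) p.1 := by
  rw [Function.iterate_succ']
  exact hasDerivAt_pdb (h.analyticOnNhd_iterate k p hp).differentiableAt

lemma pdc_succ (h : IsEllipticBurgers f U e r) (k : ℕ) {E : ℂ × ℂ → ℂ}
    (hE : Set.EqOn (pdc (pdb^[k] f)) E U) {p : ℂ × ℂ} (hp : p ∈ U) {d : ℂ}
    (hd : HasDerivAt (fun b => E (b, p.2)) d p.1) : pdc (pdb^[k + 1] f) p = d := by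
  rw [Function.iterate_succ', Function.comp_apply,
    ← pdb_pdc_comm (h.analyticOnNhd_iterate k p hp), pdb_congr_on h.isOpen hE hp]
  exact hd.deriv

lemma pdc_zero (h : IsEllipticBurgers f U e r) : Set.EqOn (pdc (pdb^[0] f))
    (fun p => (pdb^[2] f) p + (pdb^[0] f) p * (pdb^[1] f) p) U := h.burgers

lemma pdc_one (h : IsEllipticBurgers f U e r) : Set.EqOn (pdc (pdb^[1] f))
    (fun p => (pdb^[3] f) p + (pdb^[0] f) p * (pdb^[2] f) p + (pdb^[1] f) p ^ 2) U := by
  intro p hp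
  have H := fun k => h.hasDerivAt_fst k hp
  refine h.pdc_succ 0 h.pdc_zero hp (((H 2).add ((H 0).mul (H 1))).congr_deriv ?_)
  ring

lemma pdc_two (h : IsEllipticBurgers f U e r) : Set.EqOn (pdc (pdb^[2] f))
    (fun p => (pdb^[4] f) p + (pdb^[0] f) p * (pdb^[3] f) p
      + 3 * (pdb^[1] f) p * (pdb^[2] f) p) U := by
  intro p hp
  have H := fun k => h.hasDerivAt_fst k hp
  refine h.pdc_succ 1 h.pdc_one hp
    ((((H 3).add ((H 0).mul (H 2))).add ((H 1).pow 2)).congr_deriv ?_)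
  push_cast
  ring

lemma pdc_three (h : IsEllipticBurgers f U e r) : Set.EqOn (pdc (pdb^[3] f))
    (fun p => (pdb^[5] f) p + (pdb^[0] f) p * (pdb^[4] f) p
      + 4 * (pdb^[1] f) p * (pdb^[3] f) p + 3 * (pdb^[2] f) p ^ 2) U := by
  intro p hp
  have H := fun k => h.hasDerivAt_fst k hp
  refine h.pdc_succ 2 h.pdc_two hp
    ((((H 4).add ((H 0).mul (H 3))).add (((H 1).const_mul 3).mul (H 2))).congr_deriv ?_)
  ring

lemma pdc_four (h : IsEllipticBurgers f U e r) : Set.EqOn (pdc (pdb^[4] f))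
    (fun p => (pdb^[6] f) p + (pdb^[0] f) p * (pdb^[5] f) p
      + 5 * (pdb^[1] f) p * (pdb^[4] f) p + 10 * (pdb^[2] f) p * (pdb^[3] f) p) U := by
  intro p hp
  have H := fun k => h.hasDerivAt_fst k hp
  refine h.pdc_succ 3 h.pdc_three hp
    (((((H 5).add ((H 0).mul (H 4))).add (((H 1).const_mul 4).mul (H 3))).add
      (((H 2).pow 2).const_mul 3)).congr_deriv ?_)
  push_cast
  ring

lemma iterate_three (h : IsEllipticBurgers f U e r) : Set.EqOn (pdb^[3] f)
    (fun p => 6 * e p.2 * (pdb^[1] f) p - 3 * (pdb^[1] f) p ^ 2 + r p.2) U := h.elliptic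

lemma iterate_four (h : IsEllipticBurgers f U e r) : Set.EqOn (pdb^[4] f)
    (fun p => 6 * e p.2 * (pdb^[2] f) p - 6 * (pdb^[1] f) p * (pdb^[2] f) p) U := by
  intro p hp
  have H := fun k => h.hasDerivAt_fst k hp
  rw [Function.iterate_succ', Function.comp_apply, pdb_congr_on h.isOpen h.iterate_three hp]
  refine HasDerivAt.deriv (((((H 1).const_mul (6 * e p.2)).sub
    (((H 1).pow 2).const_mul 3)).add_const (r p.2)).congr_deriv ?_)
  push_cast
  ring

lemma iterate_five (h : IsEllipticBurgers f U e r) : Set.EqOn (pdb^[5] f)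
    (fun p => 6 * e p.2 * (pdb^[3] f) p - 6 * (pdb^[2] f) p ^ 2
      - 6 * (pdb^[1] f) p * (pdb^[3] f) p) U := by
  intro p hp
  have H := fun k => h.hasDerivAt_fst k hp
  rw [Function.iterate_succ', Function.comp_apply, pdb_congr_on h.isOpen h.iterate_four hp]
  refine HasDerivAt.deriv ((((H 2).const_mul (6 * e p.2)).sub
    (((H 1).const_mul 6).mul (H 2))).congr_deriv ?_)
  ring

lemma iterate_six (h : IsEllipticBurgers f U e r) : Set.EqOn (pdb^[6] f)
    (fun p => 6 * e p.2 * (pdb^[4] f) p - 18 * (pdb^[2] f) p * (pdb^[3] f) p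
      - 6 * (pdb^[1] f) p * (pdb^[4] f) p) U := by
  intro p hp
  have H := fun k => h.hasDerivAt_fst k hp
  rw [Function.iterate_succ', Function.comp_apply, pdb_congr_on h.isOpen h.iterate_five hp]
  refine HasDerivAt.deriv (((((H 3).const_mul (6 * e p.2)).sub
    (((H 2).pow 2).const_mul 6)).sub (((H 1).const_mul 6).mul (H 3))).congr_deriv ?_)
  push_cast
  ring

lemma hasDerivAt_snd (h : IsEllipticBurgers f U e r) (k : ℕ) {p : ℂ × ℂ} (hp : p ∈ U) :
    HasDerivAt (fun c => (pdb^[k] f) (p.1, c)) (pdc (pdb^[k] f) p) p.2 :=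
  hasDerivAt_pdc (h.analyticOnNhd_iterate k p hp).differentiableAt

lemma pdc_pdc (h : IsEllipticBurgers f U e r) : Set.EqOn (pdc (pdc f))
    (fun p => (pdb^[4] f) p + 2 * (pdb^[0] f) p * (pdb^[3] f) p
      + 4 * (pdb^[1] f) p * (pdb^[2] f) p
      + 2 * (pdb^[0] f) p * (pdb^[1] f) p ^ 2 + (pdb^[0] f) p ^ 2 * (pdb^[2] f) p) U := by
  intro p hp
  have H := fun k => h.hasDerivAt_snd k hp
  have e0 := h.pdc_zero
  rw [Function.iterate_zero, id] at e0
  rw [pdc_congr_on h.isOpen e0 hp]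
  refine HasDerivAt.deriv (((H 2).add ((H 0).mul (H 1))).congr_deriv ?_)
  rw [h.pdc_zero hp, h.pdc_one hp, h.pdc_two hp]
  ring

/-- Burgers trades c-derivatives for b-derivatives up to order six, and the differentiated
constraint brings orders 4, 5, 6 back down to at most 3. Since f f_b − f_c = −f_bb, the four
equations become polynomial identities, valid even with e and f_bbb as free variables. -/
theorem integrabilityAt (h : IsEllipticBurgers f U e r) {p : ℂ × ℂ} (hp : p ∈ U) :
    IntegrabilityAt f p := by
  have H := fun k => h.hasDerivAt_snd k hp
  have e1 : pdc f p = (pdb^[2] f) p + (pdb^[0] f) p * (pdb^[1] f) p := h.pdc_zero hp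
  have e2 : pdc (pdb f) p = _ := h.pdc_one hp
  have e3 := h.pdc_pdc hp
  have e4 : pdc (pdb (pdb f)) p = _ := h.pdc_two hp
  have e5 : pdc (pdc (pdb f)) p = pdc (pdb^[3] f) p
      + pdc (pdb^[0] f) p * (pdb^[2] f) p + (pdb^[0] f) p * pdc (pdb^[2] f) p
      + 2 * (pdb^[1] f) p * pdc (pdb^[1] f) p := by
    have : Set.EqOn (pdc (pdb f)) _ U := h.pdc_one
    rw [pdc_congr_on h.isOpen this hp]
    refine HasDerivAt.deriv ((((H 3).add ((H 0).mul (H 2))).add ((H 1).pow 2)).congr_deriv ?_)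
    push_cast
    ring
  have e6 : pdc (pdc (pdc f)) p = pdc (pdb^[4] f) p
      + 2 * (pdc (pdb^[0] f) p * (pdb^[3] f) p + (pdb^[0] f) p * pdc (pdb^[3] f) p)
      + 4 * (pdc (pdb^[1] f) p * (pdb^[2] f) p + (pdb^[1] f) p * pdc (pdb^[2] f) p)
      + 2 * (pdc (pdb^[0] f) p * (pdb^[1] f) p ^ 2
        + 2 * (pdb^[0] f) p * (pdb^[1] f) p * pdc (pdb^[1] f) p)
      + 2 * (pdb^[0] f) p * pdc (pdb^[0] f) p * (pdb^[2] f) p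
      + (pdb^[0] f) p ^ 2 * pdc (pdb^[2] f) p := by
    rw [pdc_congr_on h.isOpen h.pdc_pdc hp]
    refine HasDerivAt.deriv ((((((H 4).add (((H 0).const_mul 2).mul (H 3))).add
      (((H 1).const_mul 4).mul (H 2))).add (((H 0).const_mul 2).mul ((H 1).pow 2))).add
      (((H 0).pow 2).mul (H 2))).congr_deriv ?_)
    simp only [Pi.pow_apply]
    push_cast
    ring
  simp only [h.pdc_zero hp, h.pdc_one hp, h.pdc_two hp, h.pdc_three hp, h.pdc_four hp] at e5 e6
  simp only [h.iterate_six hp, h.iterate_five hp, h.iterate_four hp] at e3 e4 e5 e6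
  have f0 : (pdb^[0] f) p = f p := rfl
  have f1 : (pdb^[1] f) p = pdb f p := rfl
  have f2 : (pdb^[2] f) p = pdb (pdb f) p := rfl
  have f3 : (pdb^[3] f) p = pdb (pdb (pdb f)) p := rfl
  simp only [f0, f1, f2, f3] at e1 e2 e3 e4 e5 e6
  simp only [IntegrabilityAt, e1, e2, e3, e4, e5, e6]
  refine ⟨by ring, by ring, by ring, by ring⟩

/-- Differentiating the elliptic constraint in `c` integrates it once in `b`. -/
lemma sq_eq_cubic (h : IsEllipticBurgers f U e r) {p : ℂ × ℂ} (hp : p ∈ U) {e' r' : ℂ}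
    (he : HasDerivAt e e' p.2) (hr : HasDerivAt r r' p.2) :
    pdb (pdb f) p ^ 2 = 6 * e p.2 * pdb f p ^ 2 - 2 * pdb f p ^ 3
      + (4 / 3 * r p.2 - 2 * e') * pdb f p - r' / 3 := by
  have H := fun k => h.hasDerivAt_snd k hp
  -- The mixed derivative f_bbbc is computed twice, from the constraint here and from Burgers in
  -- `pdc_three`; the difference is the first integral.
  have e3 : pdc (pdb^[3] f) p = 6 * e' * (pdb^[1] f) p + 6 * e p.2 * pdc (pdb^[1] f) p
      - 6 * (pdb^[1] f) p * pdc (pdb^[1] f) p + r' := by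
    rw [pdc_congr_on h.isOpen h.iterate_three hp]
    refine HasDerivAt.deriv (((((he.const_mul 6).mul (H 1)).sub
      (((H 1).pow 2).const_mul 3)).add hr).congr_deriv ?_)
    push_cast
    ring
  rw [h.pdc_three hp, h.pdc_one hp] at e3
  simp only [h.iterate_five hp, h.iterate_four hp, h.iterate_three hp] at e3
  have f1 : (pdb^[1] f) p = pdb f p := rfl
  have f2 : (pdb^[2] f) p = pdb (pdb f) p := rfl
  rw [f1, f2] at e3
  linear_combination -e3 / 3

/-- Differentiating the first integral in b must give back the elliptic constraint multiplied by
2f_bb; comparing the terms linear in f_b forces the relation. -/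
lemma deriv_coef_eq (h : IsEllipticBurgers f U e r) {p : ℂ × ℂ} (hp : p ∈ U) {e' r' : ℂ}
    (he : HasDerivAt e e' p.2) (hr : HasDerivAt r r' p.2) (hne : pdb (pdb f) p ≠ 0) :
    e' = -r p.2 / 3 := by
  have H := fun k => h.hasDerivAt_fst k hp
  have hev : ∀ᶠ b in 𝓝 p.1, (pdb^[2] f) (b, p.2) ^ 2 =
      6 * e p.2 * (pdb^[1] f) (b, p.2) ^ 2 - 2 * (pdb^[1] f) (b, p.2) ^ 3
      + (4 / 3 * r p.2 - 2 * e') * (pdb^[1] f) (b, p.2) - r' / 3 :=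
    (eventually_slice_fst (h.isOpen.mem_nhds hp)).mono fun b hb =>
      h.sq_eq_cubic (p := (b, p.2)) hb he hr
  have d1 := (H 2).pow 2
  have d2 := (((((H 1).pow 2).const_mul (6 * e p.2)).sub (((H 1).pow 3).const_mul 2)).add
    ((H 1).const_mul (4 / 3 * r p.2 - 2 * e'))).sub_const (r' / 3)
  have := d1.unique (d2.congr_of_eventuallyEq hev)
  rw [h.iterate_three hp] at this
  have hne' : (pdb^[2] f) p ≠ 0 := hne
  push_cast at this
  have key : (pdb^[2] f) p * (e' + r p.2 / 3) = 0 := by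
    linear_combination this / 2
  have := (mul_eq_zero.1 key).resolve_left hne'
  linear_combination this

end IsEllipticBurgers

end HirotaTheta


namespace HirotaTheta

/-! ### The theta solutions -/

lemma analyticAt_Th_const (t : ℝ) (k : ℕ) {c : ℂ} (hc : 0 < c.re) :
    AnalyticAt ℂ (fun c => Th t k (0, 2 * c)) c := by
  have hc2 : ((0, 2 * c) : ℂ × ℂ) ∈ halfSpace := by simpa [halfSpace] using hc
  exact (analyticAt_Th t k hc2).comp_of_eq
    (analyticAt_const.prod (analyticAt_const.mul analyticAt_id)) rfl

lemma analyticAt_wronskian {c : ℂ} (hc : 0 < c.re) : AnalyticAt ℂ wronskian c :=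
  ((analyticAt_Th_const 0 0 hc).mul (analyticAt_Th_const (1 / 2) 2 hc)).sub
    ((analyticAt_Th_const (1 / 2) 0 hc).mul (analyticAt_Th_const 0 2 hc))

lemma analyticAt_coefE {c : ℂ} (hc : 0 < c.re) : AnalyticAt ℂ coefE c :=
  (analyticAt_const.mul (((analyticAt_Th_const 0 0 hc).mul (analyticAt_Th_const (1 / 2) 4 hc)).sub
    ((analyticAt_Th_const (1 / 2) 0 hc).mul (analyticAt_Th_const 0 4 hc)))).div
    (analyticAt_wronskian hc) (wronskian_ne_zero hc)

lemma analyticAt_coefR {c : ℂ} (hc : 0 < c.re) : AnalyticAt ℂ coefR c :=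
  (analyticAt_const.mul (((analyticAt_Th_const 0 4 hc).mul (analyticAt_Th_const (1 / 2) 2 hc)).sub
    ((analyticAt_Th_const (1 / 2) 4 hc).mul (analyticAt_Th_const 0 2 hc)))).div
    (analyticAt_wronskian hc) (wronskian_ne_zero hc)

/-- The bilinear equation and its first two b-derivatives are three linear relations with the same
coefficients 6e and r/2. Hence a 3×3 determinant vanishes, and this determinant is the ODE. The
multipliers at the end are its 2×2 cofactors. -/
theorem sixthOrderODE_psi (α β : ℝ) {p : ℂ × ℂ} (hp : p ∈ halfSpace) :
    sixthOrderODE (psi α β) p = 0 := by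
  have hc : 0 < p.2.re := hp
  have H := fun k b => hasDerivAt_Th (α / 2) k hc b
  have E0 := Th_bilinear (α / 2) hc (wronskian_ne_zero hc)
  have E1 := fun b => ((((H 0 b).mul (H 4 b)).sub (((H 1 b).const_mul 4).mul (H 3 b))).add
    (((H 2 b).pow 2).const_mul 3)).unique
    ((((((H 0 b).mul (H 2 b)).sub ((H 1 b).pow 2)).const_mul (6 * coefE p.2)).add
      (((H 0 b).pow 2).const_mul (coefR p.2 / 2))).congr_of_eventuallyEq (.of_forall E0))
  have E1' : ∀ b, Th (α / 2) 0 (b, p.2) * Th (α / 2) 5 (b, p.2)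
      - 3 * Th (α / 2) 1 (b, p.2) * Th (α / 2) 4 (b, p.2)
      + 2 * Th (α / 2) 2 (b, p.2) * Th (α / 2) 3 (b, p.2)
      = 6 * coefE p.2 * (Th (α / 2) 0 (b, p.2) * Th (α / 2) 3 (b, p.2)
        - Th (α / 2) 1 (b, p.2) * Th (α / 2) 2 (b, p.2))
      + coefR p.2 * (Th (α / 2) 0 (b, p.2) * Th (α / 2) 1 (b, p.2)) := fun b => by
    have := E1 b
    push_cast at this
    simp only [pow_one] at this
    linear_combination this
  have E2 := fun b => ((((H 0 b).mul (H 5 b)).sub (((H 1 b).const_mul 3).mul (H 4 b))).add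
    (((H 2 b).const_mul 2).mul (H 3 b))).unique
    ((((((H 0 b).mul (H 3 b)).sub ((H 1 b).mul (H 2 b))).const_mul (6 * coefE p.2)).add
      (((H 0 b).mul (H 1 b)).const_mul (coefR p.2))).congr_of_eventuallyEq (.of_forall E1'))
  have e0 := E0 (p.1 + Real.pi * β)
  have e1 := E1' (p.1 + Real.pi * β)
  have e2 := E2 (p.1 + Real.pi * β)
  simp only [Nat.reduceAdd] at e2
  simp only [sixthOrderODE, iterate_pdb_psi α β _ hp]
  rw [show psi α β p = Th (α / 2) 0 (p.1 + Real.pi * β, p.2) by rw [psi_eq]]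
  generalize Th (α / 2) 0 (p.1 + Real.pi * β, p.2) = y0 at *
  generalize Th (α / 2) 1 (p.1 + Real.pi * β, p.2) = y1 at *
  generalize Th (α / 2) 2 (p.1 + Real.pi * β, p.2) = y2 at *
  generalize Th (α / 2) 3 (p.1 + Real.pi * β, p.2) = y3 at *
  generalize Th (α / 2) 4 (p.1 + Real.pi * β, p.2) = y4 at *
  generalize Th (α / 2) 5 (p.1 + Real.pi * β, p.2) = y5 at *
  generalize Th (α / 2) 6 (p.1 + Real.pi * β, p.2) = y6 at *
  linear_combination
    (y0 ^ 2 * (y0 * y3 - y1 * y2) - (y0 * y2 - y1 ^ 2) * (2 * y0 * y1)) * e2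
    - (y0 ^ 2 * (y0 * y4 - y2 ^ 2) - (y0 * y2 - y1 ^ 2) * (2 * y0 * y2 + 2 * y1 ^ 2)) * e1
    + (2 * y0 * y1 * (y0 * y4 - y2 ^ 2) - (y0 * y3 - y1 * y2) * (2 * y0 * y2 + 2 * y1 ^ 2)) * e0

lemma isOpen_thetaDomain (α β : ℝ) : IsOpen (thetaDomain α β) := by
  rw [isOpen_iff_mem_nhds]
  rintro p ⟨hp, hne⟩
  exact inter_mem (isOpen_halfSpace.mem_nhds hp)
    ((analyticOnNhd_psi α β p hp).continuousAt.preimage_mem_nhds (isOpen_ne.mem_nhds hne))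

lemma thetaDomain_nonempty (α β : ℝ) : (thetaDomain α β).Nonempty := by
  obtain ⟨b, hb⟩ := exists_Th_ne_zero (α / 2) (c := 1) (by simp)
  refine ⟨(b - Real.pi * β, 1), by simp, ?_⟩
  simpa [psi_eq] using hb

section

variable {α β : ℝ} {p : ℂ × ℂ}

lemma hasDerivAt_Th_fst (s : ℝ) (k : ℕ) (t : ℂ) (hp : p ∈ halfSpace) :
    HasDerivAt (fun b => Th s k (b + t, p.2)) (Th s (k + 1) (p.1 + t, p.2)) p.1 :=
  (hasDerivAt_Th s k hp (p.1 + t)).comp_add_const p.1 t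

lemma hasDerivAt_Th_snd (s : ℝ) (k : ℕ) (t : ℂ) (hp : p ∈ halfSpace) :
    HasDerivAt (fun c => Th s k (p.1 + t, c)) (Th s (k + 2) (p.1 + t, p.2)) p.2 := by
  have h : ((p.1 + t, p.2) : ℂ × ℂ) ∈ halfSpace := hp
  rw [← pdc_Th s k h]
  exact hasDerivAt_pdc (analyticAt_Th s k h).differentiableAt

lemma Th_ne_zero (hp : p ∈ thetaDomain α β) : Th (α / 2) 0 (p.1 + Real.pi * β, p.2) ≠ 0 := by
  have := hp.2
  rwa [psi_eq] at this

lemma fTheta_eq (α β : ℝ) : Set.EqOn (fTheta α β) (fun p =>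
    2 * Th (α / 2) 1 (p.1 + Real.pi * β, p.2) / Th (α / 2) 0 (p.1 + Real.pi * β, p.2))
    (thetaDomain α β) := by
  intro p hp
  have h1 : pdb (psi α β) p = _ := iterate_pdb_psi α β 1 hp.1
  rw [fTheta, h1, psi_eq]

lemma pdb_fTheta (α β : ℝ) : Set.EqOn (pdb (fTheta α β)) (fun p =>
    2 * (Th (α / 2) 0 (p.1 + Real.pi * β, p.2) * Th (α / 2) 2 (p.1 + Real.pi * β, p.2)
      - Th (α / 2) 1 (p.1 + Real.pi * β, p.2) ^ 2) / Th (α / 2) 0 (p.1 + Real.pi * β, p.2) ^ 2)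
    (thetaDomain α β) := by
  intro p hp
  rw [pdb_congr_on (isOpen_thetaDomain α β) (fTheta_eq α β) hp]
  have H := fun k => hasDerivAt_Th_fst (α / 2) k (Real.pi * β) hp.1
  have hne := Th_ne_zero hp
  refine HasDerivAt.deriv ((((H 1).const_mul 2).div (H 0) hne).congr_deriv ?_)
  field_simp

lemma pdb_pdb_fTheta (α β : ℝ) : Set.EqOn (pdb (pdb (fTheta α β))) (fun p =>
    2 * (Th (α / 2) 0 (p.1 + Real.pi * β, p.2) ^ 2 * Th (α / 2) 3 (p.1 + Real.pi * β, p.2)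
      - 3 * Th (α / 2) 0 (p.1 + Real.pi * β, p.2) * Th (α / 2) 1 (p.1 + Real.pi * β, p.2)
        * Th (α / 2) 2 (p.1 + Real.pi * β, p.2)
      + 2 * Th (α / 2) 1 (p.1 + Real.pi * β, p.2) ^ 3) / Th (α / 2) 0 (p.1 + Real.pi * β, p.2) ^ 3)
    (thetaDomain α β) := by
  intro p hp
  rw [pdb_congr_on (isOpen_thetaDomain α β) (pdb_fTheta α β) hp]
  have H := fun k => hasDerivAt_Th_fst (α / 2) k (Real.pi * β) hp.1
  have hne := Th_ne_zero hp
  refine HasDerivAt.deriv ((((((H 0).mul (H 2)).sub ((H 1).pow 2)).const_mul 2).div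
    ((H 0).pow 2) (pow_ne_zero 2 hne)).congr_deriv ?_)
  simp only [Pi.pow_apply, Pi.sub_apply, Pi.mul_apply]
  field_simp
  push_cast
  ring

lemma pdb_pdb_pdb_fTheta (α β : ℝ) : Set.EqOn (pdb (pdb (pdb (fTheta α β)))) (fun p =>
    2 * (Th (α / 2) 0 (p.1 + Real.pi * β, p.2) ^ 3 * Th (α / 2) 4 (p.1 + Real.pi * β, p.2)
      - 4 * Th (α / 2) 0 (p.1 + Real.pi * β, p.2) ^ 2 * Th (α / 2) 1 (p.1 + Real.pi * β, p.2)
        * Th (α / 2) 3 (p.1 + Real.pi * β, p.2)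
      - 3 * Th (α / 2) 0 (p.1 + Real.pi * β, p.2) ^ 2 * Th (α / 2) 2 (p.1 + Real.pi * β, p.2) ^ 2
      + 12 * Th (α / 2) 0 (p.1 + Real.pi * β, p.2) * Th (α / 2) 1 (p.1 + Real.pi * β, p.2) ^ 2
        * Th (α / 2) 2 (p.1 + Real.pi * β, p.2)
      - 6 * Th (α / 2) 1 (p.1 + Real.pi * β, p.2) ^ 4) / Th (α / 2) 0 (p.1 + Real.pi * β, p.2) ^ 4)
    (thetaDomain α β) := by
  intro p hp
  rw [pdb_congr_on (isOpen_thetaDomain α β) (pdb_pdb_fTheta α β) hp]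
  have H := fun k => hasDerivAt_Th_fst (α / 2) k (Real.pi * β) hp.1
  have hne := Th_ne_zero hp
  refine HasDerivAt.deriv (((((((((H 0).pow 2).mul (H 3)).sub
    ((((H 0).const_mul 3).mul (H 1)).mul (H 2))).add (((H 1).pow 3).const_mul 2))).const_mul 2).div
    ((H 0).pow 3) (pow_ne_zero 3 hne)).congr_deriv ?_)
  simp only [Pi.pow_apply, Pi.mul_apply, Pi.add_apply, Pi.sub_apply]
  field_simp
  push_cast
  ring

end

/-- The first equation is Cole–Hopf, the second is the bilinear equation divided by ψ²/2. The
coefficients are the same for all characteristics. -/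
theorem isEllipticBurgers_fTheta (α β : ℝ) :
    IsEllipticBurgers (fTheta α β) (thetaDomain α β) coefE coefR where
  isOpen := isOpen_thetaDomain α β
  analytic := fun p hp => (analyticAt_const.mul (analyticAt_pdb (analyticOnNhd_psi α β p hp.1))).div
    (analyticOnNhd_psi α β p hp.1) hp.2
  burgers := fun p hp => by
    rw [pdc_congr_on (isOpen_thetaDomain α β) (fTheta_eq α β) hp, pdb_pdb_fTheta α β hp,
      pdb_fTheta α β hp, fTheta_eq α β hp]
    have H := fun k => hasDerivAt_Th_snd (α / 2) k (Real.pi * β) hp.1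
    have hne := Th_ne_zero hp
    refine HasDerivAt.deriv ((((H 1).const_mul 2).div (H 0) hne).congr_deriv ?_)
    field_simp
    ring
  elliptic := fun p hp => by
    have hc : 0 < p.2.re := hp.1
    have hne := Th_ne_zero hp
    have hb := Th_bilinear (α / 2) hc (wronskian_ne_zero hc) (p.1 + Real.pi * β)
    rw [pdb_pdb_pdb_fTheta α β hp, pdb_fTheta α β hp]
    beta_reduce
    generalize Th (α / 2) 0 (p.1 + Real.pi * β, p.2) = y0 at *
    generalize Th (α / 2) 1 (p.1 + Real.pi * β, p.2) = y1 at *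
    generalize Th (α / 2) 2 (p.1 + Real.pi * β, p.2) = y2 at *
    generalize Th (α / 2) 3 (p.1 + Real.pi * β, p.2) = y3 at *
    generalize Th (α / 2) 4 (p.1 + Real.pi * β, p.2) = y4 at *
    linear_combination (norm := skip) 2 / y0 ^ 2 * hb
    field_simp
    ring

theorem isSolutionOn_fTheta (α β : ℝ) : IsSolutionOn (fTheta α β) (thetaDomain α β) where
  isOpen := isOpen_thetaDomain α β
  analytic := (isEllipticBurgers_fTheta α β).analytic
  eqns := fun _ hp => (isEllipticBurgers_fTheta α β).integrabilityAt hp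

end HirotaTheta


namespace HirotaTheta

/-! ### The Weierstrass cubic and its invariants -/

/-- The coefficient `s` in `u_b² = 6 e u² - 2 u³ + 2 r u + s`. -/
noncomputable def coefS (c : ℂ) : ℂ := -deriv coefR c / 3

/-- The cubic `6 e t² - 2 t³ + 2 r t + s`. -/
def cubic (e r s t : ℂ) : ℂ := 6 * e * t ^ 2 - 2 * t ^ 3 + 2 * r * t + s

/-- The quadratic invariant of the depressed cubic `2 x³ - 2 R x - S`, `x = e - t`. -/
noncomputable def invR (c : ℂ) : ℂ := 3 * coefE c ^ 2 + coefR c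

/-- The constant term of the depressed cubic `2 x³ - 2 R x - S`, `x = e - t`. -/
noncomputable def invS (c : ℂ) : ℂ := -4 * coefE c ^ 3 - 2 * coefR c * coefE c - coefS c

lemma cubic_eq (c x : ℂ) : cubic (coefE c) (coefR c) (coefS c) (coefE c - x)
    = 2 * x ^ 3 - 2 * invR c * x - invS c := by
  rw [cubic, invR, invS]
  ring

lemma pdb_fTheta_eq_logDeriv₂ {α β : ℝ} {p : ℂ × ℂ} (hp : p ∈ thetaDomain α β) :
    pdb (fTheta α β) p =
      2 * logDeriv₂ (fun b => Th (α / 2) 0 (b, p.2)) (p.1 + Real.pi * β) := by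
  rw [pdb_fTheta α β hp, logDeriv₂_Th (α / 2) hp.1]
  exact mul_div_assoc _ _ _

/-- For fixed `c`, the derivative `f_b` takes every value. -/
theorem exists_pdb_fTheta_eq (α β : ℝ) {c : ℂ} (hc : 0 < c.re) (t : ℂ) :
    ∃ b, (b, c) ∈ thetaDomain α β ∧ pdb (fTheta α β) (b, c) = t := by
  obtain ⟨b, hb, ht⟩ := exists_logDeriv₂_Th_eq (α / 2) hc (t / 2)
  have hmem : (b - Real.pi * β, c) ∈ thetaDomain α β := ⟨hc, by simpa [psi_eq] using hb⟩
  refine ⟨_, hmem, ?_⟩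
  rw [pdb_fTheta_eq_logDeriv₂ hmem, sub_add_cancel, ht]
  ring

/-- If f_bb vanished for this c, so would f_bbb, and a nonzero quadratic polynomial would vanish at
every value of f_b, that is, on all of ℂ. -/
lemma exists_pdb_pdb_fTheta_ne_zero (α β : ℝ) {c : ℂ} (hc : 0 < c.re) :
    ∃ b, (b, c) ∈ thetaDomain α β ∧ pdb (pdb (fTheta α β)) (b, c) ≠ 0 := by
  by_contra! h
  have key : ∀ t, 6 * coefE c * t - 3 * t ^ 2 + coefR c = 0 := fun t => by
    obtain ⟨b, hb, rfl⟩ := exists_pdb_fTheta_eq α β hc t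
    rw [← (isEllipticBurgers_fTheta α β).elliptic _ hb]
    have : ∀ᶠ b' in 𝓝 b, pdb (pdb (fTheta α β)) (b', c) = 0 :=
      (eventually_slice_fst (p := (b, c)) ((isOpen_thetaDomain α β).mem_nhds hb)).mono
        fun b' hb' => h b' hb'
    exact (EventuallyEq.deriv_eq this).trans (by simp)
  have h1 := key 1
  have h2 := key (-1)
  have h3 := key 0
  have : (6 : ℂ) = 0 := by linear_combination 2 * h3 - h1 - h2
  norm_num at this

lemma deriv_coefE {c : ℂ} (hc : 0 < c.re) : deriv coefE c = -coefR c / 3 := by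
  obtain ⟨b, hb, hne⟩ := exists_pdb_pdb_fTheta_ne_zero 0 0 hc
  exact (isEllipticBurgers_fTheta 0 0).deriv_coef_eq hb
    (analyticAt_coefE hc).differentiableAt.hasDerivAt
    (analyticAt_coefR hc).differentiableAt.hasDerivAt hne

/-- The Weierstrass equation for `u = f_b`. -/
theorem sq_pdb_pdb_fTheta {α β : ℝ} {p : ℂ × ℂ} (hp : p ∈ thetaDomain α β) :
    pdb (pdb (fTheta α β)) p ^ 2 =
      cubic (coefE p.2) (coefR p.2) (coefS p.2) (pdb (fTheta α β) p) := by
  rw [(isEllipticBurgers_fTheta α β).sq_eq_cubic hp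
    (analyticAt_coefE hp.1).differentiableAt.hasDerivAt
    (analyticAt_coefR hp.1).differentiableAt.hasDerivAt, deriv_coefE hp.1, cubic, coefS]
  ring

/-- The Weierstrass equation for the second logarithmic derivative of a theta series. -/
lemma sq_deriv_logDeriv₂_Th (s : ℝ) {c : ℂ} (hc : 0 < c.re) {b : ℂ} (hb : Th s 0 (b, c) ≠ 0) :
    (2 * deriv (logDeriv₂ fun b => Th s 0 (b, c)) b) ^ 2 =
      cubic (coefE c) (coefR c) (coefS c) (2 * logDeriv₂ (fun b => Th s 0 (b, c)) b) := by
  have hmem : (b, c) ∈ thetaDomain (2 * s) 0 := ⟨hc, by simpa [psi_eq] using hb⟩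
  have h := sq_pdb_pdb_fTheta hmem
  have e : ∀ p ∈ thetaDomain (2 * s) 0, pdb (fTheta (2 * s) 0) p =
      2 * logDeriv₂ (fun b => Th s 0 (b, p.2)) p.1 := fun p hp => by
    simpa using pdb_fTheta_eq_logDeriv₂ hp
  have e2 : pdb (pdb (fTheta (2 * s) 0)) (b, c) =
      2 * deriv (logDeriv₂ fun b => Th s 0 (b, c)) b := by
    rw [pdb_congr_on (isOpen_thetaDomain _ _) e hmem, pdb]
    exact deriv_const_mul_field 2
  rwa [e2, e _ hmem] at h

/-! ### Modular transformations of the invariants -/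

/-- The Gaussian factor contributes the constant 2q to the second logarithmic derivative, and the
rescaling of b contributes ν². -/
lemma logDeriv₂_transform {g h : ℂ → ℂ} (hg : Differentiable ℂ g) (hh : Differentiable ℂ h)
    {ν ν₀ K q : ℂ} (hK : K ≠ 0) (H : ∀ b, h (ν * b + ν₀) = K * cexp (q * b ^ 2) * g b) {b : ℂ}
    (hb : g b ≠ 0) : logDeriv₂ g b = ν ^ 2 * logDeriv₂ h (ν * b + ν₀) - 2 * q := by
  have hg' : Differentiable ℂ (deriv g) := fun x => (hg.analyticAt x).deriv.differentiableAt
  have hh' : Differentiable ℂ (deriv h) := fun x => (hh.analyticAt x).deriv.differentiableAt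
  have hL : ∀ b, HasDerivAt (fun b => ν * b + ν₀) ν b := fun b => by
    simpa using ((hasDerivAt_id' b).const_mul ν).add_const ν₀
  have hE : ∀ b, HasDerivAt (fun b => K * cexp (q * b ^ 2))
      (2 * q * b * (K * cexp (q * b ^ 2))) b := fun b =>
    ((((hasDerivAt_id' b).pow 2).const_mul q).cexp.const_mul K).congr_deriv (by
      simp only [Pi.pow_apply]; push_cast; ring)
  have h1 : ∀ b, deriv h (ν * b + ν₀) * ν =
      K * cexp (q * b ^ 2) * (2 * q * b * g b + deriv g b) := fun b => by
    have e1 : HasDerivAt (fun b => h (ν * b + ν₀)) (deriv h (ν * b + ν₀) * ν) b :=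
      (hh _).hasDerivAt.comp b (hL b)
    have e2 := ((hE b).mul (hg b).hasDerivAt).congr_of_eventuallyEq (.of_forall H)
    exact (e1.unique e2).trans (by ring)
  have h2 : ∀ b, deriv (deriv h) (ν * b + ν₀) * ν ^ 2 = K * cexp (q * b ^ 2) *
      ((4 * q ^ 2 * b ^ 2 + 2 * q) * g b + 4 * q * b * deriv g b + deriv (deriv g) b) := fun b => by
    have e1 : HasDerivAt (fun b => deriv h (ν * b + ν₀) * ν)
        (deriv (deriv h) (ν * b + ν₀) * ν * ν) b :=
      ((hh' _).hasDerivAt.comp b (hL b)).mul_const ν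
    have e2 := ((hE b).mul ((((hasDerivAt_id' b).const_mul (2 * q)).mul (hg b).hasDerivAt).add
      (hg' b).hasDerivAt)).congr_of_eventuallyEq (.of_forall h1)
    have := e1.unique e2
    simp only [Pi.add_apply, Pi.mul_apply] at this
    linear_combination this
  have hE0 : K * cexp (q * b ^ 2) ≠ 0 := mul_ne_zero hK (Complex.exp_ne_zero _)
  have k1 := h1 b
  have k2 := h2 b
  rw [logDeriv₂, logDeriv₂, H]
  generalize K * cexp (q * b ^ 2) = E at *
  generalize deriv (deriv h) (ν * b + ν₀) = y2 at *
  generalize deriv h (ν * b + ν₀) = y1 at *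
  have : ν ^ 2 * ((E * g b * y2 - y1 ^ 2) / (E * g b) ^ 2)
      = (E * g b * (y2 * ν ^ 2) - (y1 * ν) ^ 2) / (E * g b) ^ 2 := by
    rw [← mul_div_assoc]
    congr 1
    ring
  rw [this, k1, k2]
  field_simp
  ring

/-- Both sides have the same leading coefficient, so the values at 0, 1, −1 already determine e, r,
s. The two invariants are coefficients of the depressed cubic, hence insensitive to the translation
ν. -/
lemma cubic_invariants {e r s e' r' s' μ ν : ℂ} (hμ : μ ≠ 0)
    (h : ∀ t, cubic e r s (μ * t + ν) = μ ^ 3 * cubic e' r' s' t) :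
    3 * e ^ 2 + r = μ ^ 2 * (3 * e' ^ 2 + r') ∧
    -4 * e ^ 3 - 2 * r * e - s = μ ^ 3 * (-4 * e' ^ 3 - 2 * r' * e' - s') := by
  have h0 := h 0
  have h1 := h 1
  have h2 := h (-1)
  simp only [cubic] at h0 h1 h2
  have he : e = μ * e' + ν := by
    have : 12 * μ ^ 2 * (e - (μ * e' + ν)) = 0 := by linear_combination h1 + h2 - 2 * h0
    have := (mul_eq_zero.1 this).resolve_left (mul_ne_zero (by norm_num) (pow_ne_zero 2 hμ))
    linear_combination this
  have hr : r = μ ^ 2 * r' - 6 * e * ν + 3 * ν ^ 2 := by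
    have : 4 * μ * (r - (μ ^ 2 * r' - 6 * e * ν + 3 * ν ^ 2)) = 0 := by linear_combination h1 - h2
    have := (mul_eq_zero.1 this).resolve_left (mul_ne_zero (by norm_num) hμ)
    linear_combination this
  have hs : s = μ ^ 3 * s' - 6 * e * ν ^ 2 + 2 * ν ^ 3 - 2 * r * ν := by linear_combination h0
  subst hs hr he
  constructor <;> ring

/-- A transformation law of the theta function in `b` implies one of the invariants. -/
theorem invariants_transform {c c' : ℂ} (hc : 0 < c.re) (hc' : 0 < c'.re) {ν ν₀ K q : ℂ}
    (hν : ν ≠ 0) (hK : K ≠ 0)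
    (H : ∀ b, Th 0 0 (ν * b + ν₀, c') = K * cexp (q * b ^ 2) * Th 0 0 (b, c)) :
    invR c = ν ^ 4 * invR c' ∧ invS c = ν ^ 6 * invS c' := by
  have hg := differentiable_Th 0 0 hc
  have hh := differentiable_Th 0 0 hc'
  have key : ∀ t, cubic (coefE c) (coefR c) (coefS c) (ν ^ 2 * t + (-4 * q)) =
      (ν ^ 2) ^ 3 * cubic (coefE c') (coefR c') (coefS c') t := by
    intro t
    -- As the second logarithmic derivative takes every value, the identity between the two cubics
    -- holds for every t and not only along a curve.
    obtain ⟨b', hb', ht⟩ := exists_logDeriv₂_Th_eq 0 hc' (t / 2)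
    obtain ⟨b, rfl⟩ : ∃ b, b' = ν * b + ν₀ := ⟨(b' - ν₀) / ν, by field_simp; ring⟩
    have hb : Th 0 0 (b, c) ≠ 0 := fun h0 => hb' (by rw [H, h0, mul_zero])
    have hw : ∀ᶠ x in 𝓝 b, logDeriv₂ (fun b => Th 0 0 (b, c)) x =
        ν ^ 2 * logDeriv₂ (fun b => Th 0 0 (b, c')) (ν * x + ν₀) - 2 * q := by
      filter_upwards [hg.continuous.continuousAt.eventually_ne hb] with x hx
      exact logDeriv₂_transform hg hh hK H hx
    have hd : deriv (logDeriv₂ fun b => Th 0 0 (b, c)) b =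
        ν ^ 3 * deriv (logDeriv₂ fun b => Th 0 0 (b, c')) (ν * b + ν₀) := by
      have h1 := (analyticAt_logDeriv₂ (hh.analyticAt _) hb').differentiableAt.hasDerivAt
      have h2 : HasDerivAt (fun b => ν * b + ν₀) ν b := by
        simpa using ((hasDerivAt_id' b).const_mul ν).add_const ν₀
      rw [EventuallyEq.deriv_eq hw]
      exact ((((h1.comp b h2).const_mul (ν ^ 2)).sub_const (2 * q)).congr_deriv (by ring)).deriv
    have e1 := sq_deriv_logDeriv₂_Th 0 hc hb
    have e2 := sq_deriv_logDeriv₂_Th 0 hc' hb'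
    rw [hw.self_of_nhds, hd, ht] at e1
    rw [ht] at e2
    rw [show 2 * (ν ^ 2 * (t / 2) - 2 * q) = ν ^ 2 * t + -4 * q by ring] at e1
    rw [show 2 * (t / 2) = t by ring] at e2
    rw [← e1, ← e2]
    ring
  obtain ⟨h1, h2⟩ := cubic_invariants (pow_ne_zero 2 hν) key
  rw [← pow_mul] at h1 h2
  exact ⟨h1, h2⟩

/-- In terms of τ = ic/π this is τ ↦ τ + 1. The sign (−1)^(n²) = (−1)^n that it produces is
cancelled by translating b by π. -/
lemma Th_sub_I_mul_pi (b c : ℂ) :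
    Th 0 0 (1 * b + -Real.pi, c - I * Real.pi) = 1 * cexp (0 * b ^ 2) * Th 0 0 (b, c) := by
  simp only [zero_mul, Complex.exp_zero, one_mul, Th]
  refine tsum_congr fun n => ?_
  obtain ⟨m, hm⟩ := Int.even_mul_pred_self n
  have hm' : (n : ℂ) * (n - 1) = m + m := by exact_mod_cast hm
  simp only [thTerm, pow_zero, one_mul, ofReal_zero, add_zero]
  rw [Complex.exp_eq_exp_iff_exists_int]
  refine ⟨m, ?_⟩
  linear_combination (I * Real.pi) * hm'

lemma Th_eq_jacobiTheta₂ (b c : ℂ) :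
    Th 0 0 (b, c) = jacobiTheta₂ (b / (2 * Real.pi)) (I * c / Real.pi) := by
  have hpi : (Real.pi : ℂ) ≠ 0 := by exact_mod_cast Real.pi_ne_zero
  refine tsum_congr fun n => ?_
  simp only [thTerm, jacobiTheta₂_term, pow_zero, one_mul, ofReal_zero, add_zero]
  congr 1
  field_simp
  linear_combination (-n ^ 2 * c) * I_sq

/-- This is τ ↦ −1/τ, by Jacobi's functional equation. -/
lemma exists_Th_inversion {c : ℂ} (hc : 0 < c.re) : ∃ K : ℂ, K ≠ 0 ∧ ∀ b,
    Th 0 0 (-(I * Real.pi) / c * b + 0, Real.pi ^ 2 / c) =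
      K * cexp (1 / (4 * c) * b ^ 2) * Th 0 0 (b, c) := by
  have hpi : (Real.pi : ℂ) ≠ 0 := by exact_mod_cast Real.pi_ne_zero
  have hc0 : c ≠ 0 := by rintro rfl; simp at hc
  have hcpow : (-I * (I * c / Real.pi)) ^ (1 / 2 : ℂ) ≠ 0 := by
    rw [Complex.cpow_ne_zero_iff]
    left
    have : I * c / Real.pi ≠ 0 := div_ne_zero (mul_ne_zero I_ne_zero hc0) hpi
    exact mul_ne_zero (neg_ne_zero.2 I_ne_zero) this
  refine ⟨(-I * (I * c / Real.pi)) ^ (1 / 2 : ℂ), hcpow, fun b => ?_⟩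
  have := jacobiTheta₂_functional_equation (b / (2 * Real.pi)) (I * c / Real.pi)
  have e1 : b / (2 * Real.pi) / (I * c / Real.pi) =
      (-(I * Real.pi) / c * b + 0) / (2 * Real.pi) := by
    field_simp
    linear_combination (b * Real.pi) * I_sq
  have e2 : -1 / (I * c / Real.pi) = I * (Real.pi ^ 2 / c) / Real.pi := by
    field_simp
    rw [I_sq]
  have e3 : -Real.pi * I * (b / (2 * Real.pi)) ^ 2 / (I * c / Real.pi) = -(1 / (4 * c) * b ^ 2) := by
    field_simp
    ring
  rw [e1, e2, e3, ← Th_eq_jacobiTheta₂, ← Th_eq_jacobiTheta₂, Complex.exp_neg] at this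
  rw [this]
  have := Complex.exp_ne_zero (1 / (4 * c) * b ^ 2)
  generalize (-I * (I * c / Real.pi)) ^ (1 / 2 : ℂ) = K at *
  generalize cexp (1 / (4 * c) * b ^ 2) = E at *
  generalize Th 0 0 (-(I * Real.pi) / c * b + 0, Real.pi ^ 2 / c) = y
  field_simp

lemma re_pi_sq_div_pos {c : ℂ} (hc : 0 < c.re) : 0 < ((Real.pi : ℂ) ^ 2 / c).re := by
  have hn : 0 < Complex.normSq c := Complex.normSq_pos.2 (by rintro rfl; simp at hc)
  have : ((Real.pi : ℂ) ^ 2 / c).re = Real.pi ^ 2 * (c.re / Complex.normSq c) := by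
    rw [show ((Real.pi : ℂ) ^ 2 / c) = ((Real.pi ^ 2 : ℝ) : ℂ) * c⁻¹ by push_cast; rfl,
      re_ofReal_mul, Complex.inv_re]
  rw [this]
  positivity

end HirotaTheta


namespace HirotaTheta

/-! ### The discriminant of the cubic -/

lemma analyticAt_coefS {c : ℂ} (hc : 0 < c.re) : AnalyticAt ℂ coefS c :=
  (analyticAt_coefR hc).deriv.neg.div analyticAt_const (by norm_num)

lemma analyticAt_invR {c : ℂ} (hc : 0 < c.re) : AnalyticAt ℂ invR c :=
  (analyticAt_const.mul ((analyticAt_coefE hc).pow 2)).add (analyticAt_coefR hc)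

lemma analyticAt_invS {c : ℂ} (hc : 0 < c.re) : AnalyticAt ℂ invS c :=
  ((analyticAt_const.mul ((analyticAt_coefE hc).pow 3)).sub
    ((analyticAt_const.mul (analyticAt_coefR hc)).mul (analyticAt_coefE hc))).sub
    (analyticAt_coefS hc)

/-- The discriminant of the cubic `2 x³ - 2 R x - S`, up to a factor. -/
noncomputable def disc (c : ℂ) : ℂ := 16 * invR c ^ 3 - 27 * invS c ^ 2

lemma analyticAt_disc {c : ℂ} (hc : 0 < c.re) : AnalyticAt ℂ disc c :=
  (analyticAt_const.mul ((analyticAt_invR hc).pow 3)).sub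
    (analyticAt_const.mul ((analyticAt_invS hc).pow 2))

lemma exists_double_root {R S : ℂ} (h : 16 * R ^ 3 - 27 * S ^ 2 = 0) :
    ∃ ρ : ℂ, R = 3 * ρ ^ 2 ∧ S = -4 * ρ ^ 3 := by
  by_cases hR : R = 0
  · have hS : S ^ 2 = 0 := by
      rw [hR] at h
      linear_combination (-1 / 27) * h
    exact ⟨0, by simp [hR], by simpa using hS⟩
  · refine ⟨-3 * S / (4 * R), ?_, ?_⟩
    · field_simp
      linear_combination h
    · field_simp
      linear_combination S * h

/-- With a double root ρ, the function z = e − ρ − u satisfies z_b² = z²(2z + 6ρ). Since u takes the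
value e − ρ, z has a zero, which forces z to vanish near it; but u is nowhere locally constant. -/
theorem disc_ne_zero {c : ℂ} (hc : 0 < c.re) : disc c ≠ 0 := by
  intro hd
  obtain ⟨ρ, hR, hS⟩ := exists_double_root hd
  have hf := differentiable_Th 0 0 hc
  obtain ⟨b₁, hb₁, hu⟩ := exists_logDeriv₂_Th_eq 0 hc ((coefE c - ρ) / 2)
  refine logDeriv₂_not_eventually_const hf ⟨b₁, hb₁⟩ ⟨_, Th_zero 0 c⟩ hb₁ ((coefE c - ρ) / 2) ?_
  have han : AnalyticAt ℂ (logDeriv₂ fun b => Th 0 0 (b, c)) b₁ :=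
    analyticAt_logDeriv₂ (hf.analyticAt b₁) hb₁
  have hz : AnalyticAt ℂ (fun b => coefE c - ρ - 2 * logDeriv₂ (fun b => Th 0 0 (b, c)) b) b₁ :=
    analyticAt_const.sub (analyticAt_const.mul han)
  have h0 := eventually_eq_zero_of_deriv_sq_eq hz
    (g := fun b => 2 * (coefE c - ρ - 2 * logDeriv₂ (fun b => Th 0 0 (b, c)) b) + 6 * ρ)
    (by rw [hu]; ring) ((continuousAt_const.mul hz.continuousAt).add continuousAt_const) (by
      filter_upwards [hf.continuous.continuousAt.eventually_ne hb₁] with b hb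
      have h1 := sq_deriv_logDeriv₂_Th 0 hc hb
      have h2 := cubic_eq c (coefE c - 2 * logDeriv₂ (fun b => Th 0 0 (b, c)) b)
      rw [sub_sub_cancel, hR, hS] at h2
      have h3 : deriv (fun b => coefE c - ρ - 2 * logDeriv₂ (fun b => Th 0 0 (b, c)) b) b =
          -(2 * deriv (logDeriv₂ fun b => Th 0 0 (b, c)) b) := by
        rw [deriv_const_sub, deriv_const_mul_field]
      rw [h3, neg_sq, h1, h2]
      ring)
  filter_upwards [h0] with b hb
  linear_combination (-1 / 2) * hb

/-! ### The absolute invariant -/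

/-- The absolute invariant of the cubic. -/
noncomputable def absInv (c : ℂ) : ℂ := invR c ^ 3 / disc c

lemma analyticAt_absInv {c : ℂ} (hc : 0 < c.re) : AnalyticAt ℂ absInv c :=
  ((analyticAt_invR hc).pow 3).div (analyticAt_disc hc) (disc_ne_zero hc)

lemma absInv_eq {c c' ν : ℂ} (hν : ν ≠ 0)
    (h : invR c = ν ^ 4 * invR c' ∧ invS c = ν ^ 6 * invS c') : absInv c = absInv c' := by
  rw [absInv, disc, h.1, h.2, absInv, disc]
  rw [show (ν ^ 4 * invR c') ^ 3 = ν ^ 12 * invR c' ^ 3 by ring,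
    show 16 * (ν ^ 12 * invR c' ^ 3) - 27 * (ν ^ 6 * invS c') ^ 2 =
      ν ^ 12 * (16 * invR c' ^ 3 - 27 * invS c' ^ 2) by ring,
    mul_div_mul_left _ _ (pow_ne_zero 12 hν)]

lemma absInv_sub_I_mul_pi {c : ℂ} (hc : 0 < c.re) : absInv (c - I * Real.pi) = absInv c :=
  (absInv_eq one_ne_zero (invariants_transform hc (by simpa using hc) one_ne_zero one_ne_zero
    fun b => Th_sub_I_mul_pi b c)).symm

lemma absInv_inversion {c : ℂ} (hc : 0 < c.re) : absInv (Real.pi ^ 2 / c) = absInv c := by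
  have hpi : (Real.pi : ℂ) ≠ 0 := by exact_mod_cast Real.pi_ne_zero
  have hc0 : c ≠ 0 := by rintro rfl; simp at hc
  have hν : -(I * Real.pi) / c ≠ 0 := div_ne_zero (neg_ne_zero.2 (mul_ne_zero I_ne_zero hpi)) hc0
  obtain ⟨K, hK, H⟩ := exists_Th_inversion hc
  exact (absInv_eq hν (invariants_transform hc (re_pi_sq_div_pos hc) hν hK H)).symm

/-! ### The cusp -/

/-- After multiplication by exp(ac), the terms with (n + s)² = a are constant and all others decay.
The terms at c = 1 dominate as soon as Re c ≥ 1. -/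
lemma tendsto_Th_cusp (s : ℝ) (k : ℕ) {a : ℝ} (ha : ∀ n : ℤ, a ≤ (n + s) ^ 2) :
    Tendsto (fun c => cexp (a * c) * Th s k (0, c)) (comap re atTop)
      (𝓝 (∑' n : ℤ, if (n + s) ^ 2 = a then (I * (n + s : ℂ)) ^ k else 0)) := by
  simp only [Th, ← tsum_mul_left]
  obtain ⟨u, hu, hb⟩ := exists_summable_bound s k one_pos 0
  have hterm : ∀ (c : ℂ) (n : ℤ), cexp (a * c) * thTerm s k (0, c) n =
      (I * (n + s)) ^ k * cexp (((a - (n + s) ^ 2 : ℝ) : ℂ) * c) := fun c n => by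
    rw [thTerm, mul_left_comm, ← Complex.exp_add]
    congr 2
    push_cast
    ring
  refine tendsto_tsum_of_dominated_convergence (hu.mul_left (Real.exp a)) (fun n => ?_) ?_
  · simp only [hterm]
    split_ifs with h
    · simpa [h] using tendsto_const_nhds
    · have hlt : a - (n + s) ^ 2 < 0 := sub_neg.2 (lt_of_le_of_ne (ha n) (Ne.symm h))
      rw [← mul_zero ((I * (n + s : ℂ)) ^ k)]
      refine Tendsto.const_mul _ (tendsto_zero_iff_norm_tendsto_zero.2 ?_)
      simp only [Complex.norm_exp, re_ofReal_mul]
      exact Real.tendsto_exp_atBot.comp (tendsto_comap.const_mul_atTop_of_neg hlt)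
  · filter_upwards [tendsto_comap.eventually_ge_atTop (1 : ℝ)] with c hc n
    have h1 := hb n (0, 1) (by simp) (by simp)
    refine le_trans ?_ (mul_le_mul_of_nonneg_left h1 (Real.exp_pos a).le)
    have h2 := hterm 1 n
    rw [mul_one] at h2
    rw [← Real.norm_of_nonneg (Real.exp_pos a).le, ← Complex.norm_real, Complex.ofReal_exp,
      ← norm_mul, h2, hterm, norm_mul, norm_mul, Complex.norm_exp, Complex.norm_exp,
      re_ofReal_mul, mul_one, ofReal_re]
    gcongr
    have := sub_nonpos.2 (ha n)
    nlinarith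

lemma tendsto_Th_zero_cusp (k : ℕ) :
    Tendsto (fun c => Th 0 k (0, c)) (comap re atTop) (𝓝 (0 ^ k)) := by
  have h := tendsto_Th_cusp 0 k (a := 0) fun n => by positivity
  rw [tsum_eq_single 0 fun n hn => if_neg (by simpa using hn)] at h
  simpa using h

lemma tendsto_Th_half_cusp (k : ℕ) : Tendsto (fun c => cexp (1 / 4 * c) * Th (1 / 2) k (0, c))
    (comap re atTop) (𝓝 ((I / 2) ^ k + (-I / 2) ^ k)) := by
  have key : ∀ n : ℤ, ((n : ℝ) + (1 / 2 : ℝ)) ^ 2 = 1 / 4 + ((n * (n + 1) : ℤ) : ℝ) := fun n => by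
    push_cast; ring
  have hnn : ∀ n : ℤ, 0 ≤ n * (n + 1) := fun n => by
    rcases le_or_gt 0 n with h | h
    · positivity
    · nlinarith
  have h := tendsto_Th_cusp (1 / 2) k (a := 1 / 4) fun n => by
    rw [key, le_add_iff_nonneg_right]
    exact_mod_cast hnn n
  -- The minimum 1/4 of (n + 1/2)² is attained exactly at n = 0 and n = −1.
  rw [tsum_eq_sum (s := {0, -1}) fun n hn => if_neg ?_] at h
  · rw [Finset.sum_pair (by norm_num), if_pos (by norm_num), if_pos (by norm_num)] at h
    convert h using 2
    · push_cast; rfl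
    · push_cast
      ring_nf
  · rw [key, add_eq_left, Int.cast_eq_zero, mul_eq_zero, not_or]
    simp only [Finset.mem_insert, Finset.mem_singleton, not_or] at hn
    exact ⟨hn.1, by omega⟩

lemma tendsto_two_mul_cusp : Tendsto (fun c : ℂ => 2 * c) (comap re atTop) (comap re atTop) := by
  refine tendsto_comap_iff.2 ?_
  have : re ∘ (fun c : ℂ => 2 * c) = fun c => 2 * re c := by ext c; simp
  rw [this]
  exact tendsto_comap.const_mul_atTop two_pos

lemma tendsto_coef_cusp : Tendsto coefE (comap re atTop) (𝓝 (-1 / 6)) ∧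
    Tendsto coefR (comap re atTop) (𝓝 0) := by
  have h0 := fun k => (tendsto_Th_zero_cusp k).comp tendsto_two_mul_cusp
  have h1 := fun k => (tendsto_Th_half_cusp k).comp tendsto_two_mul_cusp
  have hE : ∀ c : ℂ, cexp (1 / 4 * (2 * c)) ≠ 0 := fun c => Complex.exp_ne_zero _
  have hW := ((h0 0).mul (h1 2)).sub ((h1 0).mul (h0 2))
  constructor
  · have := ((((h0 0).mul (h1 4)).sub ((h1 0).mul (h0 4))).const_mul (2 / 3)).div hW (by
      norm_num [div_pow])
    convert this using 1
    · funext c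
      rw [coefE, wronskian]
      simp only [Pi.div_apply, Function.comp_apply]
      rw [← mul_div_mul_left _ _ (hE c)]
      ring
    · norm_num [div_pow]
  · have := ((((h0 4).mul (h1 2)).sub ((h1 4).mul (h0 2))).const_mul 16).div hW (by
      norm_num [div_pow])
    convert this using 1
    · funext c
      rw [coefR, wronskian]
      simp only [Pi.div_apply, Function.comp_apply]
      rw [← mul_div_mul_left _ _ (hE c)]
      ring
    · norm_num

/-- Instead of differentiating r, the Weierstrass equation at b = 0 is solved for s; the theta
solution of characteristic (0, 0) has f_b and f_bb tending to 0 there. -/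
lemma tendsto_coefS_cusp : Tendsto coefS (comap re atTop) (𝓝 0) := by
  have h := tendsto_Th_zero_cusp
  obtain ⟨hE, hR⟩ := tendsto_coef_cusp
  have h1 := (((h 0).mul (h 2)).sub ((h 1).pow 2)).const_mul 2 |>.div ((h 0).pow 2) (by simp)
  have h2 := (((((h 0).pow 2).mul (h 3)).sub ((((h 0).const_mul 3).mul (h 1)).mul (h 2))).add
    (((h 1).pow 3).const_mul 2)).const_mul 2 |>.div ((h 0).pow 3) (by simp)
  have h3 := (((h2.pow 2).sub ((hE.const_mul 6).mul (h1.pow 2))).add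
    ((h1.pow 3).const_mul 2)).sub ((hR.const_mul 2).mul h1)
  have h4 : Tendsto _ _ _ := h3
  norm_num at h4
  refine h4.congr' ?_
  filter_upwards [tendsto_comap.eventually_gt_atTop (0 : ℝ),
    (h 0).eventually_ne (by norm_num : (0 : ℂ) ^ 0 ≠ 0)] with c hc hne
  have hmem : (0, c) ∈ thetaDomain 0 0 := ⟨hc, by simpa [psi_eq] using hne⟩
  have e := sq_pdb_pdb_fTheta hmem
  have e1 := pdb_fTheta 0 0 hmem
  have e2 := pdb_pdb_fTheta 0 0 hmem
  simp only [zero_div, ofReal_zero, mul_zero, add_zero] at e1 e2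
  rw [cubic, e1, e2] at e
  linear_combination e

/-- The limits R = 1/12 and S = 1/54 belong to a degenerate cubic, as 16/12³ = 27/54². So the
absolute invariant has a pole at the cusp. -/
lemma tendsto_inv_cusp : Tendsto invR (comap re atTop) (𝓝 (1 / 12)) ∧
    Tendsto disc (comap re atTop) (𝓝 0) := by
  obtain ⟨hE, hR⟩ := tendsto_coef_cusp
  have h1 : Tendsto invR (comap re atTop) (𝓝 (1 / 12)) := by
    convert ((hE.pow 2).const_mul 3).add hR using 2
    · rfl
    · norm_num
  have h2 : Tendsto invS (comap re atTop) (𝓝 (1 / 54)) := by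
    convert (((hE.pow 3).const_mul (-4)).sub ((hR.const_mul 2).mul hE)).sub tendsto_coefS_cusp
      using 2
    · rfl
    · norm_num
  refine ⟨h1, ?_⟩
  convert ((h1.pow 3).const_mul 16).sub ((h2.pow 2).const_mul 27) using 2
  · rfl
  · norm_num

lemma tendsto_norm_absInv_cusp : Tendsto (fun c => ‖absInv c‖) (comap re atTop) atTop := by
  obtain ⟨hR, hD⟩ := tendsto_inv_cusp
  have h1 : Tendsto (fun c => ‖disc c‖⁻¹) (comap re atTop) atTop := by
    refine tendsto_inv_nhdsGT_zero.comp (tendsto_nhdsWithin_iff.2 ⟨by simpa using hD.norm, ?_⟩)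
    filter_upwards [tendsto_comap.eventually_gt_atTop (0 : ℝ)] with c hc
    exact norm_pos_iff.2 (disc_ne_zero hc)
  have h2 := (hR.pow 3).norm.pos_mul_atTop (by norm_num) h1
  refine h2.congr fun c => ?_
  rw [absInv, norm_div, div_eq_mul_inv]

end HirotaTheta


namespace HirotaTheta

/-! ### Surjectivity of the absolute invariant -/

lemma absInv_smul (g : Matrix.SpecialLinearGroup (Fin 2) ℤ) (τ : UpperHalfPlane) :
    absInv (-(I * Real.pi) * (g • τ : UpperHalfPlane)) = absInv (-(I * Real.pi) * τ) := by
  have hpos : ∀ τ : UpperHalfPlane, 0 < (-(I * Real.pi) * (τ : ℂ)).re := fun τ => by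
    simpa using mul_pos Real.pi_pos τ.im_pos
  have hpi : (Real.pi : ℂ) ≠ 0 := by exact_mod_cast Real.pi_ne_zero
  have hg : g ∈ Subgroup.closure {ModularGroup.S, ModularGroup.T} := by
    simp [SpecialLinearGroup.SL2Z_generators]
  induction hg using Subgroup.closure_induction generalizing τ with
  | mem g hg =>
    rcases hg with rfl | rfl
    · rw [UpperHalfPlane.modular_S_smul, ← absInv_inversion (hpos τ)]
      congr 1
      have := τ.ne_zero
      field_simp
      linear_combination I_sq
    · rw [UpperHalfPlane.modular_T_smul, ← absInv_sub_I_mul_pi (hpos τ)]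
      congr 1
      rw [UpperHalfPlane.coe_vadd]
      push_cast
      ring
  | one => rw [one_smul]
  | mul g h _ _ hg hh => rw [mul_smul, hg, hh]
  | inv g _ hg => rw [← hg (g⁻¹ • τ), smul_inv_smul]

lemma exists_absInv_eq_of_pos {c : ℂ} (hc : 0 < c.re) :
    ∃ c', Real.pi / 2 ≤ c'.re ∧ |c'.im| ≤ Real.pi / 2 ∧ absInv c' = absInv c := by
  have hpi : (Real.pi : ℂ) ≠ 0 := by exact_mod_cast Real.pi_ne_zero
  have him : 0 < (I * c / Real.pi).im := by
    rw [div_ofReal_im, I_mul_im]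
    exact div_pos hc Real.pi_pos
  let τ : UpperHalfPlane := ⟨I * c / Real.pi, him⟩
  obtain ⟨g, hg⟩ := ModularGroup.exists_smul_mem_fd τ
  refine ⟨-(I * Real.pi) * (g • τ : UpperHalfPlane), ?_, ?_, ?_⟩
  · have h1 := ModularGroup.three_le_four_mul_im_sq_of_mem_fd hg
    have h2 := (g • τ).im_pos
    -- Im τ ≥ √3/2 on the fundamental domain; the cruder bound 1/2 suffices for Re c ≥ π/2.
    have h3 : 1 / 2 ≤ (g • τ).im := by nlinarith
    have h4 : (-(I * Real.pi) * ((g • τ : UpperHalfPlane) : ℂ)).re = Real.pi * (g • τ).im := by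
      simp
    rw [h4]
    nlinarith [Real.pi_pos]
  · have h4 : (-(I * Real.pi) * ((g • τ : UpperHalfPlane) : ℂ)).im = -(Real.pi * (g • τ).re) := by
      simp
    rw [h4, abs_neg, abs_mul, abs_of_pos Real.pi_pos]
    nlinarith [Real.pi_pos, hg.2]
  · rw [absInv_smul]
    congr 1
    change -(I * Real.pi) * (I * c / Real.pi) = c
    field_simp
    linear_combination (-c) * I_sq

/-- The absolute invariant takes every value on the half-plane. -/
theorem exists_absInv_eq (t : ℂ) : ∃ c : ℂ, 0 < c.re ∧ absInv c = t := by
  have han : AnalyticOnNhd ℂ absInv {c : ℂ | 0 < c.re} := fun c hc => analyticAt_absInv hc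
  have hopen : IsOpen (absInv '' {c : ℂ | 0 < c.re}) := by
    rcases han.is_constant_or_isOpen (convex_halfSpace_re_gt 0).isPreconnected with ⟨w, hw⟩ | h
    · exfalso
      have h1 := tendsto_norm_absInv_cusp.eventually_gt_atTop ‖w‖
      have hne : (comap re atTop).NeBot := comap_neBot fun s hs => by
        obtain ⟨x, hx⟩ := (mem_atTop_sets.1 hs)
        exact ⟨(x : ℂ), hx x le_rfl⟩
      obtain ⟨c, hc, hc0⟩ := (h1.and (tendsto_comap.eventually_gt_atTop (0 : ℝ))).exists
      rw [hw c hc0] at hc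
      exact lt_irrefl _ hc
    · exact h _ subset_rfl (isOpen_lt continuous_const Complex.continuous_re)
  have hclosed : IsClosed (absInv '' {c : ℂ | 0 < c.re}) := by
    refine IsSeqClosed.isClosed fun x t hx hlim => ?_
    obtain ⟨B, hB⟩ := hlim.norm.bddAbove_range
    -- Near the cusp the invariant exceeds the bound of the convergent sequence, so representatives
    -- in the fundamental domain stay in a compact rectangle.
    obtain ⟨M, hM⟩ : ∃ M : ℝ, ∀ c : ℂ, M ≤ c.re → B < ‖absInv c‖ := by
      obtain ⟨s, hs, hsub⟩ := mem_comap.1 (tendsto_norm_absInv_cusp.eventually_gt_atTop B)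
      obtain ⟨M, hM⟩ := mem_atTop_sets.1 hs
      exact ⟨M, fun c hc => hsub (hM _ hc)⟩
    have hK : IsCompact (Set.Icc (Real.pi / 2) M ×ℂ Set.Icc (-(Real.pi / 2)) (Real.pi / 2)) :=
      isCompact_Icc.reProdIm isCompact_Icc
    have hsub : Set.Icc (Real.pi / 2) M ×ℂ Set.Icc (-(Real.pi / 2)) (Real.pi / 2) ⊆
        {c : ℂ | 0 < c.re} := fun c hc => (half_pos Real.pi_pos).trans_le hc.1.1
    have himg := (hK.image_of_continuousOn (han.continuousOn.mono hsub)).isClosed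
    refine Set.image_mono hsub (himg.mem_of_tendsto hlim (Eventually.of_forall fun n => ?_))
    obtain ⟨c, hc, hcn⟩ := hx n
    obtain ⟨c', h1, h2, h3⟩ := exists_absInv_eq_of_pos hc
    refine ⟨c', ⟨⟨h1, ?_⟩, abs_le.1 h2⟩, h3.trans hcn⟩
    by_contra! hlt
    have h4 := hM c' hlt.le
    rw [h3, hcn] at h4
    exact absurd (hB ⟨n, rfl⟩) (not_le.2 h4)
  have huniv := IsClopen.eq_univ ⟨hclosed, hopen⟩ ⟨_, 1, by simp, rfl⟩
  exact (huniv ▸ Set.mem_univ t : t ∈ absInv '' {c : ℂ | 0 < c.re})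

end HirotaTheta


namespace HirotaTheta

/-! ### The generic two-jets -/

section JetPolynomials

variable {A : Type*} [CommRing A] (j : Fin 6 → A)

/-- `δ = f f_b - f_c`, as a polynomial in the 2-jet. -/
def jetD : A := j 0 * j 1 - j 2

/-- The derivative `δ_b`. -/
def jetDb : A := j 0 * j 3 + j 1 ^ 2 - j 4

/-- The expression `f δ_b - δ_c`, up to a correction a multiple of the Weierstrass function. -/
def jetQ : A := j 2 * j 1 + j 0 * j 4 - j 5 - j 0 * jetDb j - 3 * j 1 * jetD j

/-- The quadratic invariant of the cubic attached to a 2-jet. -/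
def jetR : A := jetQ j ^ 2 - 12 * jetDb j * jetD j ^ 2

/-- The constant term of the cubic attached to a 2-jet. -/
def jetS : A := jetQ j ^ 3 - 3 * jetR j * jetQ j + 108 * j 3 * jetD j ^ 4

/-- The polynomial whose nonvanishing defines generic 2-jets. -/
def jetP : A := jetD j * j 3 * jetR j * jetS j * (4 * jetR j ^ 3 - jetS j ^ 2)

end JetPolynomials

lemma eval_jetP (J : Fin 6 → ℂ) : MvPolynomial.eval J (jetP MvPolynomial.X) = jetP J := by
  simp [jetP, jetS, jetR, jetQ, jetDb, jetD]

/-- The 2-jet of a theta solution, in terms of `f`, `u = f_b`, `v = f_bb` and `x = e - u`. -/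
lemma jet_fTheta {α β : ℝ} {q : ℂ × ℂ} (hq : q ∈ thetaDomain α β) :
    ∃ x, x = coefE q.2 - pdb (fTheta α β) q ∧
      pdc (fTheta α β) q =
        pdb (pdb (fTheta α β)) q + fTheta α β q * pdb (fTheta α β) q ∧
      pdc (pdb (fTheta α β)) q = invR q.2 - 3 * x ^ 2
        + fTheta α β q * pdb (pdb (fTheta α β)) q + pdb (fTheta α β) q ^ 2 ∧
      pdc (pdc (fTheta α β)) q = 6 * x * pdb (pdb (fTheta α β)) q
        + 2 * fTheta α β q * (invR q.2 - 3 * x ^ 2)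
        + 4 * pdb (fTheta α β) q * pdb (pdb (fTheta α β)) q
        + 2 * fTheta α β q * pdb (fTheta α β) q ^ 2
        + fTheta α β q ^ 2 * pdb (pdb (fTheta α β)) q ∧
      pdb (pdb (fTheta α β)) q ^ 2 = 2 * x ^ 3 - 2 * invR q.2 * x - invS q.2 := by
  have h := isEllipticBurgers_fTheta α β
  have e3 : (pdb^[3] (fTheta α β)) q = _ := h.iterate_three hq
  have e4 : (pdb^[4] (fTheta α β)) q = _ := h.iterate_four hq
  have ec : pdc (pdb (fTheta α β)) q = _ := h.pdc_one hq
  have ecc := h.pdc_pdc hq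
  have e := sq_pdb_pdb_fTheta hq
  have e1 : (pdb^[1] (fTheta α β)) q = pdb (fTheta α β) q := rfl
  have e2 : (pdb^[2] (fTheta α β)) q = pdb (pdb (fTheta α β)) q := rfl
  have e0 : (pdb^[0] (fTheta α β)) q = fTheta α β q := rfl
  simp only [e0, e1, e2] at e3 e4 ec ecc
  refine ⟨_, rfl, h.burgers q hq, ?_, ?_, ?_⟩
  · rw [ec, e3, invR]
    ring
  · rw [ecc, e3, e4, invR]
    ring
  · rw [e, cubic, invR, invS]
    ring

/-- The prescribed value is the absolute invariant of a cubic whose R and S are R'/12 and S'/108 up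
to weighted scaling, the normalisation in which `jetR` and `jetS` see a theta solution. -/
lemma exists_absInv_data {R' S' : ℂ} (hR' : R' ≠ 0) (hS' : S' ≠ 0)
    (hd' : 4 * R' ^ 3 - S' ^ 2 ≠ 0) : ∃ c : ℂ, 0 < c.re ∧ invR c ≠ 0 ∧ invS c ≠ 0 ∧
      4 * invR c ^ 3 * S' ^ 2 = 27 * R' ^ 3 * invS c ^ 2 := by
  obtain ⟨c, hc, hJ⟩ := exists_absInv_eq (R' ^ 3 / (4 * (4 * R' ^ 3 - S' ^ 2)))
  have hd := disc_ne_zero hc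
  rw [absInv, div_eq_div_iff hd (mul_ne_zero (by norm_num) hd')] at hJ
  have hR : invR c ≠ 0 := fun h => by
    rw [h, zero_pow three_ne_zero, zero_mul] at hJ
    exact mul_ne_zero (pow_ne_zero 3 hR') hd hJ.symm
  have key : 4 * invR c ^ 3 * S' ^ 2 = 27 * R' ^ 3 * invS c ^ 2 := by
    rw [disc] at hJ
    linear_combination -hJ
  refine ⟨c, hc, hR, fun h => ?_, key⟩
  rw [h, zero_pow two_ne_zero, mul_zero] at key
  exact mul_ne_zero (mul_ne_zero (by norm_num) (pow_ne_zero 3 hR)) (pow_ne_zero 2 hS') key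

theorem exists_jetP_fTheta_ne_zero (α β : ℝ) :
    ∃ q ∈ thetaDomain α β, jetP (jet2 (fTheta α β) q) ≠ 0 := by
  -- Any admissible data would do: all that is needed is some c at which both invariants are
  -- nonzero.
  obtain ⟨c, hc, hR, hS, -⟩ := exists_absInv_data (R' := 1) (S' := 1) one_ne_zero one_ne_zero
    (by norm_num)
  obtain ⟨b, hq, hv⟩ := exists_pdb_pdb_fTheta_ne_zero α β hc
  refine ⟨_, hq, ?_⟩
  obtain ⟨x, -, h1, h2, h3, h4⟩ := jet_fTheta hq
  have hd := disc_ne_zero hc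
  simp only at h2 h3 h4
  have key : jetP (jet2 (fTheta α β) (b, c)) = 12 * 108 * 432 *
      (invR c * invS c * disc c * pdb (pdb (fTheta α β)) (b, c) ^ 13) := by
    -- With v = f_bb, the polynomials `jetD`, `jetQ`, `jetR`, `jetS` evaluate to −v, −6xv, 12Rv²,
    -- −108Sv³, so they recover x and the invariants up to powers of v.
    have eD : jetD (jet2 (fTheta α β) (b, c)) = -pdb (pdb (fTheta α β)) (b, c) := by
      simp only [jetD, jet2, Matrix.cons_val]
      rw [h1]
      ring
    have eDb : jetDb (jet2 (fTheta α β) (b, c)) = 3 * x ^ 2 - invR c := by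
      simp only [jetDb, jet2, Matrix.cons_val]
      rw [h2]
      ring
    have eQ : jetQ (jet2 (fTheta α β) (b, c)) = -6 * x * pdb (pdb (fTheta α β)) (b, c) := by
      rw [jetQ, eD, eDb]
      simp only [jet2, Matrix.cons_val]
      rw [h1, h2, h3]
      ring
    have eR : jetR (jet2 (fTheta α β) (b, c)) =
        12 * invR c * pdb (pdb (fTheta α β)) (b, c) ^ 2 := by
      rw [jetR, eQ, eD, eDb]
      ring
    have eS : jetS (jet2 (fTheta α β) (b, c)) =
        -108 * invS c * pdb (pdb (fTheta α β)) (b, c) ^ 3 := by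
      rw [jetS, eQ, eD, eR]
      simp only [jet2, Matrix.cons_val]
      linear_combination 108 * pdb (pdb (fTheta α β)) (b, c) ^ 3 * h4
    rw [jetP, eD, eR, eS, disc]
    simp only [jet2, Matrix.cons_val]
    ring
  rw [key]
  refine mul_ne_zero (by norm_num) ?_
  exact mul_ne_zero (mul_ne_zero (mul_ne_zero hR hS) hd) (pow_ne_zero 13 hv)

/-- The parameters of a transformation matter only up to a common scale, which den = 1 normalises.
What remains are k, Δ, N, γ and the image point, six free numbers for the six entries of a 2-jet. -/
lemma exists_transf (p q : ℂ × ℂ) {k Δ : ℂ} (hk : k ≠ 0) (hΔ : Δ ≠ 0) (N γ : ℂ) :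
    ∃ g : Transf, g.k = k ∧ g.γ = γ ∧ g.det = Δ ∧ g.den p = 1 ∧ g.num p = N ∧ g.pt p = q := by
  have hdet : (Δ + γ * q.2) * (1 - γ * p.2) - (q.2 - (Δ + γ * q.2) * p.2) * γ = Δ := by ring
  refine ⟨⟨k, N + γ * q.1, q.1 - k * p.1 - (N + γ * q.1) * p.2, Δ + γ * q.2,
    q.2 - (Δ + γ * q.2) * p.2, γ, 1 - γ * p.2, hk, hdet.trans_ne hΔ⟩, rfl, rfl, hdet, ?_, ?_, ?_⟩
  · rw [Transf.den]
    ring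
  · rw [Transf.num]
    ring
  · have : γ * p.2 + (1 - γ * p.2) = 1 := by ring
    simp only [Transf.pt, this, div_one]
    ext
    · ring
    · ring

/-- The 2-jet of a transform at a point where the denominator is normalised. -/
lemma jet2_act_of_den_eq_one {U : Set (ℂ × ℂ)} {f : ℂ × ℂ → ℂ} (hU : IsOpen U)
    (hf : AnalyticOnNhd ℂ f U) {g : Transf} {p : ℂ × ℂ} (hp : p ∈ g.dom U) (hD : g.den p = 1) :
    jet2 (g.act f) p =
      ![(g.det * f (g.pt p) + g.num p) / g.k,
        g.det * pdb f (g.pt p) - g.γ,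
        g.det * (g.det * pdc f (g.pt p) + g.num p * pdb f (g.pt p)) / g.k
          - g.γ * (g.det * f (g.pt p) + g.num p) / g.k,
        g.det * g.k * pdb (pdb f) (g.pt p),
        g.det * (g.det * pdc (pdb f) (g.pt p) + g.num p * pdb (pdb f) (g.pt p))
          - 2 * g.γ * g.det * pdb f (g.pt p) + g.γ ^ 2,
        g.det * (g.det ^ 2 * pdc (pdc f) (g.pt p) + 2 * g.det * g.num p * pdc (pdb f) (g.pt p)
          + g.num p ^ 2 * pdb (pdb f) (g.pt p)) / g.k
          - 4 * g.γ * g.det * (g.det * pdc f (g.pt p) + g.num p * pdb f (g.pt p)) / g.k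
          + 2 * g.γ ^ 2 * (g.det * f (g.pt p) + g.num p) / g.k] := by
  rw [jet2, g.act_eq, Transf.pdb_act hf hp, Transf.pdc_act hf hp, Transf.pdb_pdb_act hU hf hp,
    Transf.pdc_pdb_act hU hf hp, Transf.pdc_pdc_act hU hf hp]
  simp only [hD, one_pow, mul_one, div_one]

/-- Every generic 2-jet is the 2-jet of a transform of a theta solution. -/
theorem exists_jet2_act_fTheta_eq (α β : ℝ) {J : Fin 6 → ℂ} (p : ℂ × ℂ) (hJ : jetP J ≠ 0) :
    ∃ g : Transf, p ∈ g.dom (thetaDomain α β) ∧ jet2 (g.act (fTheta α β)) p = J := by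
  rw [jetP, mul_ne_zero_iff, mul_ne_zero_iff, mul_ne_zero_iff, mul_ne_zero_iff] at hJ
  obtain ⟨⟨⟨⟨hD, hJ3⟩, hR'⟩, hS'⟩, hd'⟩ := hJ
  obtain ⟨c, hc, hR, hS, hRS⟩ := exists_absInv_data hR' hS' hd'
  -- Δ is the scale dictated by the quotient of the two matching conditions `eS` and `eR`; the
  -- choice of c then makes each of them hold.
  obtain ⟨Δ, hΔ⟩ : ∃ Δ, Δ = jetS J * invR c / (9 * invS c * jetR J * jetD J) := ⟨_, rfl⟩
  have hΔ0 : Δ ≠ 0 := by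
    rw [hΔ]
    refine div_ne_zero (mul_ne_zero hS' hR) ?_
    exact mul_ne_zero (mul_ne_zero (mul_ne_zero (by norm_num) hS) hR') hD
  have eR : 12 * jetD J ^ 2 * (Δ ^ 2 * invR c) = jetR J := by
    rw [hΔ]
    field_simp
    linear_combination 3 * hRS
  have eS : 108 * jetD J ^ 3 * (Δ ^ 3 * invS c) = jetS J := by
    rw [hΔ]
    field_simp
    linear_combination 27 * hRS
  -- The value of f_b is chosen so that x = e − f_b matches `jetQ`.
  obtain ⟨b, hq, hu⟩ := exists_pdb_fTheta_eq α β hc (coefE c - jetQ J / (6 * jetD J * Δ))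
  obtain ⟨x, hx, h1, h2, h3, h4⟩ := jet_fTheta hq
  simp only at h2 h3 h4 hx
  rw [hu, sub_sub_cancel] at hx
  have eQ : 6 * jetD J * (Δ * x) = jetQ J := by
    rw [hx]
    field_simp
  clear hu
  generalize hu : pdb (fTheta α β) (b, c) = u at *
  generalize hv : pdb (pdb (fTheta α β)) (b, c) = v at *
  generalize hF : fTheta α β (b, c) = F at *
  have hsq : Δ ^ 3 * v ^ 2 = -(J 3 * jetD J) := by
    have h5 : 108 * jetD J ^ 3 * (Δ ^ 3 * v ^ 2) = jetQ J ^ 3 - 3 * jetR J * jetQ J - jetS J := by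
      rw [← eQ, ← eS, ← eR, h4]
      ring
    have h6 : 108 * jetD J ^ 3 * (Δ ^ 3 * v ^ 2 + J 3 * jetD J) = 0 := by
      rw [jetS] at h5
      linear_combination h5
    have h7 := (mul_eq_zero.1 h6).resolve_left (mul_ne_zero (by norm_num) (pow_ne_zero 3 hD))
    linear_combination h7
  have hv0 : v ≠ 0 := fun h => by
    rw [h, zero_pow two_ne_zero, mul_zero, zero_eq_neg] at hsq
    exact mul_ne_zero hJ3 hD hsq
  -- The cubic determines only v²; the sign of v is absorbed by k, which is fixed by matching f f_b
  -- − f_c. The entry f_bb then comes out right by `hsq`.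
  obtain ⟨k, hk⟩ : ∃ k, k = -(Δ ^ 2 * v) / jetD J := ⟨_, rfl⟩
  have hk0 : k ≠ 0 := by
    rw [hk]
    exact div_ne_zero (neg_ne_zero.2 (mul_ne_zero (pow_ne_zero 2 hΔ0) hv0)) hD
  have ek : Δ ^ 2 * v + k * jetD J = 0 := by
    rw [hk]
    field_simp
    ring
  have e3 : Δ * k * v = J 3 := by
    have : jetD J * (Δ * k * v - J 3) = 0 := by linear_combination Δ * v * ek - hsq
    exact sub_eq_zero.1 ((mul_eq_zero.1 this).resolve_left hD)
  have eDb : Δ ^ 2 * (3 * x ^ 2 - invR c) = jetDb J := by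
    have : 12 * jetD J ^ 2 * (Δ ^ 2 * (3 * x ^ 2 - invR c) - jetDb J) = 0 := by
      have h5 := eR
      rw [jetR, ← eQ] at h5
      linear_combination -h5
    exact sub_eq_zero.1 ((mul_eq_zero.1 this).resolve_left
      (mul_ne_zero (by norm_num) (pow_ne_zero 2 hD)))
  -- N and γ enter the transformed f and f_b additively, so they are chosen to give these the values
  -- J 0 and J 1.
  obtain ⟨g, gk, gγ, gdet, gden, gnum, gpt⟩ :=
    exists_transf p (b, c) hk0 hΔ0 (k * J 0 - Δ * F) (Δ * u - J 1)
  have hmem : p ∈ g.dom (thetaDomain α β) := by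
    refine ⟨?_, gpt ▸ hq⟩
    have : g.den p ≠ 0 := gden ▸ one_ne_zero
    exact this
  refine ⟨g, hmem, ?_⟩
  rw [jet2_act_of_den_eq_one (isOpen_thetaDomain α β) (isEllipticBurgers_fTheta α β).analytic hmem
    gden, gk, gγ, gdet, gnum, gpt, hF, hv, hu, h1, h2, h3]
  rw [jetD] at ek eQ
  rw [jetDb] at eDb
  rw [jetQ, jetDb, jetD] at eQ
  ext i
  fin_cases i <;> simp only [Matrix.cons_val, Fin.zero_eta, Fin.mk_one, Fin.reduceFinMk]
  · field_simp
    ring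
  · ring
  · field_simp
    linear_combination ek
  · exact e3
  · linear_combination -eDb + J 0 * e3
  · field_simp
    linear_combination (6 * Δ * x + 4 * J 1) * ek - k * eQ - 2 * k * J 0 * eDb + k * J 0 ^ 2 * e3

/-- A generic solution coincides locally with a transform of a theta solution. -/
theorem IsSolutionOn.exists_eventuallyEq_act_fTheta (α β : ℝ) {U : Set (ℂ × ℂ)} {f : ℂ × ℂ → ℂ}
    (h : IsSolutionOn f U) {p : ℂ × ℂ} (hp : p ∈ U) (hJ : jetP (jet2 f p) ≠ 0) :
    ∃ g : Transf, p ∈ g.dom (thetaDomain α β) ∧ f =ᶠ[𝓝 p] g.act (fTheta α β) := by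
  obtain ⟨g, hg, hj⟩ := exists_jet2_act_fTheta_eq α β p hJ
  refine ⟨g, hg, h.eventuallyEq_of_jet2_eq ((isSolutionOn_fTheta α β).act g) hp hg hj.symm ?_⟩
  rw [jetP, mul_ne_zero_iff, mul_ne_zero_iff, mul_ne_zero_iff, mul_ne_zero_iff] at hJ
  exact hJ.1.1.1.1

end HirotaTheta

theorem mainTheorem2 :
    -- every theta series converges, satisfies the heat equation and the ODE, and yields a solution
    (∀ α β : ℝ,
      (∀ τ z : ℂ, 0 < τ.im → Summable (HirotaTheta.thetaTerm α β τ z)) ∧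
      AnalyticOnNhd ℂ (HirotaTheta.psi α β) HirotaTheta.halfSpace ∧
      (∀ p ∈ HirotaTheta.halfSpace,
        HirotaTheta.pdc (HirotaTheta.psi α β) p =
          HirotaTheta.pdb (HirotaTheta.pdb (HirotaTheta.psi α β)) p) ∧
      (∀ p ∈ HirotaTheta.halfSpace,
        HirotaTheta.sixthOrderODE (HirotaTheta.psi α β) p = 0) ∧
      (HirotaTheta.thetaDomain α β).Nonempty ∧
      HirotaTheta.IsSolutionOn (HirotaTheta.fTheta α β) (HirotaTheta.thetaDomain α β)) ∧
    -- the transformations are symmetries of the system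
    (∀ (g : HirotaTheta.Transf) (U : Set (ℂ × ℂ)) (f : ℂ × ℂ → ℂ),
      HirotaTheta.IsSolutionOn f U → HirotaTheta.IsSolutionOn (g.act f) (g.dom U)) ∧
    -- up to these symmetries, the generic solution is the one given by any theta series
    (∃ P : MvPolynomial (Fin 6) ℂ, P ≠ 0 ∧
      ∀ α β : ℝ,
        (∃ p ∈ HirotaTheta.thetaDomain α β,
          MvPolynomial.eval (HirotaTheta.jet2 (HirotaTheta.fTheta α β) p) P ≠ 0) ∧
        (∀ (J : Fin 6 → ℂ) (p : ℂ × ℂ), MvPolynomial.eval J P ≠ 0 →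
          ∃ g : HirotaTheta.Transf, p ∈ g.dom (HirotaTheta.thetaDomain α β) ∧
            HirotaTheta.jet2 (g.act (HirotaTheta.fTheta α β)) p = J) ∧
        (∀ (U : Set (ℂ × ℂ)) (f : ℂ × ℂ → ℂ), HirotaTheta.IsSolutionOn f U →
          ∀ p ∈ U, MvPolynomial.eval (HirotaTheta.jet2 f p) P ≠ 0 →
            ∃ g : HirotaTheta.Transf, p ∈ g.dom (HirotaTheta.thetaDomain α β) ∧
              ∀ᶠ q in 𝓝 p, f q = g.act (HirotaTheta.fTheta α β) q)) := by
  refine ⟨fun α β => ⟨fun τ z hτ => HirotaTheta.summable_thetaTerm α β z hτ,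
    HirotaTheta.analyticOnNhd_psi α β, fun p hp => HirotaTheta.pdc_psi α β hp,
    fun p hp => HirotaTheta.sixthOrderODE_psi α β hp, HirotaTheta.thetaDomain_nonempty α β,
    HirotaTheta.isSolutionOn_fTheta α β⟩, fun g U f hf => hf.act g,
    HirotaTheta.jetP MvPolynomial.X, ?_, fun α β => ⟨?_, ?_, ?_⟩⟩
  · intro h
    obtain ⟨q, -, hq⟩ := HirotaTheta.exists_jetP_fTheta_ne_zero 0 0
    rw [← HirotaTheta.eval_jetP, h, map_zero] at hq
    exact hq rfl
  · simp only [HirotaTheta.eval_jetP]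
    exact HirotaTheta.exists_jetP_fTheta_ne_zero α β
  · intro J p hJ
    rw [HirotaTheta.eval_jetP] at hJ
    exact HirotaTheta.exists_jet2_act_fTheta_eq α β p hJ
  · intro U f hf p hp hJ
    rw [HirotaTheta.eval_jetP] at hJ
    exact hf.exists_eventuallyEq_act_fTheta α β hp hJ
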